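/- **Setting.** Let $B=B_0\oplus B_1$ be an algebra of supernumbers: a $\mathbb Z_2$-graded supercommutative real Banach algebra with closed homogeneous parts in which only $0$ is annihilated by all odd elements (e.g. the $\ell^1$ Grassmann algebra on countably many generators). Let $\Gamma^p$ be finitely many phase-space coordinates of parity $\varepsilon_p$, with values in $B_{\varepsilon_p}$, and let $\{f,g\}=\frac{\partial_r f}{\partial\Gamma^p}\,\omega^{pq}\,\frac{\partial_l g}{\partial\Gamma^q}$ be the Poisson superbracket of a constant invertible even supermatrix $\omega^{pq}=-(-1)^{\varepsilon_p\varepsilon_q}\omega^{qp}$. Let $\Omega^a$, $a=1,2$, be odd, three times continuously superdifferentiable functions with $\{\Omega^a,\Omega^b\}=0$; put $s^a=\{\,\cdot\,,\Omega^a\}$, $s^2=\varepsilon_{ab}s^bs^a$, $X^{pa}=s^a\Gamma^p$, $Y^p=-\tfrac12 s^2\Gamma^p$, where $\varepsilon^{ab}$, $\varepsilon_{ab}$ are antisymmetric, $\varepsilon^{12}=1$, $\varepsilon^{ac}\varepsilon_{cb}=\delta^a_b$. Repeated indices are summed, derivatives are right derivatives unless marked $l$, and a subscript $t$ denotes evaluation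 at $\Gamma_t$. Trajectories $\Gamma=(\Gamma^p_t)$ are continuous in $t\in[t_{\rm in},t_{\rm out}]$, $t_{\rm in}<t_{\rm out}$. Let $\lambda_a(\Gamma)$, $a=1,2$, be arbitrary odd-valued functionals of trajectories, Fréchet differentiable at the trajectory $\Gamma$ considered, with right functional derivatives $\delta\lambda_a/\delta\Gamma^q_t$ continuous in $t$. Put $\lambda^a=\varepsilon^{ab}\lambda_b$, $\lambda^2=\lambda_a\lambda^a$, $s^a\lambda_b=\int dt\,\frac{\delta\lambda_b}{\delta\Gamma^q_t}X^{qa}_t$, and consider the transformation $\Gamma^p_t\to\Gamma^p_t+\Delta\Gamma^p_t$, $$\Delta\Gamma^p_t=(s^a\Gamma^p)_t\,\lambda_a+\tfrac14(s^2\Gamma^p)_t\,\lambda^2 .$$ Supermatrices have elements $A^p_{q|t',t''}=D^p_q(t')\,\delta(t'-t'')+K^p_q(t',t'')$; they are multiplied by $(AC)^p_{q|t',t''}=\int dt\,A^p_{r|t',t}C^r_{q|t,t''}$, with unit $\mathbb I=\delta^p_q\,\delta(t'-t'')$, and $\mathrm{Str}\,A=(-1)^{\varepsilon_p}\int dt\,A^p_{p|t,t}=\delta(0)\,(-1)^{\varepsilon_p}\int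 dt\,D^p_p(t)+(-1)^{\varepsilon_p}\int dt\,K^p_p(t,t)$, where $\delta(0)$ is a formal constant that may be given any real value. Let $$M^p_{q|t',t''}=\frac{\delta(\Delta\Gamma^p_{t'})}{\delta\Gamma^q_{t''}},\quad U^p_{q|t',t''}=X^{pa}_{t'}\frac{\delta\lambda_a}{\delta\Gamma^q_{t''}},\quad V=V_1+V_2,\quad (V_1)^p_{q|t',t''}=(-1)^{\varepsilon_p+1}\lambda_a\frac{\delta X^{pa}_{t'}}{\delta\Gamma^q_{t''}},$$ $$(V_2)^p_{q|t',t''}=(-1)^{\varepsilon_p+1}\lambda_aY^p_{t'}\frac{\delta\lambda^a}{\delta\Gamma^q_{t''}},\quad W^p_{q|t',t''}=-\tfrac12\lambda^2\frac{\delta Y^p_{t'}}{\delta\Gamma^q_{t''}},\quad (Y^a_b)^p_{q|t',t''}=(-1)^{\varepsilon_p}\lambda^aY^p_{t'}\frac{\delta\lambda_b}{\delta\Gamma^q_{t''}},$$ and let $m=(m^a_b)$, $m^a_b=s^a\lambda_b$, $e=(\delta^a_b)$, with matrix multiplication and $\mathrm{tr}$ over the $\mathrm{Sp}(2)$ indices.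 **Statement.** The transformed trajectory is again a trajectory, the matrix $M$ of functional derivatives exists, $M=U+V+W$, and, with $C_n^k=\binom nk$: 1. $\mathrm{Str}(M^n)=\mathrm{Str}(U+V)^n+n\,\mathrm{Str}(U^{n-1}W)$ for $n\ge1$; this equals $\mathrm{Str}(U+V)+\mathrm{Str}(W)$ for $n=1$ and $\mathrm{Str}(U+V)^n$ for $n>1$. 2. $\mathrm{Str}(U+V)^n=\sum_{k=0}^nC_n^k\,\mathrm{Str}(U^{n-k}V^k)=\mathrm{Str}(U^n+C_n^1U^{n-1}V+C_n^2U^{n-2}V^2)$ for $n=2,3$. 3. For $k\ge2$, $\mathrm{Str}(U+V)^{2k}=\sum_{l=0}^1C_{2k}^l\mathrm{Str}(U^{2k-l}V^l)+C_{2k}^1\sum_{l=0}^{k-2}\mathrm{Str}[U^{2(k-l-1)}(U^lV)^2]+C_k^1\mathrm{Str}[(U^{k-1}V)^2]$. 4. For $k\ge2$, $\mathrm{Str}(U+V)^{2k+1}=\sum_{l=0}^1C_{2k+1}^l\mathrm{Str}(U^{2k+1-l}V^l)+C_{2k+1}^1\sum_{l=0}^{k-1}\mathrm{Str}[U^{2(k-l)-1}(U^lV)^2]$.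 5. $\mathrm{Str}(V_1)=0$ and $\mathrm{Str}(W)-\tfrac12\mathrm{Str}(V_1^2)=0$. 6. For $n\ge1$, $\mathrm{Str}(U^n)=-\mathrm{tr}(m^n)$ and $VU^n=\mathrm{tr}[m^{n-1}(e+m)Y]$, where $\mathrm{tr}(NY)=N^a_bY^b_a$; moreover $Y^a_a=V_2$. 7. Whenever the series $\ln(e+m)=-\sum_{n\ge1}\frac{(-1)^n}{n}m^n$ converges absolutely, the series for the log-Jacobian $\Im=\mathrm{Str}\ln(\mathbb I+M)=-\sum_{n\ge1}\frac{(-1)^n}{n}\mathrm{Str}(M^n)$ converges, and $\Im=-\mathrm{tr}\ln(e+m)$. -/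

import Mathlib

open MeasureTheory

namespace BAB

noncomputable section

/-! ### Supernumbers -/

/-- `B = 𝒜 0 ⊕ 𝒜 1` is an algebra of supernumbers: a `ZMod 2`-graded Banach algebra over `ℝ`
(the Banach algebra and the grading are given by instances), with closed homogeneous parts,
supercommutative, and such that only `0` is annihilated by all odd elements, so that right and
left derivatives in odd variables are unique. Example: the Banach-Grassmann algebra of all
`∑_I b_I θ_I` with `∑_I |b_I| < ∞`, over the finite sets `I` of indices of countably many
anticommuting generators. -/
structure IsSupernumberAlgebra {B : Type*} [NormedRing B] [NormedAlgebra ℝ B]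
    (𝒜 : ZMod 2 → Submodule ℝ B) : Prop where
  isClosed : ∀ i, IsClosed (𝒜 i : Set B)
  even_comm : ∀ x ∈ 𝒜 0, ∀ y : B, x * y = y * x
  odd_anticomm : ∀ x ∈ 𝒜 1, ∀ y ∈ 𝒜 1, x * y = -(y * x)
  faithful : ∀ x : B, (∀ θ ∈ 𝒜 1, x * θ = 0) → x = 0

section PhaseSpace

variable {B ι : Type*} [NormedRing B] [NormedAlgebra ℝ B] [Fintype ι]

/-- The sign `(-1)^i`, as an element of `B`. -/
def sgn (B : Type*) [Ring B] (i : ZMod 2) : B := (-1) ^ i.val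

/-- The phase space with coordinates `Γ^p` of Grassmann parity `ε p`: the coordinate `Γ^p` takes
all values in the part of `B` of parity `ε p`. -/
abbrev PhaseSpace (𝒜 : ZMod 2 → Submodule ℝ B) (ε : ι → ZMod 2) : Type _ := ∀ p, 𝒜 (ε p)

variable {𝒜 : ZMod 2 → Submodule ℝ B} {ε : ι → ZMod 2}

/-- `g` is the family of right derivatives `f_{,q}` of `f` at `Γ`: `df = f_{,q} dΓ^q`. -/
def HasRightGradAt (f : PhaseSpace 𝒜 ε → B) (g : ι → B) (Γ : PhaseSpace 𝒜 ε) : Prop :=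
  ∃ L : PhaseSpace 𝒜 ε →L[ℝ] B, HasFDerivAt f L Γ ∧ ∀ h, L h = ∑ q, g q * (h q : B)

/-- `g` is the family of left derivatives of `f` at `Γ`: `df = dΓ^q (∂_l f / ∂Γ^q)`. -/
def HasLeftGradAt (f : PhaseSpace 𝒜 ε → B) (g : ι → B) (Γ : PhaseSpace 𝒜 ε) : Prop :=
  ∃ L : PhaseSpace 𝒜 ε →L[ℝ] B, HasFDerivAt f L Γ ∧ ∀ h, L h = ∑ q, (h q : B) * g q

open Classical in
/-- The right derivative `f_{,q}` (zero where it does not exist). -/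
def rderiv (f : PhaseSpace 𝒜 ε → B) (q : ι) (Γ : PhaseSpace 𝒜 ε) : B :=
  if h : ∃ g, HasRightGradAt f g Γ then h.choose q else 0

open Classical in
/-- The left derivative `∂_l f / ∂Γ^q` (zero where it does not exist). -/
def lderiv (f : PhaseSpace 𝒜 ε → B) (q : ι) (Γ : PhaseSpace 𝒜 ε) : B :=
  if h : ∃ g, HasLeftGradAt f g Γ then h.choose q else 0

/-- `f` is `n` times continuously superdifferentiable. -/
def IsSuperC : ℕ → (PhaseSpace 𝒜 ε → B) → Prop
  | 0, f => Continuous f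
  | n + 1, f => (∀ Γ, ∃ g, HasRightGradAt f g Γ) ∧ ∀ q, IsSuperC n (rderiv f q)

/-- The Poisson superbracket `{f, g} = (∂_r f / ∂Γ^p) ω^{pq} (∂_l g / ∂Γ^q)`, for which
`{Γ^p, Γ^q} = ω^{pq}`. -/
def bracket (ω : Matrix ι ι B) (f g : PhaseSpace 𝒜 ε → B) (Γ : PhaseSpace 𝒜 ε) : B :=
  ∑ p, ∑ q, rderiv f p Γ * ω p q * lderiv g q Γ

/-- The coordinate function `Γ ↦ Γ^p`. -/
def coord (p : ι) (Γ : PhaseSpace 𝒜 ε) : B := (Γ p : B)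

end PhaseSpace

/-- The antisymmetric tensor `ε^{ab}`, `ε^{12} = 1`. -/
def epsUp : Matrix (Fin 2) (Fin 2) ℝ := !![0, 1; -1, 0]

/-- The antisymmetric tensor `ε_{ab}`, with `ε^{ac} ε_{cb} = δ^a_b`. -/
def epsLow : Matrix (Fin 2) (Fin 2) ℝ := !![0, -1; 1, 0]

/-- A constrained Hamiltonian system in its `Sp(2)`-covariant formulation: a constant nondegenerate
even supermatrix `ω^{pq}` that defines the Poisson superbracket, and a doublet of odd functions
`Ω^a` that solves the generating equations `{Ω^a, Ω^b} = 0`. -/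
structure ConstrainedSystem {B ι : Type*} [NormedRing B] [NormedAlgebra ℝ B] [Fintype ι]
    [DecidableEq ι] (𝒜 : ZMod 2 → Submodule ℝ B) (ε : ι → ZMod 2) where
  ω : Matrix ι ι B
  ω_even : ∀ p q, ω p q ∈ 𝒜 (ε p + ε q)
  ω_antisymm : ∀ p q, ω p q = -(sgn B (ε p * ε q) * ω q p)
  ω_nondegenerate : IsUnit ω
  Ω : Fin 2 → PhaseSpace 𝒜 ε → B
  Ω_odd : ∀ a Γ, Ω a Γ ∈ 𝒜 1
  Ω_smooth : ∀ a, IsSuperC 3 (Ω a)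
  generating : ∀ a b Γ, bracket ω (Ω a) (Ω b) Γ = 0

namespace ConstrainedSystem

variable {B ι : Type*} [NormedRing B] [NormedAlgebra ℝ B] [Fintype ι] [DecidableEq ι]
  {𝒜 : ZMod 2 → Submodule ℝ B} {ε : ι → ZMod 2}

/-- The generators `s^a = {·, Ω^a}` on functions on the phase space. -/
def s (S : ConstrainedSystem 𝒜 ε) (a : Fin 2) (f : PhaseSpace 𝒜 ε → B) : PhaseSpace 𝒜 ε → B :=
  bracket S.ω f (S.Ω a)

/-- `s^2 = s_a s^a = ε_{ab} s^b s^a`. -/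
def sSq (S : ConstrainedSystem 𝒜 ε) (f : PhaseSpace 𝒜 ε → B) (Γ : PhaseSpace 𝒜 ε) : B :=
  ∑ a, ∑ b, epsLow a b • S.s b (S.s a f) Γ

/-- `X^{pa} = s^a Γ^p`. -/
def X (S : ConstrainedSystem 𝒜 ε) (p : ι) (a : Fin 2) : PhaseSpace 𝒜 ε → B := S.s a (coord p)

/-- `Y^p = -(1/2) s^2 Γ^p`. -/
def Y (S : ConstrainedSystem 𝒜 ε) (p : ι) (Γ : PhaseSpace 𝒜 ε) : B :=
  (-(1 / 2) : ℝ) • S.sSq (coord p) Γ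

end ConstrainedSystem

/-! ### Supermatrices with indices `(p, t)` -/

/-- Supermatrices with indices `(p, t)`: the pair `(D, K)` stands for the matrix with elements
`A^p_{q|t',t''} = D^p_q(t') δ(t' - t'') + K^p_q(t', t'')`. -/
def Kernel (T ι B : Type*) : Type _ := (T → Matrix ι ι B) × (T → T → Matrix ι ι B)

namespace Kernel

variable {T ι B : Type*} [NormedRing B] [NormedAlgebra ℝ B]

instance : AddCommGroup (Kernel T ι B) :=
  inferInstanceAs (AddCommGroup ((T → Matrix ι ι B) × (T → T → Matrix ι ι B)))

/-- Multiplication of all matrix elements from the left by a supernumber. -/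
instance : Module B (Kernel T ι B) :=
  inferInstanceAs (Module B ((T → Matrix ι ι B) × (T → T → Matrix ι ι B)))

/-- The part `D` of `D^p_q(t') δ(t' - t'') + K^p_q(t', t'')`. -/
def loc (A : Kernel T ι B) : T → Matrix ι ι B := A.1

/-- The part `K` of `D^p_q(t') δ(t' - t'') + K^p_q(t', t'')`. -/
def reg (A : Kernel T ι B) : T → T → Matrix ι ι B := A.2

/-- The matrix with the elements `K^p_q(t', t'')`. -/
def ofReg (K : T → T → Matrix ι ι B) : Kernel T ι B := (0, K)

/-- Multiplication of the row `(p, t')` by `c p`. -/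
def scaleRows (c : ι → B) (A : Kernel T ι B) : Kernel T ι B :=
  (fun t => Matrix.of fun p q => c p * A.loc t p q,
    fun t t' => Matrix.of fun p q => c p * A.reg t t' p q)

/-- The unit matrix `δ^p_q δ(t' - t'')`. -/
instance [DecidableEq ι] : One (Kernel T ι B) := ⟨(fun _ => 1, 0)⟩

/-- The product `(AC)^p_q(t', t'') = ∫ dt A^p_r(t', t) C^r_q(t, t'')`. -/
instance [Fintype ι] [MeasureSpace T] : Mul (Kernel T ι B) :=
  ⟨fun A C =>
    (fun t => A.loc t * C.loc t,
      fun t t' => A.loc t * C.reg t t' + A.reg t t' * C.loc t' +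
        Matrix.of fun p q => ∫ r, (A.reg t r * C.reg r t') p q)⟩

/-- Powers with respect to this product. -/
def npow [Fintype ι] [DecidableEq ι] [MeasureSpace T] (A : Kernel T ι B) : ℕ → Kernel T ι B
  | 0 => 1
  | n + 1 => npow A n * A

instance [Fintype ι] [DecidableEq ι] [MeasureSpace T] : Pow (Kernel T ι B) ℕ := ⟨npow⟩

/-- The supertrace `Str A = (-1)^{ε_p} ∫ dt A^p_p(t, t)`. On `D^p_q(t') δ(t' - t'')` it is
`δ(0) (-1)^{ε_p} ∫ dt D^p_p(t)`; the value of the symbol `δ(0)` is the argument `δ₀`. -/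
def str [Fintype ι] [MeasureSpace T] (ε : ι → ZMod 2) (δ₀ : ℝ) (A : Kernel T ι B) : B :=
  δ₀ • (∫ t, ∑ p, sgn B (ε p) * A.loc t p p) + ∫ t, ∑ p, sgn B (ε p) * A.reg t t p p

end Kernel

/-! ### Functionals of trajectories -/

/-- Lebesgue measure `dt` on the time interval. -/
instance (t₀ t₁ : ℝ) : MeasureSpace (Set.Icc t₀ t₁) := Measure.Subtype.measureSpace

section Functionals

variable {B ι : Type*} [NormedRing B] [NormedAlgebra ℝ B] [Fintype ι]

/-- Phase-space trajectories `Γ_t^p`, `t₀ ≤ t ≤ t₁`. -/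
abbrev Trajectory (𝒜 : ZMod 2 → Submodule ℝ B) (ε : ι → ZMod 2) (t₀ t₁ : ℝ) : Type _ :=
  C(Set.Icc t₀ t₁, PhaseSpace 𝒜 ε)

variable {𝒜 : ZMod 2 → Submodule ℝ B} {ε : ι → ZMod 2} {t₀ t₁ : ℝ}

/-- `k` is the right functional derivative of the functional `F` at `Γ`:
`dF = ∫ dt (δF / δΓ_t^q) dΓ_t^q`. -/
def HasFunDerivAt (F : Trajectory 𝒜 ε t₀ t₁ → B) (k : Set.Icc t₀ t₁ → ι → B)
    (Γ : Trajectory 𝒜 ε t₀ t₁) : Prop :=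
  Continuous k ∧ ∃ L : Trajectory 𝒜 ε t₀ t₁ →L[ℝ] B, HasFDerivAt F L Γ ∧
    ∀ h, L h = ∫ t, ∑ q, k t q * (h t q : B)

open Classical in
/-- The right functional derivative `δF / δΓ_t^q` (zero if it does not exist). -/
def funDeriv (F : Trajectory 𝒜 ε t₀ t₁ → B) (Γ : Trajectory 𝒜 ε t₀ t₁) :
    Set.Icc t₀ t₁ → ι → B :=
  if h : ∃ k, HasFunDerivAt F k Γ then h.choose else 0

/-- `M` is the matrix `δF_{t'}^p / δΓ_{t''}^q` of right functional derivatives at `Γ` of the family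
`F` of functionals: `dF_{t'}^p = ∫ dt'' M^p_{q|t',t''} dΓ_{t''}^q`. -/
def HasFunJacobianAt (F : Trajectory 𝒜 ε t₀ t₁ → Set.Icc t₀ t₁ → ι → B)
    (M : Kernel (Set.Icc t₀ t₁) ι B) (Γ : Trajectory 𝒜 ε t₀ t₁) : Prop :=
  Continuous M.loc ∧ Continuous (fun x : Set.Icc t₀ t₁ × Set.Icc t₀ t₁ => M.reg x.1 x.2) ∧
    ∀ t p, ∃ L : Trajectory 𝒜 ε t₀ t₁ →L[ℝ] B, HasFDerivAt (fun Γ' => F Γ' t p) L Γ ∧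
      ∀ h, L h = ∑ q, M.loc t p q * (h t q : B) + ∫ t', ∑ q, M.reg t t' p q * (h t' q : B)

open Classical in
/-- The matrix `δF_{t'}^p / δΓ_{t''}^q` (zero if it does not exist). -/
def funJacobian (F : Trajectory 𝒜 ε t₀ t₁ → Set.Icc t₀ t₁ → ι → B)
    (Γ : Trajectory 𝒜 ε t₀ t₁) : Kernel (Set.Icc t₀ t₁) ι B :=
  if h : ∃ M, HasFunJacobianAt F M Γ then h.choose else 0

end Functionals

/-! ### Finite field-dependent BRST-antiBRST transformations -/

namespace ConstrainedSystem

variable {B ι : Type*} [NormedRing B] [NormedAlgebra ℝ B] [Fintype ι] [DecidableEq ι]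
  {𝒜 : ZMod 2 → Submodule ℝ B} {ε : ι → ZMod 2} {t₀ t₁ : ℝ}

/-- `λ^a = ε^{ab} λ_b`. -/
def raise (l : Fin 2 → B) (a : Fin 2) : B := ∑ b, epsUp a b • l b

/-- `λ^2 = λ_a λ^a`. -/
def sq (l : Fin 2 → B) : B := ∑ a, l a * raise l a

/-- `X_t^{pa}`. -/
def Xt (S : ConstrainedSystem 𝒜 ε) (a : Fin 2) (Γ : Trajectory 𝒜 ε t₀ t₁) (t : Set.Icc t₀ t₁)
    (p : ι) : B := S.X p a (Γ t)

/-- `Y_t^p`. -/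
def Yt (S : ConstrainedSystem 𝒜 ε) (Γ : Trajectory 𝒜 ε t₀ t₁) (t : Set.Icc t₀ t₁) (p : ι) : B :=
  S.Y p (Γ t)

/-- `ΔΓ_t^p = (s^a Γ^p)_t λ_a + (1/4) (s^2 Γ^p)_t λ^2`. -/
def ΔΓ (S : ConstrainedSystem 𝒜 ε) (l : Fin 2 → Trajectory 𝒜 ε t₀ t₁ → B)
    (Γ : Trajectory 𝒜 ε t₀ t₁) (t : Set.Icc t₀ t₁) (p : ι) : B :=
  ∑ a, S.s a (coord p) (Γ t) * l a Γ +
    (1 / 4 : ℝ) • (S.sSq (coord p) (Γ t) * sq (fun a => l a Γ))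

/-- The generators `s^a` on functionals: `s^a F = ∫ dt (δF / δΓ_t^q) {Γ^q, Ω^a}_t`. -/
def sFun (S : ConstrainedSystem 𝒜 ε) (a : Fin 2) (F : Trajectory 𝒜 ε t₀ t₁ → B)
    (Γ : Trajectory 𝒜 ε t₀ t₁) : B :=
  ∫ t, ∑ q, funDeriv F Γ t q * S.s a (coord q) (Γ t)

variable (S : ConstrainedSystem 𝒜 ε) (l : Fin 2 → Trajectory 𝒜 ε t₀ t₁ → B)
  (Γ : Trajectory 𝒜 ε t₀ t₁)

/-- `m^a_b = s^a λ_b`; the upper index is the row index. -/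
def m : Matrix (Fin 2) (Fin 2) B := Matrix.of fun a b => S.sFun a (l b) Γ

/-- `M^p_{q|t',t''} = δ(ΔΓ_{t'}^p) / δΓ_{t''}^q`. -/
def M : Kernel (Set.Icc t₀ t₁) ι B := funJacobian (S.ΔΓ l) Γ

/-- `U^p_{q|t',t''} = X_{t'}^{pa} δλ_a / δΓ_{t''}^q`. -/
def U : Kernel (Set.Icc t₀ t₁) ι B :=
  Kernel.ofReg fun t t' => Matrix.of fun p q => ∑ a, S.Xt a Γ t p * funDeriv (l a) Γ t' q

/-- `(V₁)^p_{q|t',t''} = (-1)^{ε_p + 1} λ_a δX_{t'}^{pa} / δΓ_{t''}^q`. -/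
def V₁ : Kernel (Set.Icc t₀ t₁) ι B :=
  ∑ a, Kernel.scaleRows (fun p => sgn B (ε p + 1) * l a Γ) (funJacobian (S.Xt a) Γ)

/-- `(V₂)^p_{q|t',t''} = (-1)^{ε_p + 1} λ_a Y_{t'}^p δλ^a / δΓ_{t''}^q`. -/
def V₂ : Kernel (Set.Icc t₀ t₁) ι B :=
  Kernel.ofReg fun t t' => Matrix.of fun p q =>
    ∑ a, sgn B (ε p + 1) * l a Γ * S.Yt Γ t p *
      funDeriv (fun Γ' => raise (fun b => l b Γ') a) Γ t' q

/-- `V = V₁ + V₂`. -/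
def V : Kernel (Set.Icc t₀ t₁) ι B := S.V₁ l Γ + S.V₂ l Γ

/-- `W^p_{q|t',t''} = -(1/2) λ^2 δY_{t'}^p / δΓ_{t''}^q`. -/
def W : Kernel (Set.Icc t₀ t₁) ι B :=
  ((-(1 / 2) : ℝ) • sq (fun a => l a Γ)) • funJacobian S.Yt Γ

/-- `(Y^a_b)^p_{q|t',t''} = (-1)^{ε_p} λ^a Y_{t'}^p δλ_b / δΓ_{t''}^q`. -/
def Ymat (a b : Fin 2) : Kernel (Set.Icc t₀ t₁) ι B :=
  Kernel.ofReg fun t t' => Matrix.of fun p q =>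
    sgn B (ε p) * raise (fun c => l c Γ) a * S.Yt Γ t p * funDeriv (l b) Γ t' q

/-- `tr (N Y) = N^a_b Y^b_a`, the trace over the `Sp(2)` indices. -/
def trY (N : Matrix (Fin 2) (Fin 2) B) : Kernel (Set.Icc t₀ t₁) ι B :=
  ∑ a, ∑ b, N a b • S.Ymat l Γ b a

end ConstrainedSystem

/-- The coefficient `-(-1)^n / n` of the expansion of the logarithm, at `n = k + 1`. -/
def logCoeff (k : ℕ) : ℝ := -((-1) ^ (k + 1) / ((k : ℝ) + 1))

/-- `ln (e + m) = -∑_{n ≥ 1} ((-1)^n / n) m^n`, entry by entry. -/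
def matLog {B : Type*} [NormedRing B] [NormedAlgebra ℝ B] (m : Matrix (Fin 2) (Fin 2) B) :
    Matrix (Fin 2) (Fin 2) B :=
  Matrix.of fun a b => ∑' k : ℕ, logCoeff k • (m ^ (k + 1)) a b

end

end BAB

open BAB

set_option linter.unusedSectionVars false

namespace BAB

/-! ### Signs and parities -/

/-! The graded product rule applied to ΔΓ gives M = U + V + W, where U, V and W are of order zero,
one and two in the undifferentiated parameters λ_a. Derivatives are chosen classically, so this
needs uniqueness: an element annihilated by all θ of one parity is zero, and test functions
vanishing at t separate the δ-part of a kernel from its regular part.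

There are only two λ_a, they anticommute, and with the sign (-1)^{ε_p} they commute with all even
kernels. Hence every word with three V's, with a V before a W, or with two W's vanishes. Continuous
even kernels form a ring on which Str is cyclic, so the expansions of Str (M^n) become a count of
cyclic words (`trace_add_add_pow`, `trace_add_pow_even`, `trace_add_pow_odd`).

The dynamics enters through {Ω^a, Ω^b} = 0 and the graded antisymmetry of ω. The first makes the s^a
anticommute, so s^b X^{pa} = ε^{ab} Y^p and s^a Y^p = 0; as kernels, V₁U = V₂ and WU = 0. The second
makes the vector fields X^a divergence-free, whence Str V₁ = 0 and, after one more differentiation,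
Str W = ½ Str V₁². These traces vanish or agree before integration over time, so the value of δ(0)
is irrelevant.

U is a sum of two rank-one kernels, so multiplying by U on the right multiplies a 2×2 coefficient
matrix by m (`contract_mul_U`). This yields Str U^n = -tr m^n and the formula for VU^n. The
alternating sum of the VU^n then telescopes to V₁; formally V(𝕀 + U)⁻¹ = V₁. Since at most two V's
survive, Str ln(𝕀 + M) = Str ln(𝕀 + U) + Str V₁ - ½ Str V₁² + Str W = -tr ln(e + m).

For convergence, either some power of m has norm below 1, or the logarithmic series dominates the
harmonic one. So absolute convergence of ln(e + m) forces that of the geometric series, and every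
rearrangement is a Cauchy product of absolutely convergent series (`summable_norm_pow_apply`,
`hasSum_log_jacobian`). -/

/-- The sign `(-1)^i` as an integer. -/
def ksign (i : ZMod 2) : ℤ := (-1) ^ i.val

theorem ksign_add (i j : ZMod 2) : ksign (i + j) = ksign i * ksign j := by
  revert i j; decide

theorem ksign_mul_self (i : ZMod 2) : ksign i * ksign i = 1 := by
  revert i; decide

theorem sgn_mul {B : Type*} [Ring B] (i : ZMod 2) (x : B) : sgn B i * x = ksign i • x := by
  simp [sgn, ksign, zsmul_eq_mul]

theorem ksign_smul_smul {B : Type*} [AddCommGroup B] (i : ZMod 2) (x : B) :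
    ksign i • ksign i • x = x := by
  rw [smul_smul, ksign_mul_self, one_smul]

section Parity

variable {B : Type*} [NormedRing B] [NormedAlgebra ℝ B] {𝒜 : ZMod 2 → Submodule ℝ B}

theorem zmod_two_cases (i : ZMod 2) : i = 0 ∨ i = 1 := by
  revert i; decide

theorem zmod_two_add_add (i j : ZMod 2) : i = i + j + j := by
  revert i j; decide

theorem zmod_two_add_add_one (i j : ZMod 2) : i + 1 = i + j + 1 + j := by
  revert i j; decide

theorem IsSupernumberAlgebra.supercomm (h𝒜 : IsSupernumberAlgebra 𝒜) {i j : ZMod 2} {x y : B}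
    (hx : x ∈ 𝒜 i) (hy : y ∈ 𝒜 j) : x * y = ksign (i * j) • (y * x) := by
  rcases zmod_two_cases i with rfl | rfl
  · rw [h𝒜.even_comm x hx y]; simp [ksign]
  rcases zmod_two_cases j with rfl | rfl
  · rw [h𝒜.even_comm y hy x]; simp [ksign]
  · rw [h𝒜.odd_anticomm x hx y hy, mul_one, show ksign 1 = -1 by decide]; simp

variable [GradedAlgebra 𝒜]

theorem mul_mem_of_eq {i j k : ZMod 2} {x y : B} (hx : x ∈ 𝒜 i) (hy : y ∈ 𝒜 j)
    (h : k = i + j) : x * y ∈ 𝒜 k := h ▸ SetLike.mul_mem_graded hx hy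

theorem eq_zero_of_mem_mem {i : ZMod 2} {x : B} (h : x ∈ 𝒜 i) (h' : x ∈ 𝒜 (i + 1)) : x = 0 := by
  have hd := (DirectSum.Decomposition.isInternal 𝒜).submodule_iSupIndep
  have := hd.pairwiseDisjoint (show i ≠ i + 1 by clear h h'; revert i; decide)
  exact Submodule.disjoint_def.1 this x h h'

theorem exists_components (𝒜 : ZMod 2 → Submodule ℝ B) [GradedAlgebra 𝒜] (i : ZMod 2) (x : B) :
    ∃ y ∈ 𝒜 i, ∃ z ∈ 𝒜 (i + 1), x = y + z := by
  refine ⟨DirectSum.decompose 𝒜 x i, SetLike.coe_mem _,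
    DirectSum.decompose 𝒜 x (i + 1), SetLike.coe_mem _, ?_⟩
  classical
  conv_lhs => rw [← DirectSum.sum_support_decompose 𝒜 x]
  rw [Finset.sum_subset (Finset.subset_univ _) (by simp +contextual)]
  rcases zmod_two_cases i with rfl | rfl
  · exact Fin.sum_univ_two _
  · exact (Fin.sum_univ_two _).trans (add_comm _ _)

/-- For odd j this is the faithfulness axiom; for even j the test element θ = 1 suffices. -/
theorem IsSupernumberAlgebra.eq_zero_of_mul (h𝒜 : IsSupernumberAlgebra 𝒜) (j : ZMod 2) {x : B}
    (h : ∀ θ ∈ 𝒜 j, x * θ = 0) : x = 0 := by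
  rcases zmod_two_cases j with rfl | rfl
  · simpa using h 1 SetLike.GradedOne.one_mem
  · exact h𝒜.faithful x h

/-- The component of x of the wrong parity sends every θ into both parts of the grading, hence to 0,
so it vanishes. -/
theorem IsSupernumberAlgebra.mem_of_mul_mem (h𝒜 : IsSupernumberAlgebra 𝒜) {i j : ZMod 2} {x : B}
    (h : ∀ θ ∈ 𝒜 j, x * θ ∈ 𝒜 i) : x ∈ 𝒜 (i + j) := by
  obtain ⟨y, hy, z, hz, rfl⟩ := exists_components 𝒜 (i + j) x
  suffices hz0 : z = 0 by simpa [hz0] using hy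
  refine h𝒜.eq_zero_of_mul j fun θ hθ => eq_zero_of_mem_mem (𝒜 := 𝒜) (i := i) ?_
    (mul_mem_of_eq hz hθ (zmod_two_add_add_one i j))
  have h1 : y * θ ∈ 𝒜 i := mul_mem_of_eq hy hθ (zmod_two_add_add i j)
  simpa [add_mul] using (𝒜 i).sub_mem (h θ hθ) h1

/-- Supercommutativity speaks of homogeneous elements only, so θ is moved across each parity
component of x separately. -/
theorem IsSupernumberAlgebra.eq_zero_of_mul_left (h𝒜 : IsSupernumberAlgebra 𝒜) (j : ZMod 2) {x : B}
    (h : ∀ θ ∈ 𝒜 j, θ * x = 0) : x = 0 := by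
  obtain ⟨y, hy, z, hz, rfl⟩ := exists_components 𝒜 0 x
  have key : ∀ θ ∈ 𝒜 j, θ * y = 0 ∧ θ * z = 0 := by
    intro θ hθ
    have h1 : θ * y ∈ 𝒜 j := mul_mem_of_eq hθ hy (by simp)
    have h2 : θ * z ∈ 𝒜 (j + 1) := mul_mem_of_eq hθ hz (by simp)
    have h3 : θ * y = -(θ * z) := by
      rw [eq_neg_iff_add_eq_zero, ← mul_add]; exact h θ hθ
    have h4 : θ * y = 0 := eq_zero_of_mem_mem h1 (h3 ▸ (𝒜 _).neg_mem h2)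
    exact ⟨h4, by simpa [h4] using h3⟩
  have hy0 : y = 0 := h𝒜.eq_zero_of_mul j fun θ hθ => by
    rw [h𝒜.supercomm hy hθ, (key θ hθ).1, smul_zero]
  have hz0 : z = 0 := h𝒜.eq_zero_of_mul j fun θ hθ => by
    rw [h𝒜.supercomm hz hθ, (key θ hθ).2, smul_zero]
  rw [hy0, hz0, add_zero]

end Parity

/-! ### Right and left derivatives -/

section Grad

variable {B ι : Type*} [NormedRing B] [NormedAlgebra ℝ B] [Fintype ι]
  {𝒜 : ZMod 2 → Submodule ℝ B} {ε : ι → ZMod 2}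

open Classical in
/-- The tangent vector with the only nonzero component `θ` along `Γ^q`. -/
noncomputable def tangent (q : ι) (θ : 𝒜 (ε q)) : PhaseSpace 𝒜 ε := Pi.single q θ

theorem sum_mul_tangent (g : ι → B) (q : ι) (θ : 𝒜 (ε q)) :
    ∑ r, g r * (tangent q θ r : B) = g q * θ := by
  classical
  rw [Finset.sum_eq_single q]
  · simp [tangent]
  · intro r _ hr
    simp [tangent, Pi.single_eq_of_ne hr]
  · simp

theorem sum_tangent_mul (g : ι → B) (q : ι) (θ : 𝒜 (ε q)) :
    ∑ r, (tangent q θ r : B) * g r = θ * g q := by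
  classical
  rw [Finset.sum_eq_single q]
  · simp [tangent]
  · intro r _ hr
    simp [tangent, Pi.single_eq_of_ne hr]
  · simp

theorem hasRightGradAt_rderiv {f : PhaseSpace 𝒜 ε → B} {Γ : PhaseSpace 𝒜 ε}
    (h : ∃ g, HasRightGradAt f g Γ) : HasRightGradAt f (fun q => rderiv f q Γ) Γ := by
  have : (fun q => rderiv f q Γ) = h.choose := by
    funext q; rw [rderiv, dif_pos h]
  rw [this]; exact h.choose_spec

/-- The differential of a function of parity `i` has parity `i`. -/
theorem fderiv_mem {E : Type*} [NormedAddCommGroup E] [NormedSpace ℝ E] {K : Submodule ℝ B}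
    (hK : IsClosed (K : Set B)) {f : E → B} {L : E →L[ℝ] B} {x : E}
    (hf : ∀ y, f y ∈ K) (hL : HasFDerivAt f L x) (h : E) : L h ∈ K := by
  -- L h is a limit of difference quotients along a line, and these lie in the closed subspace K.
  have h1 : HasDerivAt (fun t : ℝ => f (x + t • h)) (L h) 0 := by
    have h2 : HasFDerivAt f L (x + (0 : ℝ) • h) := by simpa using hL
    have h3 : HasDerivAt (fun t : ℝ => x + t • h) h 0 := by
      simpa using ((hasDerivAt_id (0 : ℝ)).smul_const h).const_add x
    exact h2.comp_hasDerivAt 0 h3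
  rw [hasDerivAt_iff_tendsto_slope] at h1
  refine hK.mem_of_tendsto h1 (Filter.Eventually.of_forall fun t => ?_)
  exact K.smul_mem _ (K.sub_mem (hf _) (hf _))

variable [GradedAlgebra 𝒜]

/-- Variations of a single coordinate Γ^q determine g_q θ for every θ of parity ε_q, and hence g_q.
-/
theorem HasRightGradAt.unique (h𝒜 : IsSupernumberAlgebra 𝒜) {f : PhaseSpace 𝒜 ε → B}
    {g g' : ι → B} {Γ : PhaseSpace 𝒜 ε} (h : HasRightGradAt f g Γ) (h' : HasRightGradAt f g' Γ) :
    g = g' := by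
  obtain ⟨L, hL, e⟩ := h
  obtain ⟨L', hL', e'⟩ := h'
  obtain rfl := hL.unique hL'
  funext q
  refine sub_eq_zero.1 (h𝒜.eq_zero_of_mul (ε q) fun θ hθ => ?_)
  have := (e (tangent q ⟨θ, hθ⟩)).symm.trans (e' _)
  rw [sum_mul_tangent, sum_mul_tangent] at this
  simpa [sub_mul, sub_eq_zero] using this

theorem HasLeftGradAt.unique (h𝒜 : IsSupernumberAlgebra 𝒜) {f : PhaseSpace 𝒜 ε → B}
    {g g' : ι → B} {Γ : PhaseSpace 𝒜 ε} (h : HasLeftGradAt f g Γ) (h' : HasLeftGradAt f g' Γ) :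
    g = g' := by
  obtain ⟨L, hL, e⟩ := h
  obtain ⟨L', hL', e'⟩ := h'
  obtain rfl := hL.unique hL'
  funext q
  refine sub_eq_zero.1 (h𝒜.eq_zero_of_mul_left (ε q) fun θ hθ => ?_)
  have := (e (tangent q ⟨θ, hθ⟩)).symm.trans (e' _)
  rw [sum_tangent_mul, sum_tangent_mul] at this
  simpa [mul_sub, sub_eq_zero] using this

theorem HasRightGradAt.rderiv_eq (h𝒜 : IsSupernumberAlgebra 𝒜) {f : PhaseSpace 𝒜 ε → B}
    {g : ι → B} {Γ : PhaseSpace 𝒜 ε} (h : HasRightGradAt f g Γ) (q : ι) : rderiv f q Γ = g q := by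
  have hex : ∃ g, HasRightGradAt f g Γ := ⟨g, h⟩
  rw [rderiv, dif_pos hex]
  exact congrFun (hex.choose_spec.unique h𝒜 h) q

theorem HasLeftGradAt.lderiv_eq (h𝒜 : IsSupernumberAlgebra 𝒜) {f : PhaseSpace 𝒜 ε → B}
    {g : ι → B} {Γ : PhaseSpace 𝒜 ε} (h : HasLeftGradAt f g Γ) (q : ι) : lderiv f q Γ = g q := by
  have hex : ∃ g, HasLeftGradAt f g Γ := ⟨g, h⟩
  rw [lderiv, dif_pos hex]
  exact congrFun (hex.choose_spec.unique h𝒜 h) q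

theorem HasRightGradAt.mem (h𝒜 : IsSupernumberAlgebra 𝒜) {f : PhaseSpace 𝒜 ε → B}
    {g : ι → B} {Γ : PhaseSpace 𝒜 ε} {i : ZMod 2} (h : HasRightGradAt f g Γ)
    (hf : ∀ Γ, f Γ ∈ 𝒜 i) (q : ι) : g q ∈ 𝒜 (i + ε q) := by
  obtain ⟨L, hL, e⟩ := h
  refine h𝒜.mem_of_mul_mem fun θ hθ => ?_
  have := fderiv_mem (h𝒜.isClosed i) hf hL (tangent q ⟨θ, hθ⟩)
  rwa [e, sum_mul_tangent] at this

/-- The sign comes from moving dΓ^q, of parity ε_q, across f_{,q}, of parity i + ε_q. -/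
theorem HasRightGradAt.hasLeftGradAt (h𝒜 : IsSupernumberAlgebra 𝒜) {f : PhaseSpace 𝒜 ε → B}
    {g : ι → B} {Γ : PhaseSpace 𝒜 ε} {i : ZMod 2} (h : HasRightGradAt f g Γ)
    (hf : ∀ Γ, f Γ ∈ 𝒜 i) :
    HasLeftGradAt f (fun q => ksign (ε q * (i + ε q)) • g q) Γ := by
  have hm := h.mem h𝒜 hf
  obtain ⟨L, hL, e⟩ := h
  refine ⟨L, hL, fun v => ?_⟩
  rw [e]
  refine Finset.sum_congr rfl fun q _ => ?_
  rw [h𝒜.supercomm (hm q) (v q).2, mul_smul_comm, mul_comm (i + ε q)]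

end Grad
end BAB

namespace BAB

/-! ### Calculus of right derivatives: product rule and symmetry of second derivatives. -/

section GradCalculus

/-- Symmetry of the second derivative, for a differential written in coordinates. The map Φ p sends
a coefficient c to the linear map c · ℓ_p, so differentiability of the coefficients gives that of y
↦ L y. -/
theorem sum_mul_symmetric {B E ι : Type*} [NormedRing B] [NormedAlgebra ℝ B] [Fintype ι]
    [NormedAddCommGroup E] [NormedSpace ℝ E] (ℓ : ι → E →L[ℝ] B) {f : E → B} {g : ι → E → B}
    {L : E → E →L[ℝ] B} {G : ι → E →L[ℝ] B} {x : E} (hf : ∀ y, HasFDerivAt f (L y) y)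
    (hL : ∀ y h, L y h = ∑ p, g p y * ℓ p h) (hg : ∀ p, HasFDerivAt (g p) (G p) x) (v w : E) :
    ∑ p, G p v * ℓ p w = ∑ p, G p w * ℓ p v := by
  let Φ (p : ι) : B →L[ℝ] E →L[ℝ] B :=
    ((ContinuousLinearMap.compL ℝ E B B).flip (ℓ p)).comp (ContinuousLinearMap.mul ℝ B)
  have hΦ (p x v) : Φ p x v = x * ℓ p v := by simp [Φ]
  have hL' (y) : L y = ∑ p, Φ p (g p y) := by ext v; simp [hΦ, hL]
  have h2 : HasFDerivAt (fun y => ∑ p, Φ p (g p y)) (∑ p, (Φ p).comp (G p)) x :=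
    HasFDerivAt.fun_sum fun p _ => (Φ p).hasFDerivAt.comp x (hg p)
  have := second_derivative_symmetric (fun y => hL' y ▸ hf y) h2 v w
  simpa [hΦ] using this

variable {B ι : Type*} [NormedRing B] [NormedAlgebra ℝ B] [Fintype ι]
  {𝒜 : ZMod 2 → Submodule ℝ B} {ε : ι → ZMod 2}

theorem HasRightGradAt.const_mul {f : PhaseSpace 𝒜 ε → B} {g : ι → B} {Γ : PhaseSpace 𝒜 ε}
    (h : HasRightGradAt f g Γ) (c : B) :
    HasRightGradAt (fun Γ => c * f Γ) (fun q => c * g q) Γ := by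
  obtain ⟨L, hL, e⟩ := h
  refine ⟨c • L, HasFDerivAt.const_mul (𝕜 := ℝ) (𝔸 := B) (E := PhaseSpace 𝒜 ε) hL c, fun v => ?_⟩
  simp [e, Finset.mul_sum, mul_assoc]

theorem HasRightGradAt.fun_sum {κ : Type*} {s : Finset κ} {f : κ → PhaseSpace 𝒜 ε → B}
    {g : κ → ι → B} {Γ : PhaseSpace 𝒜 ε} (h : ∀ k ∈ s, HasRightGradAt (f k) (g k) Γ) :
    HasRightGradAt (fun Γ => ∑ k ∈ s, f k Γ) (fun q => ∑ k ∈ s, g k q) Γ := by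
  classical
  choose! L hL e using h
  refine ⟨∑ k ∈ s, L k, HasFDerivAt.fun_sum (𝕜 := ℝ) (F := B) (E := PhaseSpace 𝒜 ε) hL, fun v => ?_⟩
  rw [sum_apply, Finset.sum_congr rfl fun k hk => e k hk v, Finset.sum_comm]
  simp [Finset.sum_mul]

/-- In (df) g the differential dΓ^r has to be moved to the right of g; only the parity of g at the
point Γ matters. -/
theorem HasRightGradAt.mul (h𝒜 : IsSupernumberAlgebra 𝒜) {f g : PhaseSpace 𝒜 ε → B}
    {f' g' : ι → B} {Γ : PhaseSpace 𝒜 ε} {j : ZMod 2} (hf : HasRightGradAt f f' Γ)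
    (hg : HasRightGradAt g g' Γ) (hj : g Γ ∈ 𝒜 j) :
    HasRightGradAt (fun Γ => f Γ * g Γ)
      (fun r => f Γ * g' r + ksign (ε r * j) • (f' r * g Γ)) Γ := by
  obtain ⟨L, hL, e⟩ := hf
  obtain ⟨L', hL', e'⟩ := hg
  refine ⟨f Γ • L' + MulOpposite.op (g Γ) • L, HasFDerivAt.mul' (𝕜 := ℝ) (𝔸 := B)
    (E := PhaseSpace 𝒜 ε) hL hL', fun v => ?_⟩
  simp only [add_apply, smul_apply, smul_eq_mul,
    MulOpposite.smul_eq_mul_unop, MulOpposite.unop_op, e, e', Finset.mul_sum, Finset.sum_mul,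
    ← Finset.sum_add_distrib]
  refine Finset.sum_congr rfl fun q _ => ?_
  rw [add_mul, smul_mul_assoc, mul_assoc, mul_assoc, mul_assoc, h𝒜.supercomm (v q).2 hj,
    mul_smul_comm]

/-- The coordinate `Γ^p` as a continuous linear map. -/
noncomputable def coordL (p : ι) : PhaseSpace 𝒜 ε →L[ℝ] B :=
  (𝒜 (ε p)).subtypeL.comp (ContinuousLinearMap.proj (R := ℝ) (φ := fun p => 𝒜 (ε p)) p)

theorem coordL_apply (p : ι) (Γ : PhaseSpace 𝒜 ε) : coordL p Γ = (Γ p : B) := rfl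

theorem hasRightGradAt_coord [DecidableEq ι] (p : ι) (Γ : PhaseSpace 𝒜 ε) :
    HasRightGradAt (coord p) (fun q => if q = p then 1 else 0) Γ := by
  refine ⟨coordL p, ContinuousLinearMap.hasFDerivAt (𝕜 := ℝ) (F := B)
    (E := PhaseSpace 𝒜 ε) (coordL p), fun v => by simp [coordL]⟩

theorem HasRightGradAt.continuousAt {f : PhaseSpace 𝒜 ε → B} {g : ι → B} {Γ : PhaseSpace 𝒜 ε}
    (h : HasRightGradAt f g Γ) : ContinuousAt f Γ := by
  obtain ⟨L, hL, -⟩ := h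
  exact hL.continuousAt

theorem IsSuperC.hasRightGradAt {n : ℕ} {f : PhaseSpace 𝒜 ε → B} (h : IsSuperC (n + 1) f)
    (Γ : PhaseSpace 𝒜 ε) : HasRightGradAt f (fun q => rderiv f q Γ) Γ :=
  hasRightGradAt_rderiv (h.1 Γ)

theorem IsSuperC.rderiv {n : ℕ} {f : PhaseSpace 𝒜 ε → B} (h : IsSuperC (n + 1) f) (q : ι) :
    IsSuperC n (rderiv f q) := h.2 q

theorem IsSuperC.of_succ {n : ℕ} {f : PhaseSpace 𝒜 ε → B} (h : IsSuperC (n + 1) f) :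
    IsSuperC n f := by
  induction n generalizing f with
  | zero => exact continuous_iff_continuousAt.2 fun Γ => (h.hasRightGradAt Γ).continuousAt
  | succ n ih => exact ⟨h.1, fun q => ih (h.2 q)⟩

theorem IsSuperC.continuous {n : ℕ} {f : PhaseSpace 𝒜 ε → B} (h : IsSuperC n f) :
    Continuous f := by
  induction n with
  | zero => exact h
  | succ n ih => exact ih h.of_succ

variable [GradedAlgebra 𝒜]

theorem IsSuperC.sum_const_mul (h𝒜 : IsSupernumberAlgebra 𝒜) {κ : Type*} {s : Finset κ} {n : ℕ}
    {f : κ → PhaseSpace 𝒜 ε → B} (c : κ → B) (h : ∀ k ∈ s, IsSuperC n (f k)) :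
    IsSuperC n (fun Γ => ∑ k ∈ s, c k * f k Γ) := by
  induction n generalizing f with
  | zero =>
    exact continuous_finsetSum _ fun k hk => continuous_const.mul (h k hk)
  | succ n ih =>
    have hg (Γ) := HasRightGradAt.fun_sum fun k hk => ((h k hk).hasRightGradAt Γ).const_mul (c k)
    refine ⟨fun Γ => ⟨_, hg Γ⟩, fun q => ?_⟩
    rw [show BAB.rderiv (fun Γ => ∑ k ∈ s, c k * f k Γ) q =
      fun Γ => ∑ k ∈ s, c k * BAB.rderiv (f k) q Γ from funext fun Γ => (hg Γ).rderiv_eq h𝒜 q]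
    exact ih fun k hk => (h k hk).rderiv q

theorem IsSuperC.rderiv_mem (h𝒜 : IsSupernumberAlgebra 𝒜) {n : ℕ} {i : ZMod 2}
    {f : PhaseSpace 𝒜 ε → B} (h : IsSuperC (n + 1) f) (hf : ∀ Γ, f Γ ∈ 𝒜 i) (q : ι)
    (Γ : PhaseSpace 𝒜 ε) : BAB.rderiv f q Γ ∈ 𝒜 (i + ε q) :=
  (h.hasRightGradAt Γ).mem h𝒜 hf q

/-- Second right derivatives are graded symmetric. -/
theorem IsSuperC.rderiv_rderiv_comm (h𝒜 : IsSupernumberAlgebra 𝒜) {f : PhaseSpace 𝒜 ε → B}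
    (h : IsSuperC 2 f) (p q : ι) (Γ : PhaseSpace 𝒜 ε) :
    BAB.rderiv (BAB.rderiv f p) q Γ =
      ksign (ε p * ε q) • BAB.rderiv (BAB.rderiv f q) p Γ := by
  choose L₀ hL₀ e₀ using h.hasRightGradAt
  choose L hL e using fun p => (h.rderiv p).hasRightGradAt Γ
  have h3 := sum_mul_symmetric (E := PhaseSpace 𝒜 ε) coordL hL₀ e₀ hL
  refine sub_eq_zero.1 (h𝒜.eq_zero_of_mul (ε q) fun θ hθ =>
    h𝒜.eq_zero_of_mul (ε p) fun η hη => ?_)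
  -- Two single-coordinate variations, θ along Γ^q and η along Γ^p; restoring the order of η and θ
  -- produces the sign (-1)^{ε_p ε_q}.
  have h4 := h3 (tangent q ⟨θ, hθ⟩) (tangent p ⟨η, hη⟩)
  simp only [coordL_apply, e, sum_mul_tangent] at h4
  rw [sub_mul, sub_mul, h4, smul_mul_assoc, smul_mul_assoc, mul_assoc, mul_assoc,
    h𝒜.supercomm hη hθ, mul_smul_comm, sub_self]

end GradCalculus

/-! ### The generators `s^a` on functions on the phase space -/

namespace ConstrainedSystem

variable {B ι : Type*} [NormedRing B] [NormedAlgebra ℝ B] [Fintype ι] [DecidableEq ι]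
  {𝒜 : ZMod 2 → Submodule ℝ B} [GradedAlgebra 𝒜] {ε : ι → ZMod 2}
  (S : ConstrainedSystem 𝒜 ε) (h𝒜 : IsSupernumberAlgebra 𝒜)

theorem ksign_mul_one_add (i : ZMod 2) : ksign (i * (1 + i)) = 1 := by
  revert i; decide

include h𝒜

/-- For an odd function the conversion sign has exponent ε_q (1 + ε_q), which is always even. -/
theorem lderiv_Ω (a : Fin 2) (q : ι) (Γ : PhaseSpace 𝒜 ε) :
    lderiv (S.Ω a) q Γ = rderiv (S.Ω a) q Γ := by
  have := (((S.Ω_smooth a).hasRightGradAt Γ).hasLeftGradAt h𝒜 (S.Ω_odd a)).lderiv_eq h𝒜 q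
  rw [this, ksign_mul_one_add, one_smul]

theorem X_eq (p : ι) (a : Fin 2) (Γ : PhaseSpace 𝒜 ε) :
    S.X p a Γ = ∑ q, S.ω p q * rderiv (S.Ω a) q Γ := by
  rw [X, s, bracket, Finset.sum_eq_single p]
  · refine Finset.sum_congr rfl fun q _ => ?_
    rw [(hasRightGradAt_coord p Γ).rderiv_eq h𝒜, S.lderiv_Ω h𝒜]; simp
  · intro r _ hr
    simp [(hasRightGradAt_coord p Γ).rderiv_eq h𝒜, hr]
  · simp

theorem s_eq (a : Fin 2) (f : PhaseSpace 𝒜 ε → B) (Γ : PhaseSpace 𝒜 ε) :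
    S.s a f Γ = ∑ q, rderiv f q Γ * S.X q a Γ := by
  rw [s, bracket]
  refine Finset.sum_congr rfl fun q _ => ?_
  rw [S.X_eq h𝒜, Finset.mul_sum]
  simp_rw [S.lderiv_Ω h𝒜, mul_assoc]

theorem rderiv_Ω_mem (a : Fin 2) (q : ι) (Γ : PhaseSpace 𝒜 ε) :
    rderiv (S.Ω a) q Γ ∈ 𝒜 (1 + ε q) := (S.Ω_smooth a).rderiv_mem h𝒜 (S.Ω_odd a) q Γ

theorem X_mem (p : ι) (a : Fin 2) (Γ : PhaseSpace 𝒜 ε) : S.X p a Γ ∈ 𝒜 (ε p + 1) := by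
  rw [S.X_eq h𝒜]
  refine Submodule.sum_mem _ fun q _ => mul_mem_of_eq (S.ω_even p q) (S.rderiv_Ω_mem h𝒜 a q Γ) ?_
  generalize ε p = i; generalize ε q = j; revert i j; decide

theorem X_isSuperC (p : ι) (a : Fin 2) : IsSuperC 2 (S.X p a) := by
  rw [show S.X p a = fun Γ => ∑ q, S.ω p q * rderiv (S.Ω a) q Γ from funext (S.X_eq h𝒜 p a)]
  exact IsSuperC.sum_const_mul h𝒜 _ fun q _ => (S.Ω_smooth a).rderiv q

theorem rderiv_X (p : ι) (a : Fin 2) (r : ι) (Γ : PhaseSpace 𝒜 ε) :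
    rderiv (S.X p a) r Γ = ∑ q, S.ω p q * rderiv (rderiv (S.Ω a) q) r Γ := by
  rw [show S.X p a = fun Γ => ∑ q, S.ω p q * rderiv (S.Ω a) q Γ from funext (S.X_eq h𝒜 p a)]
  exact HasRightGradAt.rderiv_eq h𝒜 (HasRightGradAt.fun_sum fun q _ =>
    ((((S.Ω_smooth a).rderiv q).hasRightGradAt Γ).const_mul _)) r

theorem rderiv_X_mem (p : ι) (a : Fin 2) (r : ι) (Γ : PhaseSpace 𝒜 ε) :
    rderiv (S.X p a) r Γ ∈ 𝒜 (ε p + 1 + ε r) :=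
  (S.X_isSuperC h𝒜 p a).rderiv_mem h𝒜 (S.X_mem h𝒜 p a) r Γ

/-- Liouville's theorem: the graded antisymmetric ω is contracted with the graded symmetric second
derivatives of Ω^a, so the sum equals its own negative. -/
theorem sum_rderiv_X (a : Fin 2) (Γ : PhaseSpace 𝒜 ε) : ∑ p, rderiv (S.X p a) p Γ = 0 := by
  have h : ∑ p, rderiv (S.X p a) p Γ = -∑ p, rderiv (S.X p a) p Γ := by
    simp_rw [S.rderiv_X h𝒜]
    conv_lhs => rw [Finset.sum_comm]
    simp_rw [← Finset.sum_neg_distrib]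
    refine Finset.sum_congr rfl fun p _ => Finset.sum_congr rfl fun q _ => ?_
    rw [S.ω_antisymm q p, (S.Ω_smooth a).of_succ.rderiv_rderiv_comm h𝒜 p q Γ, sgn_mul, neg_mul,
      smul_mul_assoc, mul_smul_comm, mul_comm (ε q), ksign_smul_smul]
  have h2 : (2 : ℝ) • ∑ p, rderiv (S.X p a) p Γ = 0 := by
    rw [two_smul]; nth_rewrite 1 [h]; simp
  exact (smul_eq_zero.1 h2).resolve_left two_ne_zero

/-- The equations `{s^a, s^b} Γ^p = 0`, from `{Ω^a, Ω^b} = 0`. -/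
theorem rderiv_X_mul_X_symm (p : ι) (a b : Fin 2) (Γ : PhaseSpace 𝒜 ε) :
    ∑ q, rderiv (S.X p a) q Γ * S.X q b Γ = -∑ q, rderiv (S.X p b) q Γ * S.X q a Γ := by
  have hΩ (Γ) : ∑ p, rderiv (S.Ω a) p Γ * S.X p b Γ = 0 := by
    rw [← S.s_eq h𝒜]; exact S.generating a b Γ
  -- The generating equation holds at every Γ, so its gradient vanishes too. The two halves of this
  -- gradient are the two sides of `key`, which is finally contracted with ω^{pr}.
  have hgrad := HasRightGradAt.fun_sum (s := Finset.univ) fun p _ =>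
    (((S.Ω_smooth a).rderiv p).hasRightGradAt Γ).mul h𝒜 ((S.X_isSuperC h𝒜 p b).hasRightGradAt Γ)
      (S.X_mem h𝒜 p b Γ)
  have hzero : HasRightGradAt (fun _ : PhaseSpace 𝒜 ε => (0 : B)) (fun _ => 0) Γ :=
    ⟨0, hasFDerivAt_const 0 Γ, by simp⟩
  rw [show (fun Γ => ∑ p, rderiv (S.Ω a) p Γ * S.X p b Γ) = fun _ => 0 from funext hΩ] at hgrad
  have key (r : ι) : ∑ q, rderiv (rderiv (S.Ω a) r) q Γ * S.X q b Γ =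
      -∑ q, rderiv (rderiv (S.Ω b) r) q Γ * S.X q a Γ := by
    have h0 := congrFun (hgrad.unique h𝒜 hzero) r
    simp only [Finset.sum_add_distrib] at h0
    have h1 : ∑ p, rderiv (S.Ω a) p Γ * rderiv (S.X p b) r Γ =
        ksign (ε r) • ∑ q, rderiv (rderiv (S.Ω b) r) q Γ * S.X q a Γ := by
      simp_rw [S.rderiv_X h𝒜, Finset.mul_sum]
      rw [Finset.sum_comm, Finset.smul_sum]
      refine Finset.sum_congr rfl fun q _ => ?_
      -- Reversing the indices of ω by antisymmetry turns the contraction with Ω^a_{,p} back into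
      -- X^{qa}.
      have h2 : ∑ p, rderiv (S.Ω a) p Γ * S.ω p q = -(ksign (ε q) • S.X q a Γ) := by
        rw [S.X_eq h𝒜, Finset.smul_sum, ← Finset.sum_neg_distrib]
        refine Finset.sum_congr rfl fun p _ => ?_
        rw [S.ω_antisymm p q, sgn_mul, mul_neg, mul_smul_comm,
          h𝒜.supercomm (S.rderiv_Ω_mem h𝒜 a p Γ) (S.ω_even q p), smul_smul]
        congr 2
        generalize ε p = i; generalize ε q = j; revert i j; decide
      simp_rw [← mul_assoc, ← Finset.sum_mul, h2]
      rw [neg_mul, smul_mul_assoc,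
        h𝒜.supercomm (S.X_mem h𝒜 q a Γ) (((S.Ω_smooth b).rderiv q).rderiv_mem h𝒜
          (S.rderiv_Ω_mem h𝒜 b q) r Γ),
        (S.Ω_smooth b).of_succ.rderiv_rderiv_comm h𝒜 q r Γ, smul_mul_assoc, smul_smul, smul_smul,
        ← neg_smul]
      congr 1
      generalize ε r = i; generalize ε q = j; revert i j; decide
    have h2 : ∑ p, ksign (ε r * (ε p + 1)) • (rderiv (rderiv (S.Ω a) p) r Γ * S.X p b Γ) =
        ksign (ε r) • ∑ q, rderiv (rderiv (S.Ω a) r) q Γ * S.X q b Γ := by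
      rw [Finset.smul_sum]
      refine Finset.sum_congr rfl fun p _ => ?_
      rw [(S.Ω_smooth a).of_succ.rderiv_rderiv_comm h𝒜 p r Γ, smul_mul_assoc, smul_smul]
      congr 1
      generalize ε r = i; generalize ε p = j; revert i j; decide
    rw [h1, h2, ← smul_add] at h0
    have h3 := congrArg (fun x => ksign (ε r) • x) h0
    simp only [ksign_smul_smul, smul_zero] at h3
    rw [eq_neg_iff_add_eq_zero, add_comm]; exact h3
  have expand (a b : Fin 2) : ∑ q, rderiv (S.X p a) q Γ * S.X q b Γ =
      ∑ r, S.ω p r * ∑ q, rderiv (rderiv (S.Ω a) r) q Γ * S.X q b Γ := by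
    simp_rw [S.rderiv_X h𝒜, Finset.mul_sum, Finset.sum_mul]
    rw [Finset.sum_comm]
    simp_rw [mul_assoc]
  rw [expand, expand, ← Finset.sum_neg_distrib]
  exact Finset.sum_congr rfl fun r _ => by rw [key, mul_neg]

theorem hasRightGradAt_s {f : PhaseSpace 𝒜 ε → B} (hf : IsSuperC 2 f) (a : Fin 2)
    (Γ : PhaseSpace 𝒜 ε) :
    HasRightGradAt (S.s a f) (fun r => ∑ q, (rderiv f q Γ * rderiv (S.X q a) r Γ +
      ksign (ε r * (ε q + 1)) • (rderiv (rderiv f q) r Γ * S.X q a Γ))) Γ := by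
  rw [show S.s a f = fun Γ => ∑ q, rderiv f q Γ * S.X q a Γ from funext (S.s_eq h𝒜 a f)]
  exact HasRightGradAt.fun_sum fun q _ => ((hf.rderiv q).hasRightGradAt Γ).mul h𝒜
    ((S.X_isSuperC h𝒜 q a).hasRightGradAt Γ) (S.X_mem h𝒜 q a Γ)

/-- `s^a s^b + s^b s^a = 0`. -/
theorem s_s {f : PhaseSpace 𝒜 ε → B} (hf : IsSuperC 2 f) (a b : Fin 2) (Γ : PhaseSpace 𝒜 ε) :
    S.s b (S.s a f) Γ = -S.s a (S.s b f) Γ := by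
  -- The first sum is antisymmetric in a, b by `rderiv_X_mul_X_symm`. In the second, the graded
  -- symmetric Hessian of f meets a product of two X's of shifted parity, which leaves one net minus
  -- sign.
  have expand (a b : Fin 2) : S.s b (S.s a f) Γ =
      ∑ q, rderiv f q Γ * (∑ r, rderiv (S.X q a) r Γ * S.X r b Γ) +
      ∑ q, ∑ r, ksign (ε r * (ε q + 1)) •
        (rderiv (rderiv f q) r Γ * (S.X q a Γ * S.X r b Γ)) := by
    rw [S.s_eq h𝒜]
    simp_rw [fun r => (S.hasRightGradAt_s h𝒜 hf a Γ).rderiv_eq h𝒜 r, Finset.sum_mul, add_mul,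
      Finset.sum_add_distrib, Finset.mul_sum, smul_mul_assoc, mul_assoc]
    congr 1 <;> rw [Finset.sum_comm]
  rw [expand a b, expand b a, neg_add, ← Finset.sum_neg_distrib]
  congr 1
  · refine Finset.sum_congr rfl fun q _ => ?_
    rw [S.rderiv_X_mul_X_symm h𝒜, mul_neg]
  · rw [Finset.sum_comm, ← Finset.sum_neg_distrib]
    refine Finset.sum_congr rfl fun q _ => ?_
    rw [← Finset.sum_neg_distrib]
    refine Finset.sum_congr rfl fun r _ => ?_
    rw [hf.rderiv_rderiv_comm h𝒜 r q Γ, h𝒜.supercomm (S.X_mem h𝒜 r a Γ) (S.X_mem h𝒜 q b Γ),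
      smul_mul_assoc, mul_smul_comm, smul_smul, smul_smul, ← neg_smul]
    congr 1
    generalize ε r = i; generalize ε q = j; revert i j; decide

theorem s_s_self {f : PhaseSpace 𝒜 ε → B} (hf : IsSuperC 2 f) (a : Fin 2) (Γ : PhaseSpace 𝒜 ε) :
    S.s a (S.s a f) Γ = 0 := by
  have h2 : (2 : ℝ) • S.s a (S.s a f) Γ = 0 := by
    rw [two_smul]; nth_rewrite 1 [S.s_s h𝒜 hf a a Γ]; simp
  exact (smul_eq_zero.1 h2).resolve_left two_ne_zero

/-- `s^b s^a Γ^p = ε^{ab} Y^p`. -/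
theorem s_X (p : ι) (a b : Fin 2) (Γ : PhaseSpace 𝒜 ε) :
    S.s b (S.X p a) Γ = epsUp a b • S.Y p Γ := by
  have hanti (a b : Fin 2) : S.s b (S.X p a) Γ = -S.s a (S.X p b) Γ := by
    -- Antisymmetry in a, b leaves one independent component, and -½ ε_{ab} s^b s^a Γ^p counts it
    -- exactly once.
    rw [S.s_eq h𝒜, S.s_eq h𝒜]; exact S.rderiv_X_mul_X_symm h𝒜 p a b Γ
  have hself (a : Fin 2) : S.s a (S.X p a) Γ = 0 := by
    have h2 : (2 : ℝ) • S.s a (S.X p a) Γ = 0 := by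
      rw [two_smul]; nth_rewrite 1 [hanti a a]; simp
    exact (smul_eq_zero.1 h2).resolve_left two_ne_zero
  have hY : S.Y p Γ = S.s 1 (S.X p 0) Γ := by
    rw [Y, sSq]
    simp only [Fin.sum_univ_two, epsLow]
    change (-(1 / 2) : ℝ) • ((0 : ℝ) • S.s 0 (S.X p 0) Γ + (-1 : ℝ) • S.s 1 (S.X p 0) Γ +
      ((1 : ℝ) • S.s 0 (S.X p 1) Γ + (0 : ℝ) • S.s 1 (S.X p 1) Γ)) = _
    rw [hanti 1 0]
    module
  fin_cases a <;> fin_cases b <;> simp [epsUp, hself, hY]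
  exact hanti 1 0

theorem Y_eq (p : ι) (Γ : PhaseSpace 𝒜 ε) :
    S.Y p Γ = S.s 1 (S.X p 0) Γ := by
  rw [S.s_X h𝒜]; simp [epsUp]

theorem Y_mem (p : ι) (Γ : PhaseSpace 𝒜 ε) : S.Y p Γ ∈ 𝒜 (ε p) := by
  rw [S.Y_eq h𝒜, S.s_eq h𝒜]
  refine Submodule.sum_mem _ fun q _ =>
    mul_mem_of_eq (S.rderiv_X_mem h𝒜 p 0 q Γ) (S.X_mem h𝒜 q 1 Γ) ?_
  generalize ε p = i; generalize ε q = j; revert i j; decide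

theorem hasRightGradAt_Y (p : ι) (Γ : PhaseSpace 𝒜 ε) :
    HasRightGradAt (S.Y p) (fun r => ∑ q, (rderiv (S.X p 0) q Γ * rderiv (S.X q 1) r Γ +
      ksign (ε r * (ε q + 1)) • (rderiv (rderiv (S.X p 0) q) r Γ * S.X q 1 Γ))) Γ := by
  rw [show S.Y p = S.s 1 (S.X p 0) from funext (S.Y_eq h𝒜 p)]
  exact S.hasRightGradAt_s h𝒜 (S.X_isSuperC h𝒜 p 0) 1 Γ

/-- Y contains second derivatives of Ω, so the three derivatives assumed of Ω leave exactly the one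
that W requires. -/
theorem Y_isSuperC (p : ι) : IsSuperC 1 (S.Y p) := by
  refine ⟨fun Γ => ⟨_, S.hasRightGradAt_Y h𝒜 p Γ⟩, fun r => ?_⟩
  change Continuous _
  rw [show rderiv (S.Y p) r = _ from
    funext fun Γ => (S.hasRightGradAt_Y h𝒜 p Γ).rderiv_eq h𝒜 r]
  refine continuous_finsetSum _ fun q _ => ?_
  have hX (p a) := S.X_isSuperC h𝒜 p a
  have h1 := ((hX p 0).rderiv q).continuous
  have h2 := ((hX q 1).rderiv r).continuous
  have h3 := (((hX p 0).rderiv q).rderiv r).continuous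
  have h4 := (hX q 1).continuous
  fun_prop

theorem rderiv_Y_mem (p r : ι) (Γ : PhaseSpace 𝒜 ε) : rderiv (S.Y p) r Γ ∈ 𝒜 (ε p + ε r) :=
  (S.Y_isSuperC h𝒜 p).rderiv_mem h𝒜 (S.Y_mem h𝒜 p) r Γ

/-- `s^a s^2 Γ^p = 0`. -/
theorem s_Y (p : ι) (a : Fin 2) (Γ : PhaseSpace 𝒜 ε) : ∑ q, rderiv (S.Y p) q Γ * S.X q a Γ = 0 := by
  rw [← S.s_eq h𝒜, show S.Y p = S.s 1 (S.X p 0) from funext (S.Y_eq h𝒜 p)]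
  have h0 := S.X_isSuperC h𝒜 p 0
  -- With Y = s^1 s^0 Γ (indices 0, 1), a third generator repeats one of these two; anticommuting
  -- equal ones together gives 0.
  fin_cases a
  · change S.s 0 (S.s 1 (S.X p 0)) Γ = 0
    have h1 : S.s 0 (S.X p 0) = fun _ => 0 := by
      funext Γ; rw [S.s_X h𝒜]; simp [epsUp]
    have hzero (Γ) : HasRightGradAt (fun _ : PhaseSpace 𝒜 ε => (0 : B)) (fun _ => 0) Γ :=
      ⟨0, hasFDerivAt_const 0 Γ, by simp⟩
    rw [S.s_s h𝒜 h0, h1, S.s_eq h𝒜]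
    simp [(hzero Γ).rderiv_eq h𝒜]
  · exact S.s_s_self h𝒜 h0 1 Γ

/-- Differentiating Y = X^0_{,q} X^{q1} gives a product of first derivatives and a term with second
derivatives of X^0. In the supertrace the latter is the gradient of the divergence of X^0, which is
zero. -/
theorem str_rderiv_Y (Γ : PhaseSpace 𝒜 ε) :
    ∑ p, ksign (ε p) • rderiv (S.Y p) p Γ =
      ∑ p, ∑ q, ksign (ε p) • (rderiv (S.X p 0) q Γ * rderiv (S.X q 1) p Γ) := by
  simp_rw [fun p => (S.hasRightGradAt_Y h𝒜 p Γ).rderiv_eq h𝒜 p, Finset.smul_sum, smul_add,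
    Finset.sum_add_distrib]
  rw [add_eq_left, Finset.sum_comm]
  have hdiv (q : ι) : ∑ p, rderiv (rderiv (S.X p 0) p) q Γ = 0 := by
    have h1 := HasRightGradAt.fun_sum (s := Finset.univ) fun p _ =>
      ((S.X_isSuperC h𝒜 p 0).rderiv p).hasRightGradAt Γ
    rw [show (fun Γ => ∑ p, rderiv (S.X p 0) p Γ) = fun _ => 0 from
      funext (S.sum_rderiv_X h𝒜 0)] at h1
    exact congrFun (h1.unique h𝒜 (g' := fun _ => 0) ⟨0, hasFDerivAt_const 0 Γ, by simp⟩) q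
  refine Finset.sum_eq_zero fun q _ => ?_
  rw [← zero_mul (S.X q 1 Γ), ← hdiv q, Finset.sum_mul]
  refine Finset.sum_congr rfl fun p _ => ?_
  rw [(S.X_isSuperC h𝒜 p 0).rderiv_rderiv_comm h𝒜 q p Γ, smul_mul_assoc, smul_smul, smul_smul]
  conv_rhs => rw [← one_smul ℤ (rderiv (rderiv (S.X p 0) p) q Γ * S.X q 1 Γ)]
  congr 1
  generalize ε p = i; generalize ε q = j; revert i j; decide

end ConstrainedSystem
end BAB

namespace BAB
namespace Kernel

/-! ### The ring of continuous kernels -/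

section ContinuousKernels

variable {T ι B : Type*} [NormedRing B] [NormedAlgebra ℝ B]

theorem add_loc (A C : Kernel T ι B) (t : T) : (A + C).loc t = A.loc t + C.loc t := rfl

theorem add_reg (A C : Kernel T ι B) (t t' : T) : (A + C).reg t t' = A.reg t t' + C.reg t t' := rfl

theorem sum_loc {κ : Type*} (s : Finset κ) (A : κ → Kernel T ι B) (t : T) :
    (∑ k ∈ s, A k).loc t = ∑ k ∈ s, (A k).loc t :=
  map_sum (AddMonoidHom.mk' (fun A : Kernel T ι B => A.loc t) fun _ _ => rfl) A s

theorem sum_reg {κ : Type*} (s : Finset κ) (A : κ → Kernel T ι B) (t t' : T) :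
    (∑ k ∈ s, A k).reg t t' = ∑ k ∈ s, (A k).reg t t' :=
  map_sum (AddMonoidHom.mk' (fun A : Kernel T ι B => A.reg t t') fun _ _ => rfl) A s

theorem ext_iff {A C : Kernel T ι B} :
    A = C ↔ (∀ t, A.loc t = C.loc t) ∧ ∀ t t', A.reg t t' = C.reg t t' := by
  refine ⟨by rintro rfl; exact ⟨fun _ => rfl, fun _ _ => rfl⟩, fun h => Prod.ext ?_ ?_⟩
  · exact funext h.1
  · exact funext₂ h.2

theorem ext {A C : Kernel T ι B} (h : ∀ t, A.loc t = C.loc t)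
    (hreg : ∀ t t', A.reg t t' = C.reg t t') : A = C := ext_iff.2 ⟨h, hreg⟩

/-- A kernel with continuous parts `D` and `K`. -/
structure IsCont [TopologicalSpace T] (A : Kernel T ι B) : Prop where
  loc : Continuous A.loc
  reg : Continuous fun x : T × T => A.reg x.1 x.2

variable [TopologicalSpace T] [CompactSpace T] [T2Space T] [SecondCountableTopology T]
  [MeasureSpace T] [BorelSpace T] [IsFiniteMeasure (volume : Measure T)]
  [CompleteSpace B] [Fintype ι] [DecidableEq ι]

theorem integrable_of_continuous {E : Type*} [NormedAddCommGroup E] {f : T → E}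
    (hf : Continuous f) : Integrable f :=
  hf.integrable_of_hasCompactSupport (HasCompactSupport.of_compactSpace f)

theorem continuous_integral {E X : Type*} [NormedAddCommGroup E] [NormedSpace ℝ E]
    [TopologicalSpace X] [FirstCountableTopology X] [LocallyCompactSpace X] {f : X → T → E}
    (hf : Continuous (Function.uncurry f)) : Continuous fun x => ∫ t, f x t := by
  simpa using continuous_parametric_integral_of_continuous (μ := volume) hf isCompact_univ

attribute [local instance] Matrix.linftyOpNormedRing Matrix.linftyOpNormedAlgebra

/-- The operator norm makes matrices a Banach algebra, so that kernels can be multiplied and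
integrated as matrix-valued functions; its uniform structure is that of the product. -/
theorem completeSpace_matrix :
    @CompleteSpace (Matrix ι ι B) PseudoMetricSpace.toUniformSpace :=
  inferInstanceAs (CompleteSpace (ι → ι → B))

attribute [local instance] completeSpace_matrix

theorem integral_add_add {E : Type*} [NormedAddCommGroup E] [NormedSpace ℝ E] {f g h : T → E}
    (hf : Continuous f) (hg : Continuous g) (hh : Continuous h) :
    ∫ t, (f t + g t + h t) = (∫ t, f t) + (∫ t, g t) + ∫ t, h t := by
  rw [integral_add (f := fun t => f t + g t) (integrable_of_continuous (hf.add hg))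
    (integrable_of_continuous hh),
    integral_add (integrable_of_continuous hf) (integrable_of_continuous hg)]

/-- Links the entrywise integral in the definition of the product with the integral of a
matrix-valued function. -/
theorem integral_matrix_apply {f : T → Matrix ι ι B} (hf : Continuous f) (p q : ι) :
    (∫ t, f t) p q = ∫ t, f t p q := by
  let L : Matrix ι ι B →L[ℝ] B :=
    ⟨Matrix.entryLinearMap ℝ B p q, continuous_id.matrix_elem p q⟩
  exact (L.integral_comp_comm (integrable_of_continuous hf)).symm

theorem mul_loc (A C : Kernel T ι B) (t : T) : (A * C).loc t = A.loc t * C.loc t := rfl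

theorem IsCont.reg_right {A : Kernel T ι B} (hA : A.IsCont) (t : T) :
    Continuous fun r => A.reg t r := hA.reg.comp (by fun_prop : Continuous fun r => (t, r))

theorem IsCont.reg_left {A : Kernel T ι B} (hA : A.IsCont) (t : T) :
    Continuous fun r => A.reg r t := hA.reg.comp (by fun_prop : Continuous fun r => (r, t))

theorem IsCont.continuous_reg_mul {A C : Kernel T ι B} (hA : A.IsCont) (hC : C.IsCont) (t t' : T) :
    Continuous fun r => A.reg t r * C.reg r t' := (hA.reg_right t).mul (hC.reg_left t')

theorem IsCont.mul_reg {A C : Kernel T ι B} (hA : A.IsCont) (hC : C.IsCont) (t t' : T) :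
    (A * C).reg t t' = A.loc t * C.reg t t' + A.reg t t' * C.loc t' +
      ∫ r, A.reg t r * C.reg r t' := by
  have : (A * C).reg t t' = A.loc t * C.reg t t' + A.reg t t' * C.loc t' +
    Matrix.of fun p q => ∫ r, (A.reg t r * C.reg r t') p q := rfl
  rw [this]
  congr 1
  ext p q
  exact (integral_matrix_apply (hA.continuous_reg_mul hC t t') p q).symm

theorem IsCont.mul {A C : Kernel T ι B} (hA : A.IsCont) (hC : C.IsCont) : (A * C).IsCont where
  loc := hA.loc.mul hC.loc
  reg := by
    simp_rw [hA.mul_reg hC]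
    have h1 := hA.loc
    have h2 := hC.loc
    have h3 := hA.reg
    have h4 := hC.reg
    refine (((h1.comp continuous_fst).mul h4).add (h3.mul (h2.comp continuous_snd))).add
      (continuous_integral ?_)
    exact (h3.comp (by fun_prop : Continuous fun x : (T × T) × T => (x.1.1, x.2))).mul
      (h4.comp (by fun_prop : Continuous fun x : (T × T) × T => (x.2, x.1.2)))

theorem IsCont.add {A C : Kernel T ι B} (hA : A.IsCont) (hC : C.IsCont) : (A + C).IsCont :=
  ⟨hA.loc.add hC.loc, hA.reg.add hC.reg⟩

theorem IsCont.neg {A : Kernel T ι B} (hA : A.IsCont) : (-A).IsCont :=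
  ⟨hA.loc.neg, hA.reg.neg⟩

theorem isCont_zero : (0 : Kernel T ι B).IsCont := ⟨continuous_const, continuous_const⟩

theorem isCont_one : (1 : Kernel T ι B).IsCont := ⟨continuous_const, continuous_const⟩

theorem IsCont.one_mul {A : Kernel T ι B} (hA : A.IsCont) : 1 * A = A := by
  refine ext (fun t => Matrix.one_mul _) fun t t' => ?_
  rw [isCont_one.mul_reg hA]
  change 1 * A.reg t t' + 0 * A.loc t' + ∫ r, 0 * A.reg r t' = _
  simp

theorem IsCont.mul_one {A : Kernel T ι B} (hA : A.IsCont) : A * 1 = A := by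
  refine ext (fun t => Matrix.mul_one _) fun t t' => ?_
  rw [hA.mul_reg isCont_one]
  change A.loc t * 0 + A.reg t t' * 1 + ∫ r, A.reg t r * 0 = _
  simp

theorem IsCont.mul_add {A C E : Kernel T ι B} (hA : A.IsCont) (hC : C.IsCont) (hE : E.IsCont) :
    A * (C + E) = A * C + A * E := by
  refine ext (fun t => Matrix.mul_add _ _ _) fun t t' => ?_
  rw [hA.mul_reg (hC.add hE), add_reg (A * C), hA.mul_reg hC, hA.mul_reg hE]
  simp_rw [add_reg, add_loc, _root_.mul_add]
  rw [integral_add (integrable_of_continuous (hA.continuous_reg_mul hC t t'))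
    (integrable_of_continuous (hA.continuous_reg_mul hE t t'))]
  abel

theorem IsCont.add_mul {A C E : Kernel T ι B} (hA : A.IsCont) (hC : C.IsCont) (hE : E.IsCont) :
    (A + C) * E = A * E + C * E := by
  refine ext (fun t => Matrix.add_mul _ _ _) fun t t' => ?_
  rw [(hA.add hC).mul_reg hE, add_reg (A * E), hA.mul_reg hE, hC.mul_reg hE]
  simp_rw [add_reg, add_loc, _root_.add_mul]
  rw [integral_add (integrable_of_continuous (hA.continuous_reg_mul hE t t'))
    (integrable_of_continuous (hC.continuous_reg_mul hE t t'))]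
  abel

/-- Both sides expand into the same eight contributions of local and regular parts. Fubini is needed
only where all three factors are regular. -/
theorem IsCont.mul_assoc {A C E : Kernel T ι B} (hA : A.IsCont) (hC : C.IsCont) (hE : E.IsCont) :
    A * C * E = A * (C * E) := by
  refine ext (fun t => Matrix.mul_assoc _ _ _) fun t t' => ?_
  have hAl := hA.loc
  have hCl := hC.loc
  have hEl := hE.loc
  have hAr := hA.reg_right t
  have hCr := hC.reg_right t
  have hCr' := hC.reg_left t'
  have hEr := hE.reg_left t'
  have hAC (r : T) : Continuous fun u => A.reg t u * C.reg u r := hAr.mul (hC.reg_left r)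
  have hCE (u : T) : Continuous fun r => C.reg u r * E.reg r t' := (hC.reg_right u).mul hEr
  have hACE : Continuous (Function.uncurry fun r u => A.reg t u * C.reg u r * E.reg r t') :=
    ((hAr.comp continuous_snd).mul (hC.reg.comp continuous_swap)).mul (hEr.comp continuous_fst)
  -- Fubini for a continuous integrand on a compact square.
  have hsw : ∫ r, ∫ u, A.reg t u * C.reg u r * E.reg r t' =
      ∫ u, ∫ r, A.reg t u * C.reg u r * E.reg r t' :=
    integral_integral_swap_of_hasCompactSupport hACE (HasCompactSupport.of_compactSpace _)
  have i1 : ∫ r, (A.loc t * C.reg t r + A.reg t r * C.loc r +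
      ∫ u, A.reg t u * C.reg u r) * E.reg r t' =
      A.loc t * (∫ r, C.reg t r * E.reg r t') + (∫ r, A.reg t r * C.loc r * E.reg r t') +
        ∫ r, ∫ u, A.reg t u * C.reg u r * E.reg r t' := by
    simp_rw [_root_.add_mul]
    have c1 : Continuous fun r => A.loc t * C.reg t r * E.reg r t' := by fun_prop
    have c2 : Continuous fun r => A.reg t r * C.loc r * E.reg r t' := by fun_prop
    have c3 : Continuous fun r => (∫ u, A.reg t u * C.reg u r) * E.reg r t' :=
      (continuous_integral ((hAr.comp continuous_snd).mul (hC.reg.comp continuous_swap))).mul hEr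
    rw [integral_add_add c1 c2 c3]
    congr 2
    · simp_rw [_root_.mul_assoc]
      exact integral_const_mul_of_integrable (integrable_of_continuous (hCE t))
    · funext r
      exact (integral_mul_const_of_integrable (integrable_of_continuous (hAC r))).symm
  have i2 : ∫ u, A.reg t u * (C.loc u * E.reg u t' + C.reg u t' * E.loc t' +
      ∫ r, C.reg u r * E.reg r t') =
      (∫ u, A.reg t u * C.loc u * E.reg u t') + (∫ u, A.reg t u * C.reg u t') * E.loc t' +
        ∫ u, ∫ r, A.reg t u * C.reg u r * E.reg r t' := by
    simp_rw [_root_.mul_add, ← _root_.mul_assoc]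
    have c1 : Continuous fun u => A.reg t u * C.loc u * E.reg u t' := by fun_prop
    have c2 : Continuous fun u => A.reg t u * C.reg u t' * E.loc t' := by fun_prop
    have c3 : Continuous fun u => A.reg t u * ∫ r, C.reg u r * E.reg r t' :=
      hAr.mul (continuous_integral (hC.reg.mul (hEr.comp continuous_snd)))
    rw [integral_add_add c1 c2 c3]
    congr 2
    · exact integral_mul_const_of_integrable (integrable_of_continuous (hAC t'))
    · funext u
      simp_rw [_root_.mul_assoc]
      exact (integral_const_mul_of_integrable (integrable_of_continuous (hCE u))).symm
  rw [(hA.mul hC).mul_reg hE, hA.mul_reg (hC.mul hE), mul_loc, mul_loc, hC.mul_reg hE t t',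
    hA.mul_reg hC t t']
  simp_rw [fun r => hA.mul_reg hC t r, fun u => hC.mul_reg hE u t']
  rw [i1, i2, hsw]
  simp only [_root_.mul_add, _root_.add_mul, _root_.mul_assoc]
  abel

end ContinuousKernels
end Kernel
end BAB

namespace BAB
namespace Kernel

/-! ### Ring structure, parity, and cyclicity of the supertrace. -/

section EvenKernels

variable {T ι B : Type*} [NormedRing B] [NormedAlgebra ℝ B]
  [TopologicalSpace T] [CompactSpace T] [T2Space T] [SecondCountableTopology T]
  [MeasureSpace T] [BorelSpace T] [IsFiniteMeasure (volume : Measure T)]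
  [CompleteSpace B] [Fintype ι] [DecidableEq ι]

variable (T ι B) in
/-- The ring of continuous kernels. -/
def ContKernel : Type _ := {A : Kernel T ι B // A.IsCont}

namespace ContKernel

theorem ext {A C : ContKernel T ι B} (h : A.1 = C.1) : A = C := Subtype.ext h

instance : AddCommGroup (ContKernel T ι B) :=
  AddSubgroup.toAddCommGroup (G := Kernel T ι B)
    { carrier := {A | A.IsCont}
      add_mem' := fun ha hb => IsCont.add ha hb
      zero_mem' := isCont_zero
      neg_mem' := fun ha => IsCont.neg ha }

noncomputable instance : Mul (ContKernel T ι B) := ⟨fun A C => ⟨A.1 * C.1, A.2.mul C.2⟩⟩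

instance : One (ContKernel T ι B) := ⟨⟨1, isCont_one⟩⟩

theorem val_mul (A C : ContKernel T ι B) : (A * C).1 = A.1 * C.1 := rfl

/-- Integrals of non-integrable functions are 0 by convention, so arbitrary kernels need not obey
these laws. Continuity on the compact space T makes every integrand integrable. -/
noncomputable instance : Ring (ContKernel T ι B) :=
  { (inferInstance : AddCommGroup (ContKernel T ι B)) with
    mul_assoc := fun A C E => ext (A.2.mul_assoc C.2 E.2)
    one_mul := fun A => ext A.2.one_mul
    mul_one := fun A => ext A.2.mul_one
    left_distrib := fun A C E => ext (A.2.mul_add C.2 E.2)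
    right_distrib := fun A C E => ext (A.2.add_mul C.2 E.2)
    zero_mul := fun A => by
      have h : (0 : ContKernel T ι B) * A + 0 * A = 0 * A := by
        rw [← show (0 + 0 : ContKernel T ι B) * A = 0 * A + 0 * A from
          ext (isCont_zero.add_mul isCont_zero A.2), add_zero]
      exact add_eq_left.1 h
    mul_zero := fun A => by
      have h : A * (0 : ContKernel T ι B) + A * 0 = A * 0 := by
        rw [← show A * (0 + 0 : ContKernel T ι B) = A * 0 + A * 0 from
          ext (A.2.mul_add isCont_zero isCont_zero), add_zero]
      exact add_eq_left.1 h }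

theorem val_pow (A : ContKernel T ι B) (n : ℕ) : (A ^ n).1 = A.1 ^ n := by
  induction n with
  | zero => rw [pow_zero]; rfl
  | succ n ih => rw [pow_succ, val_mul, ih]; rfl

end ContKernel

/-! ### Parity -/

/-- A closed subspace is complete, so the integral can be taken inside K and the inclusion commutes
with it. -/
theorem integral_mem_of_isClosed {K : Submodule ℝ B} (hK : IsClosed (K : Set B)) {f : T → B}
    (hf : Continuous f) (h : ∀ t, f t ∈ K) : ∫ t, f t ∈ K := by
  have : CompleteSpace K := hK.completeSpace_coe
  have hg : Continuous fun t => (⟨f t, h t⟩ : K) := hf.subtype_mk h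
  have := K.subtypeL.integral_comp_comm (integrable_of_continuous hg)
  change ∫ t, f t = _ at this
  rw [this]
  exact Subtype.property _

/-- A supermatrix of parity `i`. -/
def HasParity (𝒜 : ZMod 2 → Submodule ℝ B) (ε : ι → ZMod 2) (i : ZMod 2) (N : Matrix ι ι B) :
    Prop := ∀ p q, N p q ∈ 𝒜 (ε p + ε q + i)

/-- A kernel of parity `i`. -/
structure IsHomog (𝒜 : ZMod 2 → Submodule ℝ B) (ε : ι → ZMod 2) (i : ZMod 2)
    (A : Kernel T ι B) : Prop where
  loc : ∀ t, HasParity 𝒜 ε i (A.loc t)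
  reg : ∀ t t', HasParity 𝒜 ε i (A.reg t t')

variable {𝒜 : ZMod 2 → Submodule ℝ B} {ε : ι → ZMod 2}

theorem HasParity.add {i : ZMod 2} {N P : Matrix ι ι B} (hN : HasParity 𝒜 ε i N)
    (hP : HasParity 𝒜 ε i P) : HasParity 𝒜 ε i (N + P) :=
  fun p q => (𝒜 _).add_mem (hN p q) (hP p q)

/-- The supertrace of a matrix with indices `p`. -/
noncomputable def matStr (ε : ι → ZMod 2) (N : Matrix ι ι B) : B := ∑ p, sgn B (ε p) * N p p

theorem matStr_add (N P : Matrix ι ι B) : matStr ε (N + P) = matStr ε N + matStr ε P := by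
  simp [matStr, mul_add, Finset.sum_add_distrib]

theorem continuous_matStr : Continuous (matStr (B := B) ε) :=
  continuous_finsetSum _ fun p _ => continuous_const.mul (continuous_id.matrix_elem p p)

attribute [local instance] Matrix.linftyOpNormedRing Matrix.linftyOpNormedAlgebra
  completeSpace_matrix

theorem matStr_integral {f : T → Matrix ι ι B} (hf : Continuous f) :
    matStr ε (∫ t, f t) = ∫ t, matStr ε (f t) := by
  let L : Matrix ι ι B →L[ℝ] B :=
    ⟨{ toFun := matStr ε
       map_add' := matStr_add
       map_smul' := fun c N => by simp [matStr, Finset.smul_sum] }, continuous_matStr⟩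
  exact (L.integral_comp_comm (integrable_of_continuous hf)).symm

theorem str_eq (δ₀ : ℝ) (A : Kernel T ι B) :
    str ε δ₀ A = δ₀ • (∫ t, matStr ε (A.loc t)) + ∫ t, matStr ε (A.reg t t) := rfl

theorem IsCont.reg_diag {A : Kernel T ι B} (hA : A.IsCont) : Continuous fun t => A.reg t t :=
  hA.reg.comp (by fun_prop : Continuous fun t : T => (t, t))

theorem IsCont.str_add {A C : Kernel T ι B} (hA : A.IsCont) (hC : C.IsCont) (δ₀ : ℝ) :
    str ε δ₀ (A + C) = str ε δ₀ A + str ε δ₀ C := by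
  have hc := continuous_matStr (B := B) (ε := ε)
  simp_rw [str_eq, add_loc, add_reg, matStr_add]
  have h1 := integral_add (integrable_of_continuous (hc.comp hA.loc))
    (integrable_of_continuous (hc.comp hC.loc))
  have h2 := integral_add (integrable_of_continuous (hc.comp hA.reg_diag))
    (integrable_of_continuous (hc.comp hC.reg_diag))
  simp only [Function.comp_apply] at h1 h2
  rw [h1, h2, smul_add]
  abel

/-- The supertrace on the ring of continuous kernels. -/
noncomputable def strHom (ε : ι → ZMod 2) (δ₀ : ℝ) : ContKernel T ι B →+ B :=
  AddMonoidHom.mk' (fun A => str ε δ₀ A.1) fun A C => A.2.str_add C.2 δ₀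

variable [GradedAlgebra 𝒜]

theorem HasParity.mul {i j k : ZMod 2} {N P : Matrix ι ι B} (hN : HasParity 𝒜 ε i N)
    (hP : HasParity 𝒜 ε j P) (hk : k = i + j) : HasParity 𝒜 ε k (N * P) := by
  intro p q
  rw [Matrix.mul_apply]
  refine Submodule.sum_mem _ fun r _ => mul_mem_of_eq (hN p r) (hP r q) ?_
  rw [hk]
  clear hN hP hk
  generalize ε p = a; generalize ε q = b; generalize ε r = c; revert a b c i j; decide

theorem IsHomog.mul (h𝒜 : IsSupernumberAlgebra 𝒜) {i j k : ZMod 2} {A C : Kernel T ι B}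
    (hA : A.IsHomog 𝒜 ε i) (hC : C.IsHomog 𝒜 ε j) (hA' : A.IsCont) (hC' : C.IsCont)
    (hk : k = i + j) : (A * C).IsHomog 𝒜 ε k where
  loc t := (hA.loc t).mul (hC.loc t) hk
  reg t t' := by
    rw [hA'.mul_reg hC']
    refine (((hA.loc t).mul (hC.reg t t') hk).add ((hA.reg t t').mul (hC.loc t') hk)).add
      fun p q => ?_
    have hc := hA'.continuous_reg_mul hC' t t'
    rw [integral_matrix_apply hc]
    exact integral_mem_of_isClosed (h𝒜.isClosed _) (hc.matrix_elem p q)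
      fun r => ((hA.reg t r).mul (hC.reg r t') hk) p q

variable (T) in
/-- The ring of even continuous kernels. -/
def evenSubring (h𝒜 : IsSupernumberAlgebra 𝒜) (ε : ι → ZMod 2) : Subring (ContKernel T ι B) where
  carrier := {A | A.1.IsHomog 𝒜 ε 0}
  mul_mem' {A C} hA hC := hA.mul h𝒜 hC A.2 C.2 (by simp)
  one_mem' := by
    refine ⟨fun t p q => ?_, fun t t' p q => (𝒜 _).zero_mem⟩
    change (1 : Matrix ι ι B) p q ∈ _
    rw [Matrix.one_apply]
    split_ifs with h
    · subst h
      rw [show ε p + ε p + 0 = 0 by generalize ε p = a; revert a; decide]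
      exact SetLike.GradedOne.one_mem
    · exact (𝒜 _).zero_mem
  add_mem' {A C} hA hC := ⟨fun t => (hA.loc t).add (hC.loc t),
    fun t t' => (hA.reg t t').add (hC.reg t t')⟩
  zero_mem' := ⟨fun _ _ _ => (𝒜 _).zero_mem, fun _ _ _ _ => (𝒜 _).zero_mem⟩
  neg_mem' {A} hA := ⟨fun t p q => (𝒜 _).neg_mem (hA.loc t p q),
    fun t t' p q => (𝒜 _).neg_mem (hA.reg t t' p q)⟩

/-- For i = 0 this gives the cyclicity of the supertrace; for i = 1 it gives the antisymmetry used
for the two odd matrices X^a_{,q}. -/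
theorem matStr_mul_comm (h𝒜 : IsSupernumberAlgebra 𝒜) {i : ZMod 2} {N P : Matrix ι ι B}
    (hN : HasParity 𝒜 ε i N) (hP : HasParity 𝒜 ε i P) :
    matStr ε (N * P) = ksign i • matStr ε (P * N) := by
  simp_rw [matStr, Matrix.mul_apply, Finset.mul_sum, Finset.smul_sum]
  rw [Finset.sum_comm]
  refine Finset.sum_congr rfl fun p _ => Finset.sum_congr rfl fun q _ => ?_
  rw [h𝒜.supercomm (hN q p) (hP p q), sgn_mul, sgn_mul, smul_smul, smul_smul]
  congr 1
  clear hN hP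
  generalize ε p = a; generalize ε q = b; revert a b i; decide

/-- The supertrace of even kernels is cyclic. -/
theorem IsHomog.str_mul_comm (h𝒜 : IsSupernumberAlgebra 𝒜) {A C : Kernel T ι B}
    (hA : A.IsHomog 𝒜 ε 0) (hC : C.IsHomog 𝒜 ε 0) (hA' : A.IsCont) (hC' : C.IsCont) (δ₀ : ℝ) :
    str ε δ₀ (A * C) = str ε δ₀ (C * A) := by
  have h0 {N P : Matrix ι ι B} (hN : HasParity 𝒜 ε 0 N) (hP : HasParity 𝒜 ε 0 P) :
      matStr ε (N * P) = matStr ε (P * N) := by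
    rw [matStr_mul_comm h𝒜 hN hP, show ksign 0 = 1 by decide, one_smul]
  have hc := continuous_matStr (B := B) (ε := ε)
  have hreg {A C : Kernel T ι B} (hA' : A.IsCont) (hC' : C.IsCont) :
      ∫ t, matStr ε ((A * C).reg t t) = (∫ t, matStr ε (A.loc t * C.reg t t)) +
        (∫ t, matStr ε (A.reg t t * C.loc t)) +
        ∫ t, ∫ r, matStr ε (A.reg t r * C.reg r t) := by
    have h1 (t : T) : matStr ε ((A * C).reg t t) = matStr ε (A.loc t * C.reg t t) +
        matStr ε (A.reg t t * C.loc t) + ∫ r, matStr ε (A.reg t r * C.reg r t) := by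
      rw [hA'.mul_reg hC', matStr_add, matStr_add, matStr_integral (hA'.continuous_reg_mul hC' t t)]
    simp_rw [h1]
    refine integral_add_add (hc.comp (hA'.loc.mul hC'.reg_diag))
      (hc.comp (hA'.reg_diag.mul hC'.loc)) (continuous_integral ?_)
    exact hc.comp (hA'.reg.mul (hC'.reg.comp continuous_swap))
  -- The two time variables change roles, as required by the reversed order of the factors.
  have hsw : ∫ t, ∫ r, matStr ε (A.reg t r * C.reg r t) =
      ∫ t, ∫ r, matStr ε (A.reg r t * C.reg t r) :=
    integral_integral_swap_of_hasCompactSupport (f := fun t r => matStr ε (A.reg t r * C.reg r t))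
      (hc.comp (hA'.reg.mul (hC'.reg.comp continuous_swap)))
      (HasCompactSupport.of_compactSpace _)
  rw [str_eq, str_eq, hreg hA' hC', hreg hC' hA', hsw]
  simp_rw [mul_loc, fun t => h0 (hA.loc t) (hC.loc t), fun t => h0 (hA.loc t) (hC.reg t t),
    fun t => h0 (hA.reg t t) (hC.loc t), fun t r => h0 (hA.reg r t) (hC.reg t r)]
  abel

/-! ### Multiplication by odd supernumbers -/

/-- The kernel whose product with a kernel of definite parity is the multiplication by the odd
supernumber `x` from the left, with the sign `(-1)^{ε_p}`. -/
noncomputable def oddDiag (ε : ι → ZMod 2) (x : B) : ContKernel T ι B :=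
  ⟨((fun _ => Matrix.diagonal fun p => sgn B (ε p) * x), 0), continuous_const, continuous_const⟩

theorem oddDiag_mul (x : B) (A : ContKernel T ι B) :
    (oddDiag ε x * A).1 = scaleRows (fun p => sgn B (ε p) * x) A.1 := by
  refine Kernel.ext (fun t => ?_) fun t t' => ?_
  · exact Matrix.ext fun p q => Matrix.diagonal_mul _ _ _ _
  · rw [ContKernel.val_mul, (oddDiag ε x).2.mul_reg A.2]
    change Matrix.diagonal _ * A.1.reg t t' + 0 * A.1.loc t' + ∫ r, 0 * A.1.reg r t' = _
    simp only [zero_mul, integral_zero, add_zero]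
    exact Matrix.ext fun p q => Matrix.diagonal_mul _ _ _ _

theorem mul_oddDiag_loc (x : B) (A : ContKernel T ι B) (t : T) (p q : ι) :
    (A * oddDiag ε x).1.loc t p q = A.1.loc t p q * (sgn B (ε q) * x) :=
  Matrix.mul_diagonal _ _ _ _

theorem mul_oddDiag_reg (x : B) (A : ContKernel T ι B) (t t' : T) (p q : ι) :
    (A * oddDiag ε x).1.reg t t' p q = A.1.reg t t' p q * (sgn B (ε q) * x) := by
  rw [ContKernel.val_mul, A.2.mul_reg (oddDiag ε x).2]
  change (A.1.loc t * 0 + A.1.reg t t' * Matrix.diagonal _ + ∫ r, A.1.reg t r * 0 : Matrix ι ι B)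
    p q = _
  simp only [mul_zero, integral_zero, add_zero, zero_add]
  exact Matrix.mul_diagonal _ _ _ _

theorem mul_sgn_mul_comm (h𝒜 : IsSupernumberAlgebra 𝒜) {x y : B} (hx : x ∈ 𝒜 1) {p q : ι}
    (hy : y ∈ 𝒜 (ε p + ε q + 0)) : sgn B (ε p) * x * y = y * (sgn B (ε q) * x) := by
  rw [sgn_mul, sgn_mul, mul_smul_comm, smul_mul_assoc, h𝒜.supercomm hx hy, smul_smul]
  congr 1
  generalize ε p = a; generalize ε q = b; revert a b; decide

/-- Moving x across A^p_q costs (-1)^{ε_p + ε_q}, exactly the discrepancy between the row sign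
(-1)^{ε_p} and the column sign (-1)^{ε_q}. -/
theorem oddDiag_comm (h𝒜 : IsSupernumberAlgebra 𝒜) {x : B} (hx : x ∈ 𝒜 1)
    {A : ContKernel T ι B} (hA : A ∈ evenSubring T h𝒜 ε) :
    oddDiag ε x * A = A * oddDiag ε x := by
  refine ContKernel.ext (Kernel.ext (fun t => ?_) fun t t' => ?_) <;>
    rw [oddDiag_mul] <;> ext p q
  · rw [mul_oddDiag_loc]
    exact mul_sgn_mul_comm h𝒜 hx (hA.loc t p q)
  · rw [mul_oddDiag_reg]
    exact mul_sgn_mul_comm h𝒜 hx (hA.reg t t' p q)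

theorem oddDiag_anticomm (h𝒜 : IsSupernumberAlgebra 𝒜) {x y : B} (hx : x ∈ 𝒜 1) (hy : y ∈ 𝒜 1) :
    (oddDiag ε x * oddDiag ε y : ContKernel T ι B) = -(oddDiag ε y * oddDiag ε x) := by
  have h (x y : B) (t : T) : (oddDiag ε x * oddDiag ε y : ContKernel T ι B).1.loc t =
      Matrix.diagonal fun _ => x * y := by
    refine (Matrix.diagonal_mul_diagonal _ _).trans (congrArg _ (funext fun p => ?_))
    rw [sgn_mul, sgn_mul, mul_smul_comm, smul_mul_assoc, ksign_smul_smul]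
  have h' (x y : B) (t t' : T) : (oddDiag ε x * oddDiag ε y : ContKernel T ι B).1.reg t t' = 0 := by
    rw [oddDiag_mul]
    exact Matrix.ext fun p q => mul_zero _
  refine ContKernel.ext (Kernel.ext (fun t => ?_) fun t t' => ?_)
  · change _ = -(oddDiag ε y * oddDiag ε x : ContKernel T ι B).1.loc t
    rw [h, h, h𝒜.odd_anticomm x hx y hy, ← Matrix.diagonal_neg]
  · change _ = -(oddDiag ε y * oddDiag ε x : ContKernel T ι B).1.reg t t'
    rw [h', h', neg_zero]

end EvenKernels
end Kernel
end BAB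

namespace BAB

/-! ### Powers of sums under a cyclic trace -/

section CyclicTrace

open Finset

variable {R B : Type*} [Ring R] [AddCommGroup B] [Module ℝ B]

/-- Only words with at most one letter W survive. -/
theorem add_pow_succ_of_sq_zero {A W : R} (h : ∀ x, W * x * W = 0) (n : ℕ) :
    (A + W) ^ (n + 1) = A ^ (n + 1) + ∑ ij ∈ antidiagonal n, A ^ ij.1 * W * A ^ ij.2 := by
  induction n with
  | zero => simp
  | succ n ih =>
    rw [pow_succ, ih, Nat.sum_antidiagonal_succ', mul_add, add_mul, add_mul, ← pow_succ]
    have h1 : (∑ ij ∈ antidiagonal n, A ^ ij.1 * W * A ^ ij.2) * W = 0 := by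
      rw [sum_mul]
      exact sum_eq_zero fun ij _ => by rw [mul_assoc, mul_assoc, ← mul_assoc W, h, mul_zero]
    rw [h1, sum_mul, pow_zero, mul_one, add_zero]
    simp_rw [mul_assoc, ← pow_succ]
    abel

/-- A word ending in W dies as soon as it contains a V. -/
theorem add_pow_mul_of_mul_eq_zero {U V W : R} (h : ∀ x, V * x * W = 0) (n : ℕ) :
    (U + V) ^ n * W = U ^ n * W := by
  induction n with
  | zero => simp
  | succ n ih =>
    rw [pow_succ', mul_assoc, ih, add_mul, ← mul_assoc V, h, add_zero, ← mul_assoc, ← pow_succ']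

/-- Only words with at most two V's survive. Those with two are U^i V U^j V U^l, grouped by the
length l of the tail. -/
theorem add_pow_of_cube_zero {U V : R} (h : ∀ x y, V * x * V * y * V = 0) (n : ℕ) :
    (U + V) ^ (n + 2) = U ^ (n + 2) + (∑ ij ∈ antidiagonal (n + 1), U ^ ij.1 * V * U ^ ij.2) +
      ∑ kl ∈ antidiagonal n, (∑ ij ∈ antidiagonal kl.1, U ^ ij.1 * V * U ^ ij.2) * V *
        U ^ kl.2 := by
  induction n with
  | zero =>
    simp [pow_two, Nat.sum_antidiagonal_succ]
    noncomm_ring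
  | succ n ih =>
    rw [pow_succ, ih, Nat.sum_antidiagonal_succ' (n := n + 1), Nat.sum_antidiagonal_succ' (n := n)
      (f := fun kl => (∑ ij ∈ antidiagonal kl.1, U ^ ij.1 * V * U ^ ij.2) * V * U ^ kl.2),
      mul_add, add_mul, add_mul, add_mul, add_mul, ← pow_succ]
    have h1 : (∑ kl ∈ antidiagonal n, (∑ ij ∈ antidiagonal kl.1, U ^ ij.1 * V * U ^ ij.2) * V *
        U ^ kl.2) * V = 0 := by
      rw [sum_mul]
      refine sum_eq_zero fun kl _ => ?_
      rw [sum_mul, sum_mul, sum_mul]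
      refine sum_eq_zero fun ij _ => ?_
      calc _ = U ^ ij.1 * (V * U ^ ij.2 * V * U ^ kl.2 * V) := by noncomm_ring
        _ = 0 := by rw [h, mul_zero]
    rw [h1, pow_zero, mul_one, mul_one, add_zero, sum_mul, sum_mul _ _ U]
    simp_rw [mul_assoc, ← pow_succ]
    abel

/-- Both sides run over all triples with sum n; only the bracketing differs. -/
theorem sum_antidiagonal_antidiagonal (f : ℕ → ℕ → ℕ → B) (n : ℕ) :
    ∑ kl ∈ antidiagonal n, ∑ ij ∈ antidiagonal kl.1, f ij.1 ij.2 kl.2 =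
      ∑ ik ∈ antidiagonal n, ∑ jl ∈ antidiagonal ik.2, f ik.1 jl.1 jl.2 := by
  rw [sum_sigma', sum_sigma']
  refine sum_bij' (fun x _ => ⟨(x.2.1, x.2.2 + x.1.2), (x.2.2, x.1.2)⟩)
    (fun x _ => ⟨(x.1.1 + x.2.1, x.2.2), (x.1.1, x.2.1)⟩) ?_ ?_ ?_ ?_ ?_ <;>
  simp only [mem_sigma, HasAntidiagonal.mem_antidiagonal] <;> rintro ⟨⟨_, _⟩, _, _⟩ ⟨h₁, h₂⟩ <;>
  dsimp only at h₁ h₂ <;> subst h₁ h₂ <;> simp [add_assoc]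

theorem smul_two_cancel {x y : B} (h : (2 : ℝ) • x = (2 : ℝ) • y) : x = y :=
  smul_right_injective B (two_ne_zero (α := ℝ)) h

/-- The reflection i ↦ 2m - i fixes i = m, which gives the unpaired middle term; in the odd case
below there is no fixed point. -/
theorem sum_range_symm_even {f : ℕ → B} (m : ℕ) (hf : ∀ i ≤ 2 * m, f i = f (2 * m - i)) :
    ∑ i ∈ range (2 * m + 1), f i = 2 • ∑ i ∈ range m, f i + f m := by
  rw [show 2 * m + 1 = m + 1 + m by omega, sum_range_add, sum_range_succ, two_smul,
    ← sum_range_reflect f m]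
  rw [sum_congr rfl fun x hx => show f (m + 1 + x) = f (m - 1 - x) by
    have := mem_range.1 hx
    rw [hf _ (by omega)]; congr 1; omega]
  abel

theorem sum_range_symm_odd {f : ℕ → B} (m : ℕ) (hf : ∀ i ≤ 2 * m + 1, f i = f (2 * m + 1 - i)) :
    ∑ i ∈ range (2 * m + 2), f i = 2 • ∑ i ∈ range (m + 1), f i := by
  rw [show 2 * m + 2 = (m + 1) + (m + 1) by omega, sum_range_add, two_smul]
  congr 1
  rw [← sum_range_reflect f (m + 1)]
  refine sum_congr rfl fun x hx => ?_
  have := mem_range.1 hx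
  rw [hf _ (by omega)]; congr 1; omega

variable (τ : R →+ B) (hτ : ∀ x y, τ (x * y) = τ (y * x))

include hτ

theorem trace_pow_mul_mul_pow (U V : R) (i j : ℕ) :
    τ (U ^ i * V * U ^ j) = τ (U ^ (i + j) * V) := by
  rw [hτ, ← mul_assoc, ← pow_add, add_comm]

theorem trace_sum_antidiagonal (U V : R) (n : ℕ) :
    τ (∑ ij ∈ antidiagonal n, U ^ ij.1 * V * U ^ ij.2) = (n + 1) • τ (U ^ n * V) := by
  rw [map_sum, sum_congr rfl fun ij hij => by
    rw [trace_pow_mul_mul_pow τ hτ, mem_antidiagonal.1 hij]]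
  simp

/-- `Str (U + V + W)^n = Str (U + V)^n + n Str (U^{n-1} W)`. -/
theorem trace_add_add_pow {U V W : R} (hVW : ∀ x, V * x * W = 0) (hWW : ∀ x, W * x * W = 0)
    {n : ℕ} (hn : 1 ≤ n) :
    τ ((U + V + W) ^ n) = τ ((U + V) ^ n) + n • τ (U ^ (n - 1) * W) := by
  obtain ⟨n, rfl⟩ := Nat.exists_eq_add_of_le' hn
  rw [add_pow_succ_of_sq_zero hWW, map_add, trace_sum_antidiagonal τ hτ,
    add_pow_mul_of_mul_eq_zero hVW, Nat.add_sub_cancel]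

/-- By cyclicity U^i V U^j V U^l depends only on i + l and j, and each value of i + l occurs i + l +
1 times. Symmetry in the two gaps replaces the weight by its mean (n + 2)/2; doubling b avoids the
fraction. -/
theorem trace_add_pow_add_two {U V : R} (h : ∀ x y, V * x * V * y * V = 0) (n : ℕ) :
    ∃ b : B, τ ((U + V) ^ (n + 2)) = τ (U ^ (n + 2)) + (n + 2) • τ (U ^ (n + 1) * V) + b ∧
      (2 : ℝ) • b = (n + 2) • ∑ ij ∈ antidiagonal n, τ (U ^ ij.1 * V * (U ^ ij.2 * V)) := by
  refine ⟨_, by rw [add_pow_of_cube_zero h, map_add, map_add, trace_sum_antidiagonal τ hτ], ?_⟩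
  set a : ℕ → ℕ → B := fun i j => τ (U ^ i * V * (U ^ j * V)) with ha
  have hsymm (i j) : a i j = a j i := hτ _ _
  have h1 : τ (∑ kl ∈ antidiagonal n, (∑ ij ∈ antidiagonal kl.1, U ^ ij.1 * V * U ^ ij.2) * V *
      U ^ kl.2) = ∑ kl ∈ antidiagonal n, ∑ ij ∈ antidiagonal kl.1, a (ij.2 + kl.2) ij.1 := by
    rw [map_sum]
    refine sum_congr rfl fun kl _ => ?_
    rw [sum_mul, sum_mul, map_sum, ← Nat.sum_antidiagonal_swap]
    refine sum_congr rfl fun ij _ => ?_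
    simp only [Prod.fst_swap, Prod.snd_swap, ha]
    rw [hτ, ← mul_assoc, ← mul_assoc, ← mul_assoc, ← pow_add, mul_assoc _ (U ^ ij.1), add_comm]
  have h2 : ∑ kl ∈ antidiagonal n, ∑ ij ∈ antidiagonal kl.1, a (ij.2 + kl.2) ij.1 =
      ∑ jk ∈ antidiagonal n, (jk.2 + 1) • a jk.2 jk.1 := by
    rw [sum_antidiagonal_antidiagonal fun j i l => a (i + l) j]
    refine sum_congr rfl fun jk _ => ?_
    rw [sum_congr rfl fun il hil => by rw [mem_antidiagonal.1 hil]]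
    simp
  have h3 : ∑ jk ∈ antidiagonal n, (jk.2 + 1) • a jk.2 jk.1 =
      ∑ jk ∈ antidiagonal n, (jk.1 + 1) • a jk.2 jk.1 := by
    rw [← Nat.sum_antidiagonal_swap]
    exact sum_congr rfl fun jk _ => by rw [hsymm]; rfl
  rw [h1, h2, two_smul]
  nth_rewrite 1 [h3]
  -- The weights of a pair of gaps and of the swapped pair add up to n + 2.
  rw [← sum_add_distrib, smul_sum]
  refine sum_congr rfl fun jk hjk => ?_
  rw [← add_smul, hsymm]
  congr 1
  have := mem_antidiagonal.1 hjk
  omega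

/-- Here the gaps between the two V's sum to 2k - 2. Unequal gaps pair up and acquire the full
weight 2k, while equal gaps k - 1 occur once with weight k. The summation index is the smaller gap.
-/
theorem trace_add_pow_even {U V : R} (h : ∀ x y, V * x * V * y * V = 0) {k : ℕ} (hk : 1 ≤ k) :
    τ ((U + V) ^ (2 * k)) =
      ∑ i ∈ range 2, (2 * k).choose i • τ (U ^ (2 * k - i) * V ^ i) +
      (2 * k).choose 1 • ∑ i ∈ range (k - 1), τ (U ^ (2 * (k - i - 1)) * (U ^ i * V) ^ 2) +
      k.choose 1 • τ ((U ^ (k - 1) * V) ^ 2) := by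
  obtain ⟨m, rfl⟩ := Nat.exists_eq_add_of_le' hk
  obtain ⟨b, h1, h2⟩ := trace_add_pow_add_two τ hτ h (U := U) (2 * m)
  rw [Nat.sum_antidiagonal_eq_sum_range_succ_mk, ← sum_range_reflect, Nat.succ_eq_add_one,
    sum_range_symm_even m] at h2
  · rw [show 2 * (m + 1) = 2 * m + 2 by ring, h1]
    simp only [sum_range_succ, range_zero, sum_empty, zero_add, Nat.choose_zero_right, one_smul,
      Nat.sub_zero, pow_zero, mul_one, Nat.choose_one_right, pow_one, Nat.add_sub_cancel]
    rw [show 2 * m + 2 - 1 = 2 * m + 1 by omega, add_assoc _ (_ • _) (_ • _)]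
    congr 1
    refine smul_two_cancel (h2.trans ?_)
    have e1 : ∑ i ∈ range m,
        τ (U ^ (2 * m + 1 - 1 - i) * V * (U ^ (2 * m - (2 * m + 1 - 1 - i)) * V))
        = ∑ i ∈ range m, τ (U ^ (2 * (m + 1 - i - 1)) * (U ^ i * V) ^ 2) := by
      refine sum_congr rfl fun i hi => ?_
      have := mem_range.1 hi
      rw [pow_two (U ^ i * V), ← mul_assoc (U ^ (2 * _)), ← mul_assoc (U ^ (2 * _)), ← pow_add]
      congr 5 <;> omega
    rw [e1, show 2 * m + 1 - 1 - m = m by omega, show 2 * m - m = m by omega, ← pow_two]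
    module
  · intro i hi
    rw [hτ]
    congr 5 <;> omega

/-- The gaps now have the odd sum 2k - 1, so they are never equal and every pair carries the full
weight 2k + 1. -/
theorem trace_add_pow_odd {U V : R} (h : ∀ x y, V * x * V * y * V = 0) {k : ℕ} (hk : 1 ≤ k) :
    τ ((U + V) ^ (2 * k + 1)) =
      ∑ i ∈ range 2, (2 * k + 1).choose i • τ (U ^ (2 * k + 1 - i) * V ^ i) +
      (2 * k + 1).choose 1 • ∑ i ∈ range k, τ (U ^ (2 * (k - i) - 1) * (U ^ i * V) ^ 2) := by
  obtain ⟨m, rfl⟩ := Nat.exists_eq_add_of_le' hk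
  obtain ⟨b, h1, h2⟩ := trace_add_pow_add_two τ hτ h (U := U) (2 * m + 1)
  rw [Nat.sum_antidiagonal_eq_sum_range_succ_mk, ← sum_range_reflect, Nat.succ_eq_add_one,
    sum_range_symm_odd m] at h2
  · rw [show 2 * (m + 1) + 1 = 2 * m + 1 + 2 by ring, h1, sum_range_succ, sum_range_one]
    simp only [Nat.choose_zero_right, one_smul,
      Nat.sub_zero, pow_zero, mul_one, Nat.choose_one_right, pow_one]
    rw [show 2 * m + 1 + 2 - 1 = 2 * m + 1 + 1 by omega]
    congr 1
    refine smul_two_cancel (h2.trans ?_)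
    have e1 : ∑ i ∈ range (m + 1),
        τ (U ^ (2 * m + 1 + 1 - 1 - i) * V * (U ^ (2 * m + 1 - (2 * m + 1 + 1 - 1 - i)) * V))
        = ∑ i ∈ range (m + 1), τ (U ^ (2 * (m + 1 - i) - 1) * (U ^ i * V) ^ 2) := by
      refine sum_congr rfl fun i hi => ?_
      have := mem_range.1 hi
      rw [pow_two (U ^ i * V), ← mul_assoc (U ^ (2 * _ - 1)), ← mul_assoc (U ^ (2 * _ - 1)),
        ← pow_add]
      congr 5 <;> omega
    rw [e1]
    module
  · intro i hi
    rw [hτ]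
    congr 5 <;> omega

theorem trace_add_sq (U V : R) :
    τ ((U + V) ^ 2) = τ (U ^ 2) + 2 • τ (U * V) + τ (V ^ 2) := by
  rw [show (U + V) ^ 2 = U ^ 2 + U * V + V * U + V ^ 2 by noncomm_ring, map_add, map_add, map_add,
    hτ V U]
  abel

/-- Up to length three a cyclic word in U and V is determined by its number of V's, so the binomial
formula survives. At length four U²V² and UVUV already differ. -/
theorem trace_add_cube (U V : R) :
    τ ((U + V) ^ 3) = τ (U ^ 3) + 3 • τ (U ^ 2 * V) + 3 • τ (U * V ^ 2) + τ (V ^ 3) := by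
  rw [show (U + V) ^ 3 = U ^ 3 + U ^ 2 * V + U * (V * U) + V * U ^ 2 + U * V ^ 2 + (V * U) * V +
    V ^ 2 * U + V ^ 3 by noncomm_ring]
  simp only [map_add]
  rw [hτ U (V * U), hτ (V * U) V, hτ V (U ^ 2), hτ (V ^ 2) U, mul_assoc V U U, ← pow_two,
    hτ V (U ^ 2), ← mul_assoc, ← pow_two, hτ (V ^ 2) U]
  abel

end CyclicTrace

/-! ### Nilpotency of the expansion in the odd parameters -/

section OddParameters

variable {R : Type*} [Ring R] {E : Subring R} {L : Fin 2 → R}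
  (hcomm : ∀ a, ∀ x ∈ E, L a * x = x * L a) (hanti : ∀ a b, L a * L b = -(L b * L a))
  (hsq : ∀ a, L a * L a = 0)

include hanti hsq in
-- Among three indices with two values, two coincide, and anticommutation brings the equal factors
-- together.
theorem odd_mul_mul (a b c : Fin 2) : L a * L b * L c = 0 := by
  have key (a b) : L a * L b * L a = 0 := by
    rw [mul_assoc, hanti b a, mul_neg, ← mul_assoc, hsq, zero_mul, neg_zero]
  by_cases hab : a = b
  · rw [hab, hsq, zero_mul]
  by_cases hbc : b = c
  · rw [hbc, mul_assoc, hsq, mul_zero]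
  obtain rfl : a = c := by omega
  exact key a b

include hcomm in
/-- Products of even elements of order one in the odd parameters are of order two. -/
theorem mul_mul_eq_sum {V V' x : R} (hV : V ∈ E) (hx : x ∈ E) {v v' : Fin 2 → R}
    (hv : V = ∑ a, L a * v a) (hv' : V' = ∑ a, L a * v' a) :
    V * x * V' = ∑ b, ∑ a, L b * L a * (v a * x * v' b) := by
  rw [hv', Finset.mul_sum]
  refine Finset.sum_congr rfl fun b _ => ?_
  rw [← mul_assoc, ← hcomm b _ (E.mul_mem hV hx), hv]
  simp_rw [Finset.sum_mul, Finset.mul_sum, Finset.sum_mul, mul_assoc]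

include hcomm hanti hsq

/-- Each V contributes one L, and the L's commute with even elements, so three of them gather at the
left. -/
theorem mul_mul_mul_mul_eq_zero {V x y : R} (hV : V ∈ E) (hx : x ∈ E) (hy : y ∈ E)
    {v : Fin 2 → R} (hv : V = ∑ a, L a * v a) : V * x * V * y * V = 0 := by
  -- Only the rightmost V is expanded at first: the others must stay even elements so that L c can
  -- pass them.
  conv_lhs => rw [hv, Finset.mul_sum, ← hv]
  refine Finset.sum_eq_zero fun c _ => ?_
  rw [← mul_assoc, ← hcomm c _ (E.mul_mem (E.mul_mem (E.mul_mem hV hx) hV) hy),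
    mul_mul_eq_sum hcomm hV hx hv hv]
  simp_rw [Finset.sum_mul, Finset.mul_sum, Finset.sum_mul]
  refine Finset.sum_eq_zero fun b _ => Finset.sum_eq_zero fun a _ => ?_
  simp only [← mul_assoc, odd_mul_mul hanti hsq, zero_mul]

/-- V contributes one L and W two. Taking V := W as well covers the words with two W's. -/
theorem mul_mul_eq_zero {V W x : R} (hV : V ∈ E) (hx : x ∈ E) {v : Fin 2 → R}
    (hv : V = ∑ a, L a * v a) {a b : Fin 2} {w : R} (hw : W = L a * L b * w) :
    V * x * W = 0 := by
  rw [hw, ← mul_assoc, ← mul_assoc, ← hcomm a _ (E.mul_mem hV hx), mul_assoc (L a),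
    ← hcomm b _ (E.mul_mem hV hx), hv]
  simp_rw [Finset.sum_mul, Finset.mul_sum, Finset.sum_mul]
  refine Finset.sum_eq_zero fun c _ => ?_
  simp only [← mul_assoc, odd_mul_mul hanti hsq, zero_mul]

end OddParameters
end BAB

namespace BAB

/-! ### Uniqueness of functional derivatives -/

section TestFunctions

variable {t₀ t₁ : ℝ}

instance : IsFiniteMeasure (volume : Measure (Set.Icc t₀ t₁)) where
  measure_univ_lt_top := by
    change Measure.comap Subtype.val volume Set.univ < ⊤
    rw [comap_subtype_coe_apply measurableSet_Icc, Set.image_univ, Subtype.range_coe]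
    exact measure_Icc_lt_top

/-- A relatively open set at an endpoint still meets the open interval, because t₀ < t₁. -/
theorem isOpenPosMeasure_Icc (ht : t₀ < t₁) :
    (volume : Measure (Set.Icc t₀ t₁)).IsOpenPosMeasure where
  open_pos U hU hne := by
    change Measure.comap Subtype.val volume U ≠ 0
    rw [comap_subtype_coe_apply measurableSet_Icc]
    obtain ⟨V, hV, rfl⟩ := isOpen_induced_iff.1 hU
    obtain ⟨x, hx⟩ := hne
    have hcl : (x : ℝ) ∈ closure (Set.Ioo t₀ t₁) := by
      rw [closure_Ioo ht.ne]; exact x.2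
    have hne' := mem_closure_iff.1 hcl V hV hx
    have hpos := (hV.inter isOpen_Ioo).measure_pos volume hne'
    refine (hpos.trans_le (measure_mono ?_)).ne'
    rintro y ⟨hy, hy'⟩
    exact ⟨⟨y, hy'.1.le, hy'.2.le⟩, hy, rfl⟩

/-- Separates a δ-term at t from a continuous density: test functions vanishing at t see only k, and
once k = 0 the constant 1 sees b. -/
theorem eq_zero_of_integral_smul {E : Type*} [NormedAddCommGroup E] [NormedSpace ℝ E]
    [CompleteSpace E] (ht : t₀ < t₁) {k : Set.Icc t₀ t₁ → E} (hk : Continuous k)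
    (t : Set.Icc t₀ t₁) (b : E)
    (h : ∀ φ : C(Set.Icc t₀ t₁, ℝ), φ t • b + ∫ s, φ s • k s = 0) : b = 0 ∧ k = 0 := by
  have := isOpenPosMeasure_Icc ht
  have hk0 : k = 0 := by
    have hne (s) (hs : s ≠ t) : k s = 0 := by
      refine SeparatingDual.eq_zero_of_forall_dual_eq_zero (R := ℝ) fun f => ?_
      -- The factor (s - t)² removes the term with b, and the factor f (k s) makes the integrand
      -- after applying f the square of (s - t) f (k s).
      let φ : C(Set.Icc t₀ t₁, ℝ) := ⟨fun s => ((s : ℝ) - t) ^ 2 * f (k s), by fun_prop⟩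
      have h1 := congrArg f (h φ)
      have hφ : φ t = 0 := by simp [φ]
      rw [hφ, zero_smul, zero_add, map_zero, ← ContinuousLinearMap.integral_comp_comm _
        (Kernel.integrable_of_continuous (by fun_prop))] at h1
      have h2 : (fun s => f (φ s • k s)) =
          fun s : Set.Icc t₀ t₁ => (((s : ℝ) - t) * f (k s)) ^ 2 := by
        funext s; simp [φ]; ring
      have hc : Continuous fun s : Set.Icc t₀ t₁ => (((s : ℝ) - t) * f (k s)) ^ 2 := by fun_prop
      rw [h2, integral_eq_zero_iff_of_nonneg (fun s => sq_nonneg _)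
        (Kernel.integrable_of_continuous hc)] at h1
      have h3 := congrFun ((hc.ae_eq_iff_eq volume continuous_zero).1 h1) s
      have h4 : ((s : ℝ) - t) * f (k s) = 0 := by simpa using h3
      exact (mul_eq_zero.1 h4).resolve_left (sub_ne_zero.2 fun e => hs (Subtype.ext e))
    have : Fact (t₀ ≤ t₁) := ⟨ht.le⟩
    have : Nontrivial (Set.Icc t₀ t₁) := ⟨⟨t₀, by simp [ht.le]⟩, ⟨t₁, by simp [ht.le]⟩, by
      simpa using ht.ne⟩
    have : PreconnectedSpace (Set.Icc t₀ t₁) := Subtype.preconnectedSpace isPreconnected_Icc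
    -- The point t is not isolated in a nondegenerate interval, so continuity extends k = 0 to it.
    exact hk.ext_on (dense_compl_singleton t) continuous_zero fun s hs => hne s hs
  refine ⟨?_, hk0⟩
  simpa [hk0] using h 1

end TestFunctions

/-! ### Calculus and uniqueness of functional derivatives with a δ-part. -/

section FunctionalDerivatives

variable {B ι : Type*} [NormedRing B] [NormedAlgebra ℝ B] [CompleteSpace B] [Fintype ι]
  {𝒜 : ZMod 2 → Submodule ℝ B} {ε : ι → ZMod 2} {t₀ t₁ : ℝ}

/-- The functional `F` has the differential `D_q dΓ_t^q + ∫ dt' K_q(t') dΓ_{t'}^q`. -/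
def HasKernelDerivAt (t : Set.Icc t₀ t₁) (F : Trajectory 𝒜 ε t₀ t₁ → B) (D : ι → B)
    (K : Set.Icc t₀ t₁ → ι → B) (Γ : Trajectory 𝒜 ε t₀ t₁) : Prop :=
  Continuous K ∧ ∃ L : Trajectory 𝒜 ε t₀ t₁ →L[ℝ] B, HasFDerivAt F L Γ ∧
    ∀ h, L h = ∑ q, D q * (h t q : B) + ∫ t', ∑ q, K t' q * (h t' q : B)

/-- The variation `φ(t) θ` of `Γ_t^q`. -/
noncomputable def testVariation (φ : C(Set.Icc t₀ t₁, ℝ)) (q : ι) (θ : 𝒜 (ε q)) :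
    Trajectory 𝒜 ε t₀ t₁ :=
  ⟨fun t => φ t • tangent q θ, by fun_prop⟩

theorem kernel_testVariation (t : Set.Icc t₀ t₁) (D : ι → B) (K : Set.Icc t₀ t₁ → ι → B)
    (φ : C(Set.Icc t₀ t₁, ℝ)) (q : ι) (θ : 𝒜 (ε q)) :
    ∑ r, D r * (testVariation φ q θ t r : B) + ∫ t', ∑ r, K t' r * (testVariation φ q θ t' r : B) =
      φ t • (D q * θ) + ∫ t', φ t' • (K t' q * θ) := by
  have h (D : ι → B) (t : Set.Icc t₀ t₁) :
      ∑ r, D r * (testVariation φ q θ t r : B) = φ t • (D q * θ) := by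
    rw [← sum_mul_tangent D q θ, Finset.smul_sum]
    exact Finset.sum_congr rfl fun r _ => mul_smul_comm _ _ _
  simp_rw [h]

theorem continuous_sum_mul {K : Set.Icc t₀ t₁ → ι → B} (hK : Continuous K)
    (h : Trajectory 𝒜 ε t₀ t₁) : Continuous fun t => ∑ q, K t q * (h t q : B) := by
  have hh : Continuous h := h.continuous
  fun_prop

theorem HasFunDerivAt.hasKernelDerivAt {F : Trajectory 𝒜 ε t₀ t₁ → B}
    {k : Set.Icc t₀ t₁ → ι → B} {Γ : Trajectory 𝒜 ε t₀ t₁} (h : HasFunDerivAt F k Γ)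
    (t : Set.Icc t₀ t₁) : HasKernelDerivAt t F 0 k Γ := by
  obtain ⟨hk, L, hL, e⟩ := h
  exact ⟨hk, L, hL, fun v => by simp [e]⟩

theorem HasFunJacobianAt.hasKernelDerivAt {F : Trajectory 𝒜 ε t₀ t₁ → Set.Icc t₀ t₁ → ι → B}
    {M : Kernel (Set.Icc t₀ t₁) ι B} {Γ : Trajectory 𝒜 ε t₀ t₁} (h : HasFunJacobianAt F M Γ)
    (t : Set.Icc t₀ t₁) (p : ι) :
    HasKernelDerivAt t (fun Γ' => F Γ' t p) (M.loc t p) (fun t' => M.reg t t' p) Γ := by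
  obtain ⟨-, hr, h⟩ := h
  obtain ⟨L, hL, e⟩ := h t p
  refine ⟨?_, L, hL, e⟩
  exact continuous_pi fun q =>
    (hr.comp (by fun_prop : Continuous fun t' => (t, t'))).matrix_elem p q

theorem HasKernelDerivAt.fun_sum {κ : Type*} {s : Finset κ} {t : Set.Icc t₀ t₁}
    {F : κ → Trajectory 𝒜 ε t₀ t₁ → B} {D : κ → ι → B} {K : κ → Set.Icc t₀ t₁ → ι → B}
    {Γ : Trajectory 𝒜 ε t₀ t₁} (h : ∀ i ∈ s, HasKernelDerivAt t (F i) (D i) (K i) Γ) :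
    HasKernelDerivAt t (fun Γ' => ∑ i ∈ s, F i Γ') (fun q => ∑ i ∈ s, D i q)
      (fun t' q => ∑ i ∈ s, K i t' q) Γ := by
  choose! hK L hL e using h
  refine ⟨continuous_pi fun q => continuous_finsetSum _ fun i hi =>
    (continuous_apply q).comp (hK i hi), ∑ i ∈ s, L i, HasFDerivAt.fun_sum (𝕜 := ℝ)
      (E := Trajectory 𝒜 ε t₀ t₁) (F := B) hL, fun v => ?_⟩
  rw [sum_apply, Finset.sum_congr rfl fun i hi => e i hi v, Finset.sum_add_distrib,
    ← integral_finsetSum _ fun i hi =>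
      Kernel.integrable_of_continuous (continuous_sum_mul (hK i hi) v)]
  simp_rw [Finset.sum_mul]
  congr 1
  · rw [Finset.sum_comm]
  · congr 1
    funext t'
    rw [Finset.sum_comm]

theorem HasKernelDerivAt.sub {t : Set.Icc t₀ t₁}
    {F G : Trajectory 𝒜 ε t₀ t₁ → B} {D D' : ι → B} {K K' : Set.Icc t₀ t₁ → ι → B}
    {Γ : Trajectory 𝒜 ε t₀ t₁} (h : HasKernelDerivAt t F D K Γ)
    (h' : HasKernelDerivAt t G D' K' Γ) :
    HasKernelDerivAt t (fun Γ' => F Γ' - G Γ') (fun q => D q - D' q)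
      (fun t' q => K t' q - K' t' q) Γ := by
  obtain ⟨hK, L, hL, e⟩ := h
  obtain ⟨hK', L', hL', e'⟩ := h'
  refine ⟨hK.sub hK', L - L', HasFDerivAt.fun_sub (𝕜 := ℝ)
      (E := Trajectory 𝒜 ε t₀ t₁) (F := B) hL hL', fun v => ?_⟩
  rw [sub_apply, e, e']
  simp_rw [sub_mul, Finset.sum_sub_distrib]
  rw [integral_sub (Kernel.integrable_of_continuous (continuous_sum_mul hK v))
      (Kernel.integrable_of_continuous (continuous_sum_mul hK' v))]
  abel

theorem HasKernelDerivAt.mul (h𝒜 : IsSupernumberAlgebra 𝒜) {t : Set.Icc t₀ t₁}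
    {F G : Trajectory 𝒜 ε t₀ t₁ → B} {D D' : ι → B} {K K' : Set.Icc t₀ t₁ → ι → B}
    {Γ : Trajectory 𝒜 ε t₀ t₁} {j : ZMod 2} (h : HasKernelDerivAt t F D K Γ)
    (h' : HasKernelDerivAt t G D' K' Γ) (hj : G Γ ∈ 𝒜 j) :
    HasKernelDerivAt t (fun Γ' => F Γ' * G Γ')
      (fun q => F Γ * D' q + ksign (ε q * j) • (D q * G Γ))
      (fun t' q => F Γ * K' t' q + ksign (ε q * j) • (K t' q * G Γ)) Γ := by
  obtain ⟨hK, L, hL, e⟩ := h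
  obtain ⟨hK', L', hL', e'⟩ := h'
  refine ⟨by fun_prop, F Γ • L' + MulOpposite.op (G Γ) • L, HasFDerivAt.mul' (𝕜 := ℝ)
      (E := Trajectory 𝒜 ε t₀ t₁) (𝔸 := B) hL hL', fun v => ?_⟩
  have key (D D' : ι → B) (t : Set.Icc t₀ t₁) :
      ∑ q, (F Γ * D' q + ksign (ε q * j) • (D q * G Γ)) * (v t q : B) =
        F Γ * (∑ q, D' q * (v t q : B)) + (∑ q, D q * (v t q : B)) * G Γ := by
    rw [Finset.mul_sum, Finset.sum_mul, ← Finset.sum_add_distrib]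
    refine Finset.sum_congr rfl fun q _ => ?_
    rw [add_mul, smul_mul_assoc, mul_assoc, mul_assoc, mul_assoc, h𝒜.supercomm (v t q).2 hj,
      mul_smul_comm]
  simp_rw [key]
  have c := continuous_sum_mul hK v
  have c' := continuous_sum_mul hK' v
  have d : Continuous fun t' => (∑ q, K t' q * (v t' q : B)) * G Γ := c.mul continuous_const
  have d' : Continuous fun t' => F Γ * ∑ q, K' t' q * (v t' q : B) := continuous_const.mul c'
  rw [integral_add (Kernel.integrable_of_continuous d') (Kernel.integrable_of_continuous d),
    integral_const_mul_of_integrable (Kernel.integrable_of_continuous c'),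
    integral_mul_const_of_integrable (Kernel.integrable_of_continuous c)]
  simp only [add_apply, smul_apply, smul_eq_mul, MulOpposite.smul_eq_mul_unop,
    MulOpposite.unop_op, e, e', mul_add, add_mul]
  abel

theorem HasRightGradAt.hasKernelDerivAt {f : PhaseSpace 𝒜 ε → B} {g : ι → B}
    {t : Set.Icc t₀ t₁} {Γ : Trajectory 𝒜 ε t₀ t₁} (h : HasRightGradAt f g (Γ t)) :
    HasKernelDerivAt t (fun Γ' => f (Γ' t)) g 0 Γ := by
  obtain ⟨L, hL, e⟩ := h
  refine ⟨continuous_const, L.comp (ContinuousMap.evalCLM ℝ t), ?_, fun v => ?_⟩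
  · exact HasFDerivAt.comp (𝕜 := ℝ) (E := Trajectory 𝒜 ε t₀ t₁) (F := PhaseSpace 𝒜 ε) (G := B)
      Γ hL (ContinuousLinearMap.hasFDerivAt (𝕜 := ℝ) (E := Trajectory 𝒜 ε t₀ t₁)
        (F := PhaseSpace 𝒜 ε) (ContinuousMap.evalCLM ℝ t))
  · simp [e]

variable [GradedAlgebra 𝒜]

/-- Variations φ(t) θ of one coordinate reduce the claim to `eq_zero_of_integral_smul`, after which
θ is cancelled. -/
theorem HasKernelDerivAt.unique (h𝒜 : IsSupernumberAlgebra 𝒜) (ht : t₀ < t₁)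
    {t : Set.Icc t₀ t₁} {F : Trajectory 𝒜 ε t₀ t₁ → B} {D D' : ι → B}
    {K K' : Set.Icc t₀ t₁ → ι → B} {Γ : Trajectory 𝒜 ε t₀ t₁} (h : HasKernelDerivAt t F D K Γ)
    (h' : HasKernelDerivAt t F D' K' Γ) : D = D' ∧ K = K' := by
  obtain ⟨hK, L, hL, e⟩ := h
  obtain ⟨hK', L', hL', e'⟩ := h'
  obtain rfl := hL.unique hL'
  have key (q : ι) (θ : 𝒜 (ε q)) : (D q - D' q) * θ = 0 ∧
      (fun t' => (K t' q - K' t' q) * (θ : B)) = 0 := by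
    refine eq_zero_of_integral_smul ht (by fun_prop) t _ fun φ => ?_
    have h1 := (e (testVariation φ q θ)).symm.trans (e' _)
    rw [kernel_testVariation, kernel_testVariation, ← sub_eq_zero] at h1
    simp_rw [sub_mul, smul_sub]
    rw [integral_sub (Kernel.integrable_of_continuous (by fun_prop))
      (Kernel.integrable_of_continuous (by fun_prop)), ← h1]
    abel
  constructor
  · funext q
    exact sub_eq_zero.1 (h𝒜.eq_zero_of_mul (ε q) fun θ hθ => (key q ⟨θ, hθ⟩).1)
  · funext t' q
    exact sub_eq_zero.1 (h𝒜.eq_zero_of_mul (ε q) fun θ hθ => congrFun (key q ⟨θ, hθ⟩).2 t')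

/-- The differential of F takes values in the closed subspace 𝒜 i, so modulo 𝒜 i the function k θ
integrates to zero against every test function. -/
theorem HasFunDerivAt.mem (h𝒜 : IsSupernumberAlgebra 𝒜) (ht : t₀ < t₁)
    {F : Trajectory 𝒜 ε t₀ t₁ → B} {k : Set.Icc t₀ t₁ → ι → B} {Γ : Trajectory 𝒜 ε t₀ t₁}
    {i : ZMod 2} (h : HasFunDerivAt F k Γ) (hF : ∀ Γ, F Γ ∈ 𝒜 i) (t : Set.Icc t₀ t₁) (q : ι) :
    k t q ∈ 𝒜 (i + ε q) := by
  obtain ⟨hk, L, hL, e⟩ := h.hasKernelDerivAt t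
  refine h𝒜.mem_of_mul_mem fun θ hθ => ?_
  have hcl : IsClosed (𝒜 i : Set B) := h𝒜.isClosed i
  rw [← Submodule.Quotient.mk_eq_zero]
  have hmk : Continuous fun t => (𝒜 i).mkQL (k t q * θ) := by fun_prop
  refine congrFun (eq_zero_of_integral_smul ht hmk t 0 fun φ => ?_).2 t
  have h1 := fderiv_mem hcl hF hL (testVariation φ q ⟨θ, hθ⟩)
  rw [e, kernel_testVariation, ← Submodule.Quotient.mk_eq_zero] at h1
  simp only [Pi.zero_apply, zero_mul, smul_zero, zero_add] at h1 ⊢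
  rw [← h1]
  simp_rw [← map_smul]
  exact (𝒜 i).mkQL.integral_comp_comm (Kernel.integrable_of_continuous (by fun_prop))

theorem HasFunDerivAt.funDeriv_eq (h𝒜 : IsSupernumberAlgebra 𝒜) (ht : t₀ < t₁)
    {F : Trajectory 𝒜 ε t₀ t₁ → B} {k : Set.Icc t₀ t₁ → ι → B} {Γ : Trajectory 𝒜 ε t₀ t₁}
    (h : HasFunDerivAt F k Γ) : funDeriv F Γ = k := by
  have hex : ∃ k, HasFunDerivAt F k Γ := ⟨k, h⟩
  rw [funDeriv, dif_pos hex]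
  let t : Set.Icc t₀ t₁ := ⟨t₀, by simp [ht.le]⟩
  exact ((hex.choose_spec.hasKernelDerivAt t).unique h𝒜 ht (h.hasKernelDerivAt t)).2

theorem HasFunJacobianAt.funJacobian_eq (h𝒜 : IsSupernumberAlgebra 𝒜) (ht : t₀ < t₁)
    {F : Trajectory 𝒜 ε t₀ t₁ → Set.Icc t₀ t₁ → ι → B} {M : Kernel (Set.Icc t₀ t₁) ι B}
    {Γ : Trajectory 𝒜 ε t₀ t₁} (h : HasFunJacobianAt F M Γ) : funJacobian F Γ = M := by
  have hex : ∃ M, HasFunJacobianAt F M Γ := ⟨M, h⟩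
  rw [funJacobian, dif_pos hex]
  have key (t p) := (hex.choose_spec.hasKernelDerivAt t p).unique h𝒜 ht (h.hasKernelDerivAt t p)
  refine Kernel.ext (fun t => ?_) fun t t' => ?_
  · exact Matrix.ext fun p q => congrFun (key t p).1 q
  · exact Matrix.ext fun p q => congrFun (congrFun (key t p).2 t') q

theorem hasFunJacobianAt_of_isSuperC {f : ι → PhaseSpace 𝒜 ε → B} (hf : ∀ p, IsSuperC 1 (f p))
    (Γ : Trajectory 𝒜 ε t₀ t₁) :
    HasFunJacobianAt (fun Γ' t p => f p (Γ' t))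
      ((fun t => Matrix.of fun p q => rderiv (f p) q (Γ t), 0) : Kernel (Set.Icc t₀ t₁) ι B) Γ := by
  refine ⟨?_, continuous_const, fun t p => ?_⟩
  · exact continuous_matrix fun p q => ((hf p).rderiv q).continuous.comp Γ.continuous
  · exact (((hf p).hasRightGradAt (Γ t)).hasKernelDerivAt (t := t)).2

end FunctionalDerivatives
end BAB

namespace BAB
namespace Kernel

/-! ### Kernels of finite rank -/

section FiniteRank

variable {T ι B : Type*} [NormedRing B] [NormedAlgebra ℝ B]

/-- The kernel `x^p(t') y_q(t'')`. -/
def outer (x y : T → ι → B) : Kernel T ι B :=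
  ofReg fun t t' => Matrix.of fun p q => x t p * y t' q

theorem outer_loc (x y : T → ι → B) (t : T) : (outer x y).loc t = 0 := rfl

theorem outer_reg (x y : T → ι → B) (t t' : T) (p q : ι) :
    (outer x y).reg t t' p q = x t p * y t' q := rfl

theorem smul_loc (c : B) (A : Kernel T ι B) (t : T) (p q : ι) :
    (c • A).loc t p q = c * A.loc t p q := rfl

theorem smul_reg (c : B) (A : Kernel T ι B) (t t' : T) (p q : ι) :
    (c • A).reg t t' p q = c * A.reg t t' p q := rfl

theorem smul_outer {c : B} (hc : ∀ x, c * x = x * c) (x y : T → ι → B) :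
    c • outer x y = outer x fun t q => c * y t q := by
  refine ext (fun t => Matrix.ext fun p q => mul_zero c) fun t t' => Matrix.ext fun p q => ?_
  rw [smul_reg, outer_reg, outer_reg, ← mul_assoc, hc, mul_assoc]

variable [TopologicalSpace T] [CompactSpace T] [T2Space T] [SecondCountableTopology T]
  [MeasureSpace T] [BorelSpace T] [IsFiniteMeasure (volume : Measure T)]
  [CompleteSpace B] [Fintype ι] [DecidableEq ι]

theorem isCont_outer {x y : T → ι → B} (hx : Continuous x) (hy : Continuous y) :
    (outer x y).IsCont := by
  refine ⟨continuous_const, continuous_matrix fun p q => ?_⟩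
  simp only [outer_reg]
  fun_prop

theorem IsCont.smul {A : Kernel T ι B} (hA : A.IsCont) (c : B) : (c • A).IsCont := by
  refine ⟨continuous_matrix fun p q => ?_, continuous_matrix fun p q => ?_⟩
  · exact continuous_const.mul (hA.loc.matrix_elem p q)
  · exact continuous_const.mul (hA.reg.matrix_elem p q)

theorem IsCont.sum {κ : Type*} {s : Finset κ} {A : κ → Kernel T ι B}
    (h : ∀ k ∈ s, (A k).IsCont) : (∑ k ∈ s, A k).IsCont :=
  Finset.sum_induction A IsCont (fun _ _ => IsCont.add) isCont_zero h

/-- The pairing `∫ dt y_q(t) x^q(t)`. -/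
noncomputable def pairing (y x : T → ι → B) : B := ∫ t, ∑ q, y t q * x t q

/-- The intermediate integral collapses to one supernumber, the pairing of the inner factors, so
products of rank-one kernels keep rank one. -/
theorem outer_mul_outer {x y x' y' : T → ι → B} (hy : Continuous y)
    (hx' : Continuous x') :
    outer x y * outer x' y' = outer x fun t q => pairing y x' * y' t q := by
  refine ext (fun t => Matrix.zero_mul _) fun t t' => Matrix.ext fun p q => ?_
  change (0 * (outer x' y').reg t t' + (outer x y).reg t t' * 0 +
    Matrix.of fun p q => ∫ r, ((outer x y).reg t r * (outer x' y').reg r t') p q :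
      Matrix ι ι B) p q = _
  rw [Matrix.zero_mul, Matrix.mul_zero, zero_add, zero_add, Matrix.of_apply, outer_reg]
  have hc : Continuous fun r => ∑ s, y r s * x' r s := by fun_prop
  have h1 (r : T) : ((outer x y).reg t r * (outer x' y').reg r t') p q =
      x t p * ((∑ s, y r s * x' r s) * y' t' q) := by
    rw [Matrix.mul_apply, Finset.sum_mul, Finset.mul_sum]
    simp_rw [outer_reg, mul_assoc]
  simp_rw [h1]
  have hd : Continuous fun r => (∑ s, y r s * x' r s) * y' t' q := hc.mul continuous_const
  rw [integral_const_mul_of_integrable (integrable_of_continuous hd),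
    integral_mul_const_of_integrable (integrable_of_continuous hc)]
  rfl

/-- The kernel `D^p_q(t') δ(t' - t'')`. -/
def ofLoc (D : T → Matrix ι ι B) : Kernel T ι B := (D, 0)

theorem ofLoc_mul_outer (D : T → Matrix ι ι B) (x y : T → ι → B) :
    ofLoc D * outer x y = outer (fun t => (D t).mulVec (x t)) y := by
  refine ext (fun t => Matrix.mul_zero _) fun t t' => Matrix.ext fun p q => ?_
  change (D t * (outer x y).reg t t' + 0 * 0 +
    Matrix.of fun p q => ∫ r, (0 * (outer x y).reg r t' : Matrix ι ι B) p q : Matrix ι ι B) p q = _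
  simp only [Matrix.zero_apply, integral_zero, add_zero, Matrix.add_apply,
    Matrix.of_apply, Matrix.mul_apply, outer_reg, Matrix.mulVec, dotProduct, Finset.sum_mul,
    mul_assoc, zero_mul, Finset.sum_const_zero]

theorem str_outer (ε : ι → ZMod 2) (δ₀ : ℝ) (x y : T → ι → B) :
    str ε δ₀ (outer x y) = ∫ t, ∑ p, sgn B (ε p) * (x t p * y t p) := by
  simp [str, outer_loc, outer_reg]

theorem str_smul {ε : ι → ZMod 2} {δ₀ : ℝ} {c : B} {A : Kernel T ι B}
    (hA : A.IsCont) : str ε δ₀ (c • A) = c * str ε δ₀ A := by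
  have h (N : Matrix ι ι B) : ∑ p, sgn B (ε p) * (c * N p p) = c * matStr ε N := by
    rw [matStr, Finset.mul_sum]
    exact Finset.sum_congr rfl fun p _ => by rw [sgn_mul, sgn_mul, mul_smul_comm]
  simp_rw [str, smul_loc, smul_reg, h]
  have hc := continuous_matStr (B := B) (ε := ε)
  have c1 : Continuous fun t => matStr ε (A.loc t) := hc.comp hA.loc
  have c2 : Continuous fun t => matStr ε (A.reg t t) := hc.comp hA.reg_diag
  rw [integral_const_mul_of_integrable (integrable_of_continuous c1),
    integral_const_mul_of_integrable (integrable_of_continuous c2),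
    ← mul_smul_comm, ← mul_add]
  rfl

theorem IsCont.smul_mul {A C : Kernel T ι B} (hA : A.IsCont) (hC : C.IsCont) (c : B) :
    (c • A) * C = c • (A * C) := by
  have hs (N P : Matrix ι ι B) (p q : ι) :
      (Matrix.of (fun p q => c * N p q) * P) p q = c * (N * P) p q := by
    simp [Matrix.mul_apply, Finset.mul_sum, _root_.mul_assoc]
  refine ext (fun t => Matrix.ext fun p q => hs _ _ _ _) fun t t' => Matrix.ext fun p q => ?_
  rw [smul_reg]
  change (Matrix.of (fun p q => c * A.loc t p q) * C.reg t t') p q +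
    (Matrix.of (fun p q => c * A.reg t t' p q) * C.loc t') p q +
    ∫ r, (Matrix.of (fun p q => c * A.reg t r p q) * C.reg r t') p q =
    c * ((A.loc t * C.reg t t') p q + (A.reg t t' * C.loc t') p q +
      ∫ r, (A.reg t r * C.reg r t') p q)
  simp_rw [hs]
  rw [integral_const_mul_of_integrable (integrable_of_continuous
    ((hA.continuous_reg_mul hC t t').matrix_elem p q)), _root_.mul_add, _root_.mul_add]

/-- A scalar acts from the left, so it leaves the second factor only if it is central; even
supernumbers are. -/
theorem IsCont.mul_smul {A C : Kernel T ι B} (hA : A.IsCont) (hC : C.IsCont) {c : B}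
    (hc : ∀ x, c * x = x * c) : A * (c • C) = c • (A * C) := by
  have hs (N P : Matrix ι ι B) (p q : ι) :
      (N * Matrix.of (fun p q => c * P p q)) p q = c * (N * P) p q := by
    simp only [Matrix.mul_apply, Finset.mul_sum, Matrix.of_apply]
    exact Finset.sum_congr rfl fun r _ => by
      rw [← _root_.mul_assoc, ← hc, _root_.mul_assoc]
  refine ext (fun t => Matrix.ext fun p q => hs _ _ _ _) fun t t' => Matrix.ext fun p q => ?_
  rw [smul_reg]
  change (A.loc t * Matrix.of (fun p q => c * C.reg t t' p q)) p q +
    (A.reg t t' * Matrix.of (fun p q => c * C.loc t' p q)) p q +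
    ∫ r, (A.reg t r * Matrix.of (fun p q => c * C.reg r t' p q)) p q =
    c * ((A.loc t * C.reg t t') p q + (A.reg t t' * C.loc t') p q +
      ∫ r, (A.reg t r * C.reg r t') p q)
  simp_rw [hs]
  rw [integral_const_mul_of_integrable (integrable_of_continuous
    ((hA.continuous_reg_mul hC t t').matrix_elem p q)), _root_.mul_add, _root_.mul_add]

theorem IsCont.sum_mul {κ : Type*} {s : Finset κ} {A : κ → Kernel T ι B} {C : Kernel T ι B}
    (hA : ∀ k ∈ s, (A k).IsCont) (hC : C.IsCont) : (∑ k ∈ s, A k) * C = ∑ k ∈ s, A k * C := by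
  classical
  induction s using Finset.induction_on with
  | empty =>
    rw [Finset.sum_empty, Finset.sum_empty]
    exact congrArg Subtype.val (MulZeroClass.zero_mul (M₀ := ContKernel T ι B)
      (⟨C, hC⟩ : ContKernel T ι B))
  | insert k s hk ih =>
    have h1 := hA k (Finset.mem_insert_self k s)
    have h2 := fun j hj => hA j (Finset.mem_insert_of_mem (a := j) hj)
    rw [Finset.sum_insert hk, Finset.sum_insert hk, h1.add_mul (IsCont.sum h2) hC, ih h2]

theorem IsCont.mul_sum {κ : Type*} {s : Finset κ} {A : Kernel T ι B} {C : κ → Kernel T ι B}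
    (hA : A.IsCont) (hC : ∀ k ∈ s, (C k).IsCont) : A * ∑ k ∈ s, C k = ∑ k ∈ s, A * C k := by
  classical
  induction s using Finset.induction_on with
  | empty =>
    rw [Finset.sum_empty, Finset.sum_empty]
    exact congrArg Subtype.val (MulZeroClass.mul_zero (M₀ := ContKernel T ι B)
      (⟨A, hA⟩ : ContKernel T ι B))
  | insert k s hk ih =>
    have h1 := hC k (Finset.mem_insert_self k s)
    have h2 := fun j hj => hC j (Finset.mem_insert_of_mem (a := j) hj)
    rw [Finset.sum_insert hk, Finset.sum_insert hk, hA.mul_add h1 (IsCont.sum h2), ih h2]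

theorem str_sum {κ : Type*} {s : Finset κ} {A : κ → Kernel T ι B} (ε : ι → ZMod 2) (δ₀ : ℝ)
    (hA : ∀ k ∈ s, (A k).IsCont) : str ε δ₀ (∑ k ∈ s, A k) = ∑ k ∈ s, str ε δ₀ (A k) := by
  classical
  induction s using Finset.induction_on with
  | empty => exact map_zero (strHom (T := T) (B := B) ε δ₀)
  | insert k s hk ih =>
    have h1 := hA k (Finset.mem_insert_self k s)
    have h2 := fun j hj => hA j (Finset.mem_insert_of_mem (a := j) hj)
    rw [Finset.sum_insert hk, Finset.sum_insert hk, h1.str_add (IsCont.sum h2), ih h2]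

end FiniteRank
end Kernel
end BAB

namespace BAB
namespace ConstrainedSystem

/-! ### The matrices `U`, `V₁`, `V₂`, `W` -/

open Kernel

variable {B ι : Type*} [NormedRing B] [NormedAlgebra ℝ B] [CompleteSpace B] [Fintype ι]
  [DecidableEq ι] {𝒜 : ZMod 2 → Submodule ℝ B} [GradedAlgebra 𝒜] {ε : ι → ZMod 2} {t₀ t₁ : ℝ}

theorem raise_zero (x : Fin 2 → B) : raise x 0 = x 1 := by simp [raise, epsUp]

theorem raise_one (x : Fin 2 → B) : raise x 1 = -x 0 := by simp [raise, epsUp]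

theorem sq_eq (h𝒜 : IsSupernumberAlgebra 𝒜) {x : Fin 2 → B} (hx : ∀ a, x a ∈ 𝒜 1) :
    sq x = (2 : ℝ) • (x 0 * x 1) := by
  rw [sq, Fin.sum_univ_two, raise_zero, raise_one, mul_neg, h𝒜.odd_anticomm _ (hx 1) _ (hx 0),
    neg_neg, two_smul]

theorem sgn_add_one_mul (i : ZMod 2) (x : B) : sgn B (i + 1) * x = -(ksign i • x) := by
  rw [sgn_mul, ksign_add, show ksign 1 = -1 by decide]; simp

variable (S : ConstrainedSystem 𝒜 ε) (Γ : Trajectory 𝒜 ε t₀ t₁)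

/-- The matrix `X^{pa}_{,q}` at `Γ_t`. -/
noncomputable def dX (a : Fin 2) (t : Set.Icc t₀ t₁) : Matrix ι ι B :=
  Matrix.of fun p q => rderiv (S.X p a) q (Γ t)

/-- The matrix `Y^p_{,q}` at `Γ_t`. -/
noncomputable def dY (t : Set.Icc t₀ t₁) : Matrix ι ι B :=
  Matrix.of fun p q => rderiv (S.Y p) q (Γ t)

variable (h𝒜 : IsSupernumberAlgebra 𝒜)

include h𝒜

theorem continuous_Xt (a : Fin 2) : Continuous (S.Xt a Γ) :=
  continuous_pi fun p => (S.X_isSuperC h𝒜 p a).continuous.comp Γ.continuous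

theorem continuous_Yt : Continuous (S.Yt Γ) :=
  continuous_pi fun p => (S.Y_isSuperC h𝒜 p).continuous.comp Γ.continuous

theorem continuous_dX (a : Fin 2) : Continuous (S.dX Γ a) :=
  continuous_matrix fun p q => ((S.X_isSuperC h𝒜 p a).rderiv q).continuous.comp Γ.continuous

theorem continuous_dY : Continuous (S.dY Γ) :=
  continuous_matrix fun p q => ((S.Y_isSuperC h𝒜 p).rderiv q).continuous.comp Γ.continuous

theorem dX_hasParity (a : Fin 2) (t : Set.Icc t₀ t₁) : HasParity 𝒜 ε 1 (S.dX Γ a t) := by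
  intro p q
  rw [show ε p + ε q + 1 = ε p + 1 + ε q by ring]
  exact S.rderiv_X_mem h𝒜 p a q (Γ t)

theorem dY_hasParity (t : Set.Icc t₀ t₁) : HasParity 𝒜 ε 0 (S.dY Γ t) := by
  intro p q
  rw [add_zero]
  exact S.rderiv_Y_mem h𝒜 p q (Γ t)

variable (ht : t₀ < t₁)

include ht

theorem funJacobian_Xt (a : Fin 2) : funJacobian (S.Xt a) Γ = ofLoc (S.dX Γ a) :=
  (hasFunJacobianAt_of_isSuperC (fun p => (S.X_isSuperC h𝒜 p a).of_succ) Γ).funJacobian_eq h𝒜 ht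

theorem funJacobian_Yt : funJacobian S.Yt Γ = ofLoc (S.dY Γ) :=
  (hasFunJacobianAt_of_isSuperC (fun p => S.Y_isSuperC h𝒜 p) Γ).funJacobian_eq h𝒜 ht

variable (l : Fin 2 → Trajectory 𝒜 ε t₀ t₁ → B)

omit [CompleteSpace B] [GradedAlgebra 𝒜] h𝒜 ht in
theorem U_eq : S.U l Γ = ∑ a, outer (S.Xt a Γ) (funDeriv (l a) Γ) := by
  refine Kernel.ext (fun t => ?_) fun t t' => Matrix.ext fun p q => ?_
  · rw [sum_loc]; exact (Finset.sum_eq_zero fun _ _ => rfl).symm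
  · rw [sum_reg, Matrix.sum_apply]; rfl

theorem V₁_eq : S.V₁ l Γ = ofLoc fun t => (∑ a, Matrix.of fun p q =>
    sgn B (ε p + 1) * l a Γ * S.dX Γ a t p q : Matrix ι ι B) := by
  refine Kernel.ext (fun t => ?_) fun t t' => ?_
  · rw [V₁, sum_loc]
    simp_rw [S.funJacobian_Xt Γ h𝒜 ht]
    rfl
  · rw [V₁, sum_reg]
    refine Finset.sum_eq_zero fun a _ => ?_
    rw [S.funJacobian_Xt Γ h𝒜 ht]
    exact Matrix.ext fun p q => mul_zero _

variable (hl : ∀ a Γ, l a Γ ∈ 𝒜 1)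

include hl

theorem W_eq : S.W l Γ = ofLoc fun t => Matrix.of fun p q =>
    -(l 0 Γ * l 1 Γ * S.dY Γ t p q) := by
  rw [W, S.funJacobian_Yt Γ h𝒜 ht, sq_eq h𝒜 fun a => hl a Γ, smul_smul,
    show (-(1 / 2) : ℝ) * 2 = -1 by norm_num, neg_one_smul]
  refine Kernel.ext (fun t => Matrix.ext fun p q => ?_) fun t t' => Matrix.ext fun p q => ?_
  · rw [smul_loc, neg_mul]; rfl
  · exact mul_zero _

variable (hk : ∀ a, HasFunDerivAt (l a) (funDeriv (l a) Γ) Γ)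

include hk

theorem funDeriv_mem (a : Fin 2) (t : Set.Icc t₀ t₁) (q : ι) :
    funDeriv (l a) Γ t q ∈ 𝒜 (1 + ε q) := (hk a).mem h𝒜 ht (hl a) t q

theorem funDeriv_raise_zero :
    funDeriv (fun Γ' => raise (fun b => l b Γ') 0) Γ = funDeriv (l 1) Γ := by
  simp_rw [raise_zero]

theorem funDeriv_raise_one :
    funDeriv (fun Γ' => raise (fun b => l b Γ') 1) Γ = fun t q => -funDeriv (l 0) Γ t q := by
  simp_rw [raise_one]
  obtain ⟨hc, L, hL, e⟩ := hk 0
  refine HasFunDerivAt.funDeriv_eq h𝒜 ht ⟨hc.neg, -L, ?_, fun v => ?_⟩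
  · exact HasFDerivAt.fun_neg (𝕜 := ℝ) (E := Trajectory 𝒜 ε t₀ t₁) (F := B) hL
  · rw [neg_apply, e, ← integral_neg]
    simp [Finset.sum_neg_distrib]

/-- Moving λ_a across Y^p absorbs (-1)^{ε_p} and gives the form in which the product rule for Y λ_0
λ_1 delivers this term. -/
theorem V₂_eq : S.V₂ l Γ = ofReg fun t t' => Matrix.of fun p q =>
    -(S.Yt Γ t p * (l 0 Γ * funDeriv (l 1) Γ t' q - l 1 Γ * funDeriv (l 0) Γ t' q)) := by
  refine Kernel.ext (fun t => rfl) fun t t' => Matrix.ext fun p q => ?_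
  change ∑ a, sgn B (ε p + 1) * l a Γ * S.Yt Γ t p *
      funDeriv (fun Γ' => raise (fun b => l b Γ') a) Γ t' q = -(_ * _)
  have h (a : Fin 2) : sgn B (ε p + 1) * l a Γ * S.Yt Γ t p = -(S.Yt Γ t p * l a Γ) := by
    rw [mul_assoc, sgn_add_one_mul, h𝒜.supercomm (hl a Γ)
      (show S.Yt Γ t p ∈ 𝒜 (ε p) from S.Y_mem h𝒜 p (Γ t)), one_mul, ksign_smul_smul]
  rw [Fin.sum_univ_two, funDeriv_raise_zero Γ h𝒜 ht l hl hk,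
    funDeriv_raise_one Γ h𝒜 ht l hl hk, h, h]
  noncomm_ring

/-- Lowering one index and raising the other with the antisymmetric ε changes the sign, which
matches the extra minus in V₂. -/
theorem sum_Ymat : ∑ a, S.Ymat l Γ a a = S.V₂ l Γ := by
  rw [S.V₂_eq Γ h𝒜 ht l hl hk]
  refine Kernel.ext (fun t => ?_) fun t t' => Matrix.ext fun p q => ?_
  · rw [sum_loc]; exact Finset.sum_eq_zero fun _ _ => rfl
  rw [sum_reg, Matrix.sum_apply, Fin.sum_univ_two]
  have h (a : Fin 2) : sgn B (ε p) * l a Γ * S.Yt Γ t p = S.Yt Γ t p * l a Γ := by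
    rw [mul_assoc, sgn_mul, h𝒜.supercomm (hl a Γ)
      (show S.Yt Γ t p ∈ 𝒜 (ε p) from S.Y_mem h𝒜 p (Γ t)), one_mul, ksign_smul_smul]
  change sgn B (ε p) * raise (fun c => l c Γ) 0 * S.Yt Γ t p * funDeriv (l 0) Γ t' q +
    sgn B (ε p) * raise (fun c => l c Γ) 1 * S.Yt Γ t p * funDeriv (l 1) Γ t' q = -(_ * _)
  rw [raise_zero, raise_one, mul_neg, neg_mul, h, h]
  noncomm_ring

omit [CompleteSpace B] [DecidableEq ι] [GradedAlgebra 𝒜] h𝒜 ht hl hk in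
theorem hasFunDerivAt_funDeriv {F : Trajectory 𝒜 ε t₀ t₁ → B}
    (h : ∃ k, HasFunDerivAt F k Γ) : HasFunDerivAt F (funDeriv F Γ) Γ := by
  rw [funDeriv, dif_pos h]
  exact h.choose_spec

omit ht hk in
theorem ΔΓ_eq (t : Set.Icc t₀ t₁) (p : ι) : S.ΔΓ l Γ t p =
    ∑ a, S.X p a (Γ t) * l a Γ - S.Y p (Γ t) * (l 0 Γ * l 1 Γ) := by
  rw [ΔΓ, sq_eq h𝒜 fun a => hl a Γ, Y, sub_eq_add_neg]
  congr 1
  rw [mul_smul_comm, smul_smul, smul_mul_assoc, ← neg_smul]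
  norm_num

omit ht hk in
theorem exists_transformed_trajectory : ∃ Γ' : Trajectory 𝒜 ε t₀ t₁,
    ∀ t p, (Γ' t p : B) = (Γ t p : B) + S.ΔΓ l Γ t p := by
  have hmem (t p) : S.ΔΓ l Γ t p ∈ 𝒜 (ε p) := by
    rw [S.ΔΓ_eq Γ h𝒜 l hl]
    refine Submodule.sub_mem _ (Submodule.sum_mem _ fun a _ => ?_) ?_
    · refine mul_mem_of_eq (S.X_mem h𝒜 p a (Γ t)) (hl a Γ) ?_
      generalize ε p = i; revert i; decide
    · refine mul_mem_of_eq (S.Y_mem h𝒜 p (Γ t)) (mul_mem_of_eq (k := 0) (hl 0 Γ) (hl 1 Γ)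
        (by decide)) (by simp)
  have hcont (p) : Continuous fun t => S.ΔΓ l Γ t p := by
    simp_rw [S.ΔΓ_eq Γ h𝒜 l hl]
    have h1 := fun a => (S.X_isSuperC h𝒜 p a).continuous.comp Γ.continuous
    have h2 := (S.Y_isSuperC h𝒜 p).continuous.comp Γ.continuous
    exact (continuous_finsetSum _ fun a _ => (h1 a).mul continuous_const).sub
      (h2.mul continuous_const)
  refine ⟨⟨fun t p => Γ t p + ⟨S.ΔΓ l Γ t p, hmem t p⟩, continuous_pi fun p => ?_⟩,
    fun t p => rfl⟩
  exact ((continuous_apply p).comp Γ.continuous).add ((hcont p).subtype_mk _)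

/-- Product rule for Σ X^{pa} λ_a - Y^p λ_0 λ_1. Derivatives of X and Y are local in time and give
V₁ and W; derivatives of λ give the regular kernels U and V₂. -/
theorem hasFunJacobianAt_ΔΓ : HasFunJacobianAt (S.ΔΓ l) (S.U l Γ + S.V l Γ + S.W l Γ) Γ := by
  have hX := fun a => S.continuous_Xt Γ h𝒜 a
  have hY := S.continuous_Yt Γ h𝒜
  have hdX := fun a => S.continuous_dX Γ h𝒜 a
  have hdY := S.continuous_dY Γ h𝒜
  have hkc := fun a => (hk a).1
  have hloc (t p q) : (S.U l Γ + S.V l Γ + S.W l Γ).loc t p q =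
      ∑ a, sgn B (ε p + 1) * l a Γ * S.dX Γ a t p q - l 0 Γ * l 1 Γ * S.dY Γ t p q := by
    rw [V, S.V₁_eq Γ h𝒜 ht, S.W_eq Γ h𝒜 ht l hl]
    change (0 : B) + ((∑ a, Matrix.of fun p q => sgn B (ε p + 1) * l a Γ * S.dX Γ a t p q :
      Matrix ι ι B) p q + 0) + -_ = _
    rw [Matrix.sum_apply, zero_add, add_zero, ← sub_eq_add_neg]; rfl
  have hreg (t t' p q) : (S.U l Γ + S.V l Γ + S.W l Γ).reg t t' p q =
      ∑ a, S.Xt a Γ t p * funDeriv (l a) Γ t' q -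
      S.Yt Γ t p * (l 0 Γ * funDeriv (l 1) Γ t' q - l 1 Γ * funDeriv (l 0) Γ t' q) := by
    rw [V, S.V₁_eq Γ h𝒜 ht, S.W_eq Γ h𝒜 ht l hl, S.V₂_eq Γ h𝒜 ht l hl hk]
    change (∑ a, S.Xt a Γ t p * funDeriv (l a) Γ t' q) + (0 + -_) + (0 : B) = _
    rw [zero_add, add_zero, ← sub_eq_add_neg]
  refine ⟨continuous_matrix fun p q => ?_, continuous_matrix fun p q => ?_, fun t p => ?_⟩
  · simp_rw [hloc]
    have h1 := fun a => (hdX a).matrix_elem p q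
    have h2 := hdY.matrix_elem p q
    exact (continuous_finsetSum _ fun a _ => continuous_const.mul (h1 a)).sub
      (continuous_const.mul h2)
  · simp_rw [hreg]
    have h1 := fun a => (continuous_apply p).comp (hX a)
    have h2 := (continuous_apply p).comp hY
    have h3 := fun a => (continuous_apply q).comp (hkc a)
    exact (continuous_finsetSum _ fun a _ => ((h1 a).comp continuous_fst).mul
      ((h3 a).comp continuous_snd)).sub ((h2.comp continuous_fst).mul
      ((continuous_const.mul ((h3 1).comp continuous_snd)).sub
        (continuous_const.mul ((h3 0).comp continuous_snd))))
  have hΔ : (fun Γ' => S.ΔΓ l Γ' t p) = fun Γ' =>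
      ∑ a, S.X p a (Γ' t) * l a Γ' - S.Y p (Γ' t) * (l 0 Γ' * l 1 Γ') :=
    funext fun Γ' => S.ΔΓ_eq Γ' h𝒜 l hl t p
  have hkd := fun a => (hk a).hasKernelDerivAt t
  have hD := (HasKernelDerivAt.fun_sum (s := Finset.univ) fun a _ =>
    (((S.X_isSuperC h𝒜 p a).hasRightGradAt (Γ t)).hasKernelDerivAt (t := t)).mul h𝒜 (hkd a)
      (hl a Γ)).sub ((((S.Y_isSuperC h𝒜 p).hasRightGradAt (Γ t)).hasKernelDerivAt (t := t)).mul h𝒜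
        ((hkd 0).mul h𝒜 (hkd 1) (hl 1 Γ)) (mul_mem_of_eq (k := 0) (hl 0 Γ) (hl 1 Γ) (by decide)))
  rw [← hΔ] at hD
  obtain ⟨-, L, hL, e⟩ := hD
  refine ⟨L, hL, fun h => (e h).trans ?_⟩
  have e1 (a q) : ksign (ε q * 1) • (rderiv (S.X p a) q (Γ t) * l a Γ) =
      sgn B (ε p + 1) * l a Γ * S.dX Γ a t p q := by
    rw [mul_assoc, sgn_mul, dX, Matrix.of_apply, h𝒜.supercomm (hl a Γ)
      (S.rderiv_X_mem h𝒜 p a q (Γ t)), smul_smul]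
    congr 1
    generalize ε p = i; generalize ε q = j; revert i j; decide
  have e2 (q) : ksign (ε q * 0) • (rderiv (S.Y p) q (Γ t) * (l 0 Γ * l 1 Γ)) =
      l 0 Γ * l 1 Γ * S.dY Γ t p q := by
    rw [mul_zero, show ksign 0 = 1 by decide, one_smul, h𝒜.even_comm _
      (mul_mem_of_eq (k := 0) (hl 0 Γ) (hl 1 Γ) (by decide))]
    rfl
  have e3 (t' q) : ksign (ε q * 1) • (funDeriv (l 0) Γ t' q * l 1 Γ) =
      -(l 1 Γ * funDeriv (l 0) Γ t' q) := by
    rw [h𝒜.supercomm (funDeriv_mem Γ h𝒜 ht l hl hk 0 t' q) (hl 1 Γ), smul_smul, ← neg_one_smul ℤ]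
    congr 1
    generalize ε q = i; revert i; decide
  have e4 (q : ι) (x : B) : (0 : ι → B) q * x = 0 := zero_mul x
  have e5 (q : ι) (x : B) : x * (0 : ι → B) q = 0 := mul_zero x
  have e6 (t' : Set.Icc t₀ t₁) (q : ι) (x : B) : (0 : Set.Icc t₀ t₁ → ι → B) t' q * x = 0 :=
    zero_mul x
  congr 1
  · refine Finset.sum_congr rfl fun q _ => ?_
    rw [hloc]
    simp only [e1, e2, e4, e5, smul_zero, add_zero, zero_add]
    rw [mul_zero, zero_add]
  · refine integral_congr_ae (.of_forall fun t' => Finset.sum_congr rfl fun q _ => ?_)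
    rw [hreg]
    simp only [e3, e6, smul_zero, add_zero, ← sub_eq_add_neg]
    rfl
end ConstrainedSystem
end BAB

namespace BAB

/-- A continuous kernel as an element of the ring of continuous kernels. -/
def Kernel.IsCont.toContKernel {T ι B : Type*} [NormedRing B] [TopologicalSpace T]
    {A : Kernel T ι B} (hA : A.IsCont) : Kernel.ContKernel T ι B := ⟨A, hA⟩

namespace ConstrainedSystem

/-! ### Nilpotency of `V` and `W` -/

open Kernel

section Nilpotency

variable {B ι : Type*} [NormedRing B] [NormedAlgebra ℝ B] [CompleteSpace B] [Fintype ι]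
  [DecidableEq ι] {𝒜 : ZMod 2 → Submodule ℝ B} [GradedAlgebra 𝒜] {ε : ι → ZMod 2} {t₀ t₁ : ℝ}
  (S : ConstrainedSystem 𝒜 ε) (Γ : Trajectory 𝒜 ε t₀ t₁) (h𝒜 : IsSupernumberAlgebra 𝒜)
  (ht : t₀ < t₁) (l : Fin 2 → Trajectory 𝒜 ε t₀ t₁ → B) (hl : ∀ a Γ, l a Γ ∈ 𝒜 1)
  (hk : ∀ a, HasFunDerivAt (l a) (funDeriv (l a) Γ) Γ)

include h𝒜 ht hl

/-- The components of `λ^a Y`. -/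
noncomputable def raiseY (a : Fin 2) (t : Set.Icc t₀ t₁) (p : ι) : B :=
  sgn B (ε p) * raise (fun c => l c Γ) a * S.Yt Γ t p

omit ht hl in
theorem continuous_raiseY (a : Fin 2) : Continuous (S.raiseY Γ l a) :=
  continuous_pi fun p => continuous_const.mul ((continuous_apply p).comp (S.continuous_Yt Γ h𝒜))

theorem V₁_isHomog : (S.V₁ l Γ).IsHomog 𝒜 ε 0 := by
  rw [S.V₁_eq Γ h𝒜 ht]
  refine ⟨fun t p q => ?_, fun t t' p q => (𝒜 _).zero_mem⟩
  change (∑ a, Matrix.of fun p q => sgn B (ε p + 1) * l a Γ * S.dX Γ a t p q : Matrix ι ι B) p q ∈ _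
  rw [Matrix.sum_apply]
  refine Submodule.sum_mem _ fun a _ => ?_
  rw [Matrix.of_apply, mul_assoc, sgn_mul]
  refine zsmul_mem (mul_mem_of_eq (hl a Γ) (S.dX_hasParity Γ h𝒜 a t p q) ?_) _
  generalize ε p = i; generalize ε q = j; revert i j; decide

omit hl in
theorem V₁_isCont : (S.V₁ l Γ).IsCont := by
  rw [S.V₁_eq Γ h𝒜 ht]
  have h := fun a => S.continuous_dX Γ h𝒜 a
  have h' (a : Fin 2) : Continuous fun t => (Matrix.of fun p q =>
      sgn B (ε p + 1) * l a Γ * S.dX Γ a t p q : Matrix ι ι B) :=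
    continuous_matrix fun p q => continuous_const.mul ((h a).matrix_elem p q)
  exact ⟨show Continuous fun t => (∑ a, Matrix.of fun p q =>
    sgn B (ε p + 1) * l a Γ * S.dX Γ a t p q : Matrix ι ι B) from
      continuous_finsetSum _ fun a _ => h' a, continuous_const⟩

theorem W_isHomog : (S.W l Γ).IsHomog 𝒜 ε 0 := by
  rw [S.W_eq Γ h𝒜 ht l hl]
  refine ⟨fun t p q => ?_, fun t t' p q => (𝒜 _).zero_mem⟩
  exact Submodule.neg_mem _ (mul_mem_of_eq (mul_mem_of_eq (k := 0) (hl 0 Γ) (hl 1 Γ) (by decide))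
    (S.dY_hasParity Γ h𝒜 t p q) (by simp))

theorem W_isCont : (S.W l Γ).IsCont := by
  rw [S.W_eq Γ h𝒜 ht l hl]
  have h := S.continuous_dY Γ h𝒜
  exact ⟨continuous_matrix fun p q => (continuous_const.mul (h.matrix_elem p q)).neg,
    continuous_const⟩

include hk

theorem U_isHomog : (S.U l Γ).IsHomog 𝒜 ε 0 := by
  refine ⟨fun t p q => (𝒜 _).zero_mem, fun t t' p q => ?_⟩
  change ∑ a, S.Xt a Γ t p * funDeriv (l a) Γ t' q ∈ _
  refine Submodule.sum_mem _ fun a _ => ?_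
  refine mul_mem_of_eq (S.X_mem h𝒜 p a (Γ t)) (funDeriv_mem Γ h𝒜 ht l hl hk a t' q) ?_
  generalize ε p = i; generalize ε q = j; revert i j; decide

omit ht hl in
theorem U_isCont : (S.U l Γ).IsCont := by
  rw [S.U_eq]
  exact IsCont.sum fun a _ => isCont_outer (S.continuous_Xt Γ h𝒜 a) (hk a).1

omit ht hl in
theorem Ymat_isCont (a b : Fin 2) : (S.Ymat l Γ a b).IsCont :=
  isCont_outer (S.continuous_raiseY Γ h𝒜 l a) (hk b).1

theorem V₂_isCont : (S.V₂ l Γ).IsCont := by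
  rw [← S.sum_Ymat Γ h𝒜 ht l hl hk]
  exact IsCont.sum fun a _ => S.Ymat_isCont Γ h𝒜 l hk a a

theorem V₂_isHomog : (S.V₂ l Γ).IsHomog 𝒜 ε 0 := by
  rw [S.V₂_eq Γ h𝒜 ht l hl hk]
  refine ⟨fun t p q => (𝒜 _).zero_mem, fun t t' p q => Submodule.neg_mem _ ?_⟩
  have h (a b : Fin 2) : l a Γ * funDeriv (l b) Γ t' q ∈ 𝒜 (ε q) :=
    mul_mem_of_eq (hl a Γ) (funDeriv_mem Γ h𝒜 ht l hl hk b t' q) (by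
      generalize ε q = i; revert i; decide)
  exact mul_mem_of_eq (S.Y_mem h𝒜 p (Γ t)) (Submodule.sub_mem _ (h 0 1) (h 1 0)) (by simp)

theorem V_isCont : (S.V l Γ).IsCont :=
  (S.V₁_isCont Γ h𝒜 ht l).add (S.V₂_isCont Γ h𝒜 ht l hl hk)

theorem V_isHomog : (S.V l Γ).IsHomog 𝒜 ε 0 :=
  ⟨fun t => ((S.V₁_isHomog Γ h𝒜 ht l hl).loc t).add ((S.V₂_isHomog Γ h𝒜 ht l hl hk).loc t),
    fun t t' => ((S.V₁_isHomog Γ h𝒜 ht l hl).reg t t').add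
      ((S.V₂_isHomog Γ h𝒜 ht l hl hk).reg t t')⟩

theorem continuous_funDeriv_raise (a : Fin 2) :
    Continuous (funDeriv (fun Γ' => raise (fun b => l b Γ') a) Γ) := by
  fin_cases a
  · exact (funDeriv_raise_zero Γ h𝒜 ht l hl hk) ▸ (hk 1).1
  · exact (funDeriv_raise_one Γ h𝒜 ht l hl hk) ▸ (hk 0).1.neg

/-- `V` is of first order in the odd parameters `λ_a`. -/
theorem exists_V_eq : ∃ v : Fin 2 → ContKernel (Set.Icc t₀ t₁) ι B,
    (S.V_isCont Γ h𝒜 ht l hl hk).toContKernel =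
      ∑ a, oddDiag ε (l a Γ) * v a := by
  -- The cofactor of λ_a in V, with the sign that distinguishes (-1)^{ε_p + 1} from the (-1)^{ε_p}
  -- of `oddDiag`.
  have hc (a : Fin 2) : (-(funJacobian (S.Xt a) Γ + outer (S.Yt Γ)
      (funDeriv (fun Γ' => raise (fun b => l b Γ') a) Γ))).IsCont := by
    refine (IsCont.add ?_ (isCont_outer (S.continuous_Yt Γ h𝒜)
      (continuous_funDeriv_raise Γ h𝒜 ht l hl hk a))).neg
    rw [S.funJacobian_Xt Γ h𝒜 ht]
    exact ⟨S.continuous_dX Γ h𝒜 a, continuous_const⟩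
  refine ⟨fun a => (hc a).toContKernel, ContKernel.ext ?_⟩
  have hs (v : Fin 2 → ContKernel (Set.Icc t₀ t₁) ι B) : (∑ a, v a).1 = ∑ a, (v a).1 := by
    rw [Fin.sum_univ_two, Fin.sum_univ_two]; rfl
  rw [hs]
  simp_rw [oddDiag_mul]
  change S.V l Γ = _
  have e (p : ι) (x y : B) : sgn B (ε p) * x * -y = sgn B (ε p + 1) * x * y := by
    rw [mul_assoc, mul_assoc, sgn_mul, sgn_add_one_mul, mul_neg, smul_neg]
  refine Kernel.ext (fun t => Matrix.ext fun p q => ?_) fun t t' => Matrix.ext fun p q => ?_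
  · rw [V, V₁, add_loc, sum_loc, sum_loc, Matrix.add_apply, Matrix.sum_apply, Matrix.sum_apply]
    refine (add_zero _).trans (Finset.sum_congr rfl fun a _ => ?_)
    change sgn B (ε p + 1) * l a Γ * (funJacobian (S.Xt a) Γ).loc t p q =
      sgn B (ε p) * l a Γ * -((funJacobian (S.Xt a) Γ).loc t p q + 0)
    rw [e, add_zero]
  · rw [V, V₁, add_reg, sum_reg, sum_reg, Matrix.add_apply, Matrix.sum_apply, Matrix.sum_apply]
    rw [show (S.V₂ l Γ).reg t t' p q = ∑ a, sgn B (ε p + 1) * l a Γ * S.Yt Γ t p *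
      funDeriv (fun Γ' => raise (fun b => l b Γ') a) Γ t' q from rfl, ← Finset.sum_add_distrib]
    refine Finset.sum_congr rfl fun a _ => ?_
    change sgn B (ε p + 1) * l a Γ * (funJacobian (S.Xt a) Γ).reg t t' p q + _ =
      sgn B (ε p) * l a Γ * -((funJacobian (S.Xt a) Γ).reg t t' p q + S.Yt Γ t p * _)
    rw [e, mul_add, ← mul_assoc _ (S.Yt Γ t p)]

omit hk in
/-- `W` is of second order in the odd parameters `λ_a`. -/
theorem exists_W_eq : ∃ w : ContKernel (Set.Icc t₀ t₁) ι B,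
    (S.W_isCont Γ h𝒜 ht l hl).toContKernel =
      oddDiag ε (l 0 Γ) * oddDiag ε (l 1 Γ) * w := by
  have hc : (-(ofLoc (S.dY Γ))).IsCont :=
    IsCont.neg ⟨S.continuous_dY Γ h𝒜, continuous_const⟩
  refine ⟨hc.toContKernel, ContKernel.ext ?_⟩
  change S.W l Γ = _
  rw [mul_assoc, oddDiag_mul, oddDiag_mul, S.W_eq Γ h𝒜 ht l hl]
  refine Kernel.ext (fun t => Matrix.ext fun p q => ?_) fun t t' => Matrix.ext fun p q => ?_
  · change -(l 0 Γ * l 1 Γ * S.dY Γ t p q) =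
      sgn B (ε p) * l 0 Γ * (sgn B (ε p) * l 1 Γ * -S.dY Γ t p q)
    rw [mul_assoc (sgn B (ε p)), mul_assoc (sgn B (ε p)), sgn_mul, sgn_mul, mul_smul_comm,
      ksign_smul_smul]
    noncomm_ring
  · change (0 : B) = sgn B (ε p) * l 0 Γ * (sgn B (ε p) * l 1 Γ * -(0 : B))
    simp

/-- `U`, `V` and `W` as elements of the ring of even continuous kernels. -/
theorem exists_even : ∃ U V W : evenSubring (Set.Icc t₀ t₁) h𝒜 ε,
    U.1.1 = S.U l Γ ∧ V.1.1 = S.V l Γ ∧ W.1.1 = S.W l Γ ∧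
    (∀ x y, V * x * V * y * V = 0) ∧ (∀ x, V * x * W = 0) ∧ ∀ x, W * x * W = 0 := by
  obtain ⟨v, hv⟩ := S.exists_V_eq Γ h𝒜 ht l hl hk
  obtain ⟨w, hw⟩ := S.exists_W_eq Γ h𝒜 ht l hl
  have hcomm (a : Fin 2) (x : ContKernel (Set.Icc t₀ t₁) ι B)
      (hx : x ∈ evenSubring (Set.Icc t₀ t₁) h𝒜 ε) :
      oddDiag ε (l a Γ) * x = x * oddDiag ε (l a Γ) := oddDiag_comm h𝒜 (hl a Γ) hx
  have hanti (a b : Fin 2) : (oddDiag ε (l a Γ) * oddDiag ε (l b Γ) :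
      ContKernel (Set.Icc t₀ t₁) ι B) = -(oddDiag ε (l b Γ) * oddDiag ε (l a Γ)) :=
    oddDiag_anticomm h𝒜 (hl a Γ) (hl b Γ)
  have hsq (a : Fin 2) : (oddDiag ε (l a Γ) * oddDiag ε (l a Γ) :
      ContKernel (Set.Icc t₀ t₁) ι B) = 0 := by
    have h0 : l a Γ * l a Γ = 0 := by
      have := h𝒜.odd_anticomm _ (hl a Γ) _ (hl a Γ)
      exact smul_two_cancel (by rw [smul_zero, two_smul]; nth_rewrite 1 [this]; simp)
    refine ContKernel.ext ?_
    rw [oddDiag_mul]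
    refine Kernel.ext (fun t => Matrix.ext fun p q => ?_) fun t t' => Matrix.ext fun p q => ?_
    · change sgn B (ε p) * l a Γ * Matrix.diagonal (fun p => sgn B (ε p) * l a Γ) p q = 0
      rw [Matrix.diagonal_apply]
      split_ifs
      · rw [sgn_mul, smul_mul_smul_comm, h0, smul_zero]
      · rw [mul_zero]
    · exact mul_zero _
  -- W is also of first order, with λ_1 w as the coefficient of λ_0, so `mul_mul_eq_zero` applies to
  -- two W's.
  have hw' : (S.W_isCont Γ h𝒜 ht l hl).toContKernel =
      ∑ a, oddDiag ε (l a Γ) * ![oddDiag ε (l 1 Γ) * w, 0] a := by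
    rw [hw, Fin.sum_univ_two]
    simp [mul_assoc]
  have hVE := S.V_isHomog Γ h𝒜 ht l hl hk
  have hWE := S.W_isHomog Γ h𝒜 ht l hl
  refine ⟨⟨(S.U_isCont Γ h𝒜 l hk).toContKernel, S.U_isHomog Γ h𝒜 ht l hl hk⟩,
    ⟨(S.V_isCont Γ h𝒜 ht l hl hk).toContKernel, hVE⟩,
    ⟨(S.W_isCont Γ h𝒜 ht l hl).toContKernel, hWE⟩,
    rfl, rfl, rfl, fun x y => Subtype.ext ?_, fun x => Subtype.ext ?_, fun x => Subtype.ext ?_⟩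
  · exact mul_mul_mul_mul_eq_zero hcomm hanti hsq hVE x.2 y.2 hv
  · exact mul_mul_eq_zero hcomm hanti hsq hVE x.2 hv hw
  · exact mul_mul_eq_zero hcomm hanti hsq hWE x.2 hw' hw

end Nilpotency
end ConstrainedSystem
end BAB

namespace BAB
namespace ConstrainedSystem

/-! ### Products with `U` and supertraces -/

open Kernel

section Identities

variable {B ι : Type*} [NormedRing B] [NormedAlgebra ℝ B] [CompleteSpace B] [Fintype ι]
  [DecidableEq ι] {𝒜 : ZMod 2 → Submodule ℝ B} [GradedAlgebra 𝒜] {ε : ι → ZMod 2} {t₀ t₁ : ℝ}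
  (S : ConstrainedSystem 𝒜 ε) (Γ : Trajectory 𝒜 ε t₀ t₁) (h𝒜 : IsSupernumberAlgebra 𝒜)
  (ht : t₀ < t₁) (l : Fin 2 → Trajectory 𝒜 ε t₀ t₁ → B) (hl : ∀ a Γ, l a Γ ∈ 𝒜 1)
  (hk : ∀ a, HasFunDerivAt (l a) (funDeriv (l a) Γ) Γ)

/-- The kernel `N^a_b x^b δλ_a/δΓ`. -/
noncomputable def contract (x : Fin 2 → Set.Icc t₀ t₁ → ι → B) (N : Matrix (Fin 2) (Fin 2) B) :
    Kernel (Set.Icc t₀ t₁) ι B :=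
  ∑ a, ∑ b, N a b • outer (x b) (funDeriv (l a) Γ)

/-- The powers of U (x = X) and the products VU^n (x = λY) are instances of one construction, so
`contract_mul_U` serves both. -/
theorem trY_eq_contract (N : Matrix (Fin 2) (Fin 2) B) :
    S.trY l Γ N = contract Γ l (S.raiseY Γ l) N := rfl

theorem contract_one (x : Fin 2 → Set.Icc t₀ t₁ → ι → B) :
    contract Γ l x 1 = ∑ a, outer (x a) (funDeriv (l a) Γ) := by
  refine Finset.sum_congr rfl fun a _ => ?_
  rw [Finset.sum_eq_single a]
  · rw [Matrix.one_apply_eq, one_smul]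
  · intro b _ hb
    rw [Matrix.one_apply_ne hb.symm, zero_smul]
  · simp

theorem contract_add (x : Fin 2 → Set.Icc t₀ t₁ → ι → B) (N P : Matrix (Fin 2) (Fin 2) B) :
    contract Γ l x (N + P) = contract Γ l x N + contract Γ l x P := by
  simp only [contract, Matrix.add_apply, add_smul, Finset.sum_add_distrib]

theorem m_apply (a b : Fin 2) : S.m l Γ a b = pairing (funDeriv (l b) Γ) (S.Xt a Γ) := rfl

include h𝒜 ht hl hk

theorem continuous_pairing_integrand (a b : Fin 2) :
    Continuous fun t => ∑ q, funDeriv (l b) Γ t q * S.Xt a Γ t q := by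
  have h1 := S.continuous_Xt Γ h𝒜 a
  have h2 := (hk b).1
  fun_prop

/-- The entries of m are even, hence central, and can be pulled out of kernels on either side. -/
theorem m_mem (a b : Fin 2) : S.m l Γ a b ∈ 𝒜 0 := by
  refine integral_mem_of_isClosed (h𝒜.isClosed 0)
    (S.continuous_pairing_integrand Γ h𝒜 ht l hl hk a b) fun t => Submodule.sum_mem _ fun q _ => ?_
  refine mul_mem_of_eq (funDeriv_mem Γ h𝒜 ht l hl hk b t q) (S.X_mem h𝒜 q a (Γ t)) ?_
  generalize ε q = i; revert i; decide

theorem outer_mul_U {x : Set.Icc t₀ t₁ → ι → B} (hx : Continuous x) (a : Fin 2) :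
    outer x (funDeriv (l a) Γ) * S.U l Γ =
      ∑ b, S.m l Γ b a • outer x (funDeriv (l b) Γ) := by
  rw [S.U_eq, (isCont_outer hx (hk a).1).mul_sum fun b _ =>
    isCont_outer (S.continuous_Xt Γ h𝒜 b) (hk b).1]
  refine Finset.sum_congr rfl fun b _ => ?_
  rw [outer_mul_outer (hk a).1 (S.continuous_Xt Γ h𝒜 b), ← m_apply,
    smul_outer (h𝒜.even_comm _ (S.m_mem Γ h𝒜 ht l hl hk b a))]

/-- The covector δλ_a paired with X^c inside U yields m^c_a, so U acts on the coefficient matrix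
alone. -/
theorem contract_mul_U {x : Fin 2 → Set.Icc t₀ t₁ → ι → B} (hx : ∀ a, Continuous (x a))
    (N : Matrix (Fin 2) (Fin 2) B) :
    contract Γ l x N * S.U l Γ = contract Γ l x (S.m l Γ * N) := by
  have hU := S.U_isCont Γ h𝒜 l hk
  have ho (a b : Fin 2) := isCont_outer (hx b) (hk a).1
  have h1 : contract Γ l x N * S.U l Γ =
      ∑ a, ∑ b, ∑ c, (S.m l Γ c a * N a b) • outer (x b) (funDeriv (l c) Γ) := by
    rw [contract, IsCont.sum_mul (A := fun a => ∑ b, N a b • outer (x b) (funDeriv (l a) Γ))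
      (fun a _ => IsCont.sum fun b _ => (ho a b).smul _) hU]
    refine Finset.sum_congr rfl fun a _ => ?_
    rw [IsCont.sum_mul (A := fun b => N a b • outer (x b) (funDeriv (l a) Γ))
      (fun b _ => (ho a b).smul _) hU]
    refine Finset.sum_congr rfl fun b _ => ?_
    rw [(ho a b).smul_mul hU, S.outer_mul_U Γ h𝒜 ht l hl hk (hx b), Finset.smul_sum]
    refine Finset.sum_congr rfl fun c _ => ?_
    rw [smul_smul, h𝒜.even_comm _ (S.m_mem Γ h𝒜 ht l hl hk c a)]
  rw [h1, contract]
  simp_rw [Matrix.mul_apply, Finset.sum_smul]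
  rw [Finset.sum_comm]
  simp_rw [Finset.sum_comm (s := Finset.univ) (t := Finset.univ)
    (f := fun (a c : Fin 2) => (S.m l Γ c a * N a _) • outer (x _) (funDeriv (l c) Γ))]
  rw [Finset.sum_comm]

theorem U_pow_isCont (n : ℕ) : (S.U l Γ ^ n).IsCont := by
  have := ContKernel.val_pow (S.U_isCont Γ h𝒜 l hk).toContKernel n
  exact this ▸ ((S.U_isCont Γ h𝒜 l hk).toContKernel ^ n).2

/-- U itself has coefficient matrix e, hence the exponent n against n + 1. -/
theorem U_pow_succ (n : ℕ) :
    S.U l Γ ^ (n + 1) = contract Γ l (fun a => S.Xt a Γ) (S.m l Γ ^ n) := by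
  induction n with
  | zero =>
    rw [pow_zero, contract_one, ← S.U_eq]
    exact (S.U_isCont Γ h𝒜 l hk).one_mul
  | succ n ih =>
    change S.U l Γ ^ (n + 1) * S.U l Γ = _
    rw [ih, S.contract_mul_U Γ h𝒜 ht l hl hk (fun a => S.continuous_Xt Γ h𝒜 a), ← pow_succ']

/-- Origin of the minus in -tr: exchanging X^p and δλ/δΓ^p, both of parity ε_p + 1, costs (-1)^{ε_p
+ 1}, against (-1)^{ε_p} from the supertrace. -/
theorem str_outer_Xt (δ₀ : ℝ) (a b : Fin 2) :
    str ε δ₀ (outer (S.Xt b Γ) (funDeriv (l a) Γ)) = -S.m l Γ b a := by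
  rw [str_outer, m_apply, pairing, ← integral_neg]
  refine integral_congr_ae (.of_forall fun t => ?_)
  change ∑ p, _ = -∑ q, _
  rw [← Finset.sum_neg_distrib]
  refine Finset.sum_congr rfl fun p _ => ?_
  rw [sgn_mul, h𝒜.supercomm (show S.Xt b Γ t p ∈ 𝒜 (ε p + 1) from S.X_mem h𝒜 p b (Γ t))
    (funDeriv_mem Γ h𝒜 ht l hl hk a t p), smul_smul, ← neg_one_smul ℤ]
  congr 1
  generalize ε p = i; revert i; decide

theorem str_U_pow (δ₀ : ℝ) {n : ℕ} (hn : 1 ≤ n) :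
    str ε δ₀ (S.U l Γ ^ n) = -(S.m l Γ ^ n).trace := by
  obtain ⟨n, rfl⟩ := Nat.exists_eq_add_of_le' hn
  have ho (a b : Fin 2) := isCont_outer (S.continuous_Xt Γ h𝒜 b) (hk a).1
  rw [S.U_pow_succ Γ h𝒜 ht l hl hk, contract, pow_succ, Matrix.trace, ← Finset.sum_neg_distrib,
    str_sum (A := fun a => ∑ b, (S.m l Γ ^ n) a b • outer (S.Xt b Γ) (funDeriv (l a) Γ)) _ _
      fun a _ => IsCont.sum fun b _ => (ho a b).smul _]
  refine Finset.sum_congr rfl fun a _ => ?_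
  rw [str_sum (A := fun b => (S.m l Γ ^ n) a b • outer (S.Xt b Γ) (funDeriv (l a) Γ)) _ _
    fun b _ => (ho a b).smul _, Matrix.diag_apply, Matrix.mul_apply,
    ← Finset.sum_neg_distrib]
  refine Finset.sum_congr rfl fun b _ => ?_
  rw [str_smul (ho a b), S.str_outer_Xt Γ h𝒜 ht l hl hk, mul_neg]

/-- Applied to X^b, the matrix X^{pa}_{,q} gives s^b X^{pa} = ε^{ab} Y^p, and -ε^{ab} λ_a = λ^b. -/
theorem V₁_mul_outer (b : Fin 2) (y : Set.Icc t₀ t₁ → ι → B) :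
    S.V₁ l Γ * outer (S.Xt b Γ) y = outer (S.raiseY Γ l b) y := by
  rw [S.V₁_eq Γ h𝒜 ht, ofLoc_mul_outer]
  congr 1
  funext t p
  have h (a : Fin 2) : ∑ q, S.dX Γ a t p q * S.Xt b Γ t q = epsUp a b • S.Yt Γ t p :=
    (S.s_eq h𝒜 b (S.X p a) (Γ t)).symm.trans (S.s_X h𝒜 p a b (Γ t))
  have e : raise (fun c => l c Γ) b = -∑ a, epsUp a b • l a Γ := by
    fin_cases b <;> simp [raise, epsUp]
  simp only [Matrix.mulVec, dotProduct, Matrix.sum_apply, Matrix.of_apply, Finset.sum_mul]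
  rw [Finset.sum_comm, raiseY, e]
  simp_rw [mul_assoc, ← Finset.mul_sum, h, sgn_add_one_mul]
  rw [sgn_mul, neg_mul, Finset.sum_mul, smul_neg]
  simp_rw [mul_smul_comm, smul_mul_assoc]

theorem V₁_mul_U : S.V₁ l Γ * S.U l Γ = S.V₂ l Γ := by
  rw [S.U_eq, (S.V₁_isCont Γ h𝒜 ht l).mul_sum fun b _ =>
    isCont_outer (S.continuous_Xt Γ h𝒜 b) (hk b).1, ← S.sum_Ymat Γ h𝒜 ht l hl hk]
  exact Finset.sum_congr rfl fun b _ => S.V₁_mul_outer Γ h𝒜 ht l hl hk b _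

theorem V₂_eq_trY : S.V₂ l Γ = S.trY l Γ 1 := by
  rw [← S.sum_Ymat Γ h𝒜 ht l hl hk, trY_eq_contract, contract_one]
  rfl

/-- Since V₁U = V₂, the product VU is V₂ + V₂U, with coefficient e + m; each further U contributes
one m. -/
theorem V_mul_U_pow_succ (n : ℕ) :
    S.V l Γ * S.U l Γ ^ (n + 1) = S.trY l Γ (S.m l Γ ^ n * (1 + S.m l Γ)) := by
  have hU := S.U_isCont Γ h𝒜 l hk
  have hV := S.V_isCont Γ h𝒜 ht l hl hk
  have hm := S.contract_mul_U Γ h𝒜 ht l hl hk fun a => S.continuous_raiseY Γ h𝒜 l a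
  induction n with
  | zero =>
    rw [show S.U l Γ ^ (0 + 1) = S.U l Γ from hU.one_mul, V,
      (S.V₁_isCont Γ h𝒜 ht l).add_mul (S.V₂_isCont Γ h𝒜 ht l hl hk) hU,
      S.V₁_mul_U Γ h𝒜 ht l hl hk, S.V₂_eq_trY Γ h𝒜 ht l hl hk, trY_eq_contract, hm, mul_one,
      pow_zero, one_mul, trY_eq_contract, contract_add]
  | succ n ih =>
    rw [show S.U l Γ ^ (n + 1 + 1) = S.U l Γ ^ (n + 1) * S.U l Γ from rfl,
      ← hV.mul_assoc (S.U_pow_isCont Γ h𝒜 ht l hl hk _) hU, ih, trY_eq_contract, hm, ← mul_assoc,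
      ← pow_succ', trY_eq_contract]

theorem V_mul_U_pow {n : ℕ} (hn : 1 ≤ n) :
    S.V l Γ * S.U l Γ ^ n = S.trY l Γ (S.m l Γ ^ (n - 1) * (1 + S.m l Γ)) := by
  obtain ⟨n, rfl⟩ := Nat.exists_eq_add_of_le' hn
  exact S.V_mul_U_pow_succ Γ h𝒜 ht l hl hk n

/-- Each column of U is proportional to some X^b, and Y^p_{,q} X^{qb} = s^b Y^p = 0. -/
theorem W_mul_U : S.W l Γ * S.U l Γ = 0 := by
  rw [S.U_eq, (S.W_isCont Γ h𝒜 ht l hl).mul_sum fun b _ =>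
    isCont_outer (S.continuous_Xt Γ h𝒜 b) (hk b).1]
  refine Finset.sum_eq_zero fun b _ => ?_
  rw [S.W_eq Γ h𝒜 ht l hl, ofLoc_mul_outer]
  have h (t : Set.Icc t₀ t₁) (p : ι) : ∑ q, S.dY Γ t p q * S.Xt b Γ t q = 0 :=
    S.s_Y h𝒜 p b (Γ t)
  refine Kernel.ext (fun t => rfl) fun t t' => Matrix.ext fun p q => ?_
  rw [outer_reg]
  simp only [Matrix.mulVec, dotProduct, Matrix.of_apply]
  simp_rw [neg_mul, mul_assoc (l 0 Γ * l 1 Γ), Finset.sum_neg_distrib, ← Finset.mul_sum, h]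
  rw [mul_zero, neg_zero, zero_mul]
  rfl

omit hk in
-- The sign (-1)^{ε_p} of the supertrace cancels that of V₁, leaving the divergence of X^a at each
-- time.
theorem str_V₁ (δ₀ : ℝ) : str ε δ₀ (S.V₁ l Γ) = 0 := by
  rw [S.V₁_eq Γ h𝒜 ht, str_eq]
  have h1 (t : Set.Icc t₀ t₁) : matStr ε (∑ a, Matrix.of fun p q =>
      sgn B (ε p + 1) * l a Γ * S.dX Γ a t p q : Matrix ι ι B) = 0 := by
    have h2 (a : Fin 2) : ∑ p, S.dX Γ a t p p = 0 := S.sum_rderiv_X h𝒜 a (Γ t)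
    have h3 (a : Fin 2) (p : ι) : sgn B (ε p) * (sgn B (ε p + 1) * l a Γ * S.dX Γ a t p p) =
        -(l a Γ * S.dX Γ a t p p) := by
      rw [mul_assoc, sgn_mul, sgn_add_one_mul, smul_neg, ksign_smul_smul]
    simp_rw [matStr, Matrix.sum_apply, Matrix.of_apply, Finset.mul_sum, h3]
    rw [Finset.sum_comm]
    simp_rw [Finset.sum_neg_distrib, ← Finset.mul_sum, h2]
    simp
  change δ₀ • (∫ t, matStr ε (∑ a, Matrix.of fun p q =>
      sgn B (ε p + 1) * l a Γ * S.dX Γ a t p q : Matrix ι ι B)) +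
        ∫ t : Set.Icc t₀ t₁, matStr ε (0 : Matrix ι ι B) = 0
  simp_rw [h1]
  simp [matStr]

omit hk in
-- Both kernels are local. In V₁² the two mixed terms agree, as both λ_0, λ_1 and the odd matrices
-- anticommute under the supertrace. Their sum is -2 λ_0 λ_1 times the supertrace of X^0_{,r}
-- X^1_{,q}, which by `str_rderiv_Y` is twice that of W.
theorem str_W_sub (δ₀ : ℝ) :
    str ε δ₀ (S.W l Γ) - (1 / 2 : ℝ) • str ε δ₀ (S.V₁ l Γ ^ 2) = 0 := by
  have hsq : S.V₁ l Γ ^ 2 = S.V₁ l Γ * S.V₁ l Γ :=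
    congrArg (· * S.V₁ l Γ) (S.V₁_isCont Γ h𝒜 ht l).one_mul
  have hreg (t : Set.Icc t₀ t₁) : (S.V₁ l Γ * S.V₁ l Γ).reg t t = 0 := by
    have h0 (t t') : (S.V₁ l Γ).reg t t' = 0 := by rw [S.V₁_eq Γ h𝒜 ht]; rfl
    rw [(S.V₁_isCont Γ h𝒜 ht l).mul_reg (S.V₁_isCont Γ h𝒜 ht l)]
    simp [h0]
  have hz (t : Set.Icc t₀ t₁) : matStr ε (S.dX Γ 1 t * S.dX Γ 0 t) =
      -matStr ε (S.dX Γ 0 t * S.dX Γ 1 t) := by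
    rw [matStr_mul_comm h𝒜 (S.dX_hasParity Γ h𝒜 1 t) (S.dX_hasParity Γ h𝒜 0 t),
      show ksign 1 = -1 by decide, neg_one_smul]
  have hY (t : Set.Icc t₀ t₁) : matStr ε (S.dY Γ t) = matStr ε (S.dX Γ 0 t * S.dX Γ 1 t) := by
    simp_rw [matStr, sgn_mul, Matrix.mul_apply, Finset.smul_sum]
    exact S.str_rderiv_Y h𝒜 (Γ t)
  have hW (t : Set.Icc t₀ t₁) : matStr ε ((S.W l Γ).loc t) =
      -(l 0 Γ * l 1 Γ * matStr ε (S.dX Γ 0 t * S.dX Γ 1 t)) := by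
    rw [← hY, S.W_eq Γ h𝒜 ht l hl]
    change ∑ p, sgn B (ε p) * -(l 0 Γ * l 1 Γ * S.dY Γ t p p) = _
    rw [matStr, Finset.mul_sum, ← Finset.sum_neg_distrib]
    refine Finset.sum_congr rfl fun p _ => ?_
    rw [sgn_mul, sgn_mul, smul_neg, mul_smul_comm]
  have hVloc (t : Set.Icc t₀ t₁) (p q : ι) : (S.V₁ l Γ * S.V₁ l Γ).loc t p q =
      -∑ a, ∑ b, l a Γ * l b Γ * (S.dX Γ a t * S.dX Γ b t) p q := by
    rw [mul_loc, S.V₁_eq Γ h𝒜 ht]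
    change ((∑ a, Matrix.of fun p q => sgn B (ε p + 1) * l a Γ * S.dX Γ a t p q : Matrix ι ι B) *
      (∑ a, Matrix.of fun p q => sgn B (ε p + 1) * l a Γ * S.dX Γ a t p q : Matrix ι ι B)) p q = _
    simp_rw [Finset.sum_mul, Finset.mul_sum, Matrix.sum_apply, Matrix.mul_apply, Matrix.of_apply]
    rw [← Finset.sum_neg_distrib]
    refine Finset.sum_congr rfl fun a _ => ?_
    rw [← Finset.sum_neg_distrib]
    refine Finset.sum_congr rfl fun b _ => ?_
    rw [Finset.mul_sum, ← Finset.sum_neg_distrib]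
    refine Finset.sum_congr rfl fun r _ => ?_
    rw [mul_assoc (sgn B (ε p + 1)) (l a Γ), mul_assoc (sgn B (ε r + 1)) (l b Γ), sgn_mul, sgn_mul,
      smul_mul_smul_comm,
      mul_assoc (l a Γ), ← mul_assoc (S.dX Γ a t p r),
      h𝒜.supercomm (S.dX_hasParity Γ h𝒜 a t p r) (hl b Γ), smul_mul_assoc, mul_smul_comm, smul_smul,
      mul_assoc (l a Γ), mul_assoc (l b Γ), ← neg_one_smul ℤ]
    congr 1
    generalize ε p = i; generalize ε r = j; revert i j; decide
  have hV (t : Set.Icc t₀ t₁) : matStr ε ((S.V₁ l Γ * S.V₁ l Γ).loc t) =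
      (2 : ℝ) • matStr ε ((S.W l Γ).loc t) := by
    have h1 : matStr ε ((S.V₁ l Γ * S.V₁ l Γ).loc t) =
        -∑ a, ∑ b, l a Γ * l b Γ * matStr ε (S.dX Γ a t * S.dX Γ b t) := by
      simp_rw [matStr, hVloc, mul_neg, Finset.sum_neg_distrib, Finset.mul_sum]
      rw [Finset.sum_comm]
      congr 1
      refine Finset.sum_congr rfl fun a _ => ?_
      rw [Finset.sum_comm]
      refine Finset.sum_congr rfl fun b _ => Finset.sum_congr rfl fun p _ => ?_
      rw [sgn_mul, sgn_mul, mul_smul_comm]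
    have h0 (a : Fin 2) : l a Γ * l a Γ = 0 := by
      have := h𝒜.odd_anticomm _ (hl a Γ) _ (hl a Γ)
      exact smul_two_cancel (by rw [smul_zero, two_smul]; nth_rewrite 1 [this]; simp)
    rw [h1, hW, Fin.sum_univ_two, Fin.sum_univ_two, Fin.sum_univ_two, h0, h0, hz,
      h𝒜.odd_anticomm _ (hl 1 Γ) _ (hl 0 Γ), two_smul]
    noncomm_ring
  have hWreg (t : Set.Icc t₀ t₁) : (S.W l Γ).reg t t = 0 := by rw [S.W_eq Γ h𝒜 ht l hl]; rfl
  rw [hsq, str_eq, str_eq]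
  simp_rw [hreg, hWreg, hV]
  rw [integral_smul, smul_add, smul_comm (1 / 2 : ℝ) δ₀, smul_smul (1 / 2 : ℝ)]
  simp [matStr]

end Identities
end ConstrainedSystem
end BAB

namespace BAB

/-! ### Supertraces of powers -/

section EvenTrace

open Kernel Finset

theorem trace_add_pow_two_or_three {R B : Type*} [Ring R] [AddCommGroup B] [Module ℝ B] (τ : R →+ B)
    (hτ : ∀ x y, τ (x * y) = τ (y * x)) (U : R) {V : R} (hV : V ^ 3 = 0) {n : ℕ}
    (hn : n = 2 ∨ n = 3) :
    τ ((U + V) ^ n) = ∑ k ∈ range (n + 1), n.choose k • τ (U ^ (n - k) * V ^ k) ∧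
      τ ((U + V) ^ n) =
        τ (U ^ n + n.choose 1 • (U ^ (n - 1) * V) + n.choose 2 • (U ^ (n - 2) * V ^ 2)) := by
  obtain rfl | rfl := hn
  · rw [trace_add_sq τ hτ]
    constructor
    · simp [sum_range_succ]
    · simp [-nsmul_eq_mul]
  · rw [trace_add_cube τ hτ, hV]
    constructor
    · simp [sum_range_succ, Nat.choose, hV]
    · simp [Nat.choose, -nsmul_eq_mul]

variable {T ι B : Type*} [NormedRing B] [NormedAlgebra ℝ B]
  [TopologicalSpace T] [CompactSpace T] [T2Space T] [SecondCountableTopology T]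
  [MeasureSpace T] [BorelSpace T] [IsFiniteMeasure (volume : Measure T)]
  [CompleteSpace B] [Fintype ι] [DecidableEq ι] {𝒜 : ZMod 2 → Submodule ℝ B} [GradedAlgebra 𝒜]
  {ε : ι → ZMod 2} {h𝒜 : IsSupernumberAlgebra 𝒜}

variable (T h𝒜 ε) in
/-- The supertrace on the ring of even continuous kernels. -/
noncomputable def strEven (δ₀ : ℝ) : evenSubring T h𝒜 ε →+ B :=
  (strHom ε δ₀).comp (evenSubring T h𝒜 ε).subtype.toAddMonoidHom

theorem strEven_apply (δ₀ : ℝ) (A : evenSubring T h𝒜 ε) :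
    strEven T ε h𝒜 δ₀ A = str ε δ₀ A.1.1 := rfl

theorem strEven_mul_comm (δ₀ : ℝ) (A C : evenSubring T h𝒜 ε) :
    strEven T ε h𝒜 δ₀ (A * C) = strEven T ε h𝒜 δ₀ (C * A) :=
  IsHomog.str_mul_comm h𝒜 A.2 C.2 A.1.2 C.1.2 δ₀

theorem evenSubring_val_add (A C : evenSubring T h𝒜 ε) : (A + C).1.1 = A.1.1 + C.1.1 := rfl

theorem evenSubring_val_mul (A C : evenSubring T h𝒜 ε) : (A * C).1.1 = A.1.1 * C.1.1 := rfl

theorem evenSubring_val_nsmul (n : ℕ) (A : evenSubring T h𝒜 ε) : (n • A).1.1 = n • A.1.1 := by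
  induction n with
  | zero => rw [zero_smul, zero_smul]; rfl
  | succ n ih => rw [succ_nsmul, succ_nsmul, evenSubring_val_add, ih]

theorem evenSubring_val_pow (A : evenSubring T h𝒜 ε) (n : ℕ) : (A ^ n).1.1 = A.1.1 ^ n := by
  rw [Subring.coe_pow, ContKernel.val_pow]

end EvenTrace

/-! ### Series -/

section Series

open Finset

theorem summable_norm_pow_of_norm_pow_lt_one {R : Type*} [NormedRing R] {x : R} {K : ℕ}
    (hK : 0 < K) (h : ‖x ^ K‖ < 1) : Summable fun n : ℕ => ‖x ^ n‖ := by
  have : NeZero K := ⟨hK.ne'⟩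
  rw [← (Nat.divModEquiv K).symm.summable_iff]
  have hs : Summable fun i : ℕ × Fin K => ‖x ^ K‖ ^ i.1 * ‖x ^ (i.2 : ℕ)‖ :=
    (summable_geometric_of_lt_one (norm_nonneg _) h).mul_of_nonneg
      (.of_finite (f := fun r : Fin K => ‖x ^ (r : ℕ)‖)) (fun _ => by positivity) fun _ => by
        positivity
  refine hs.of_nonneg_of_le (fun _ => norm_nonneg _) fun ⟨q, r⟩ => ?_
  change ‖x ^ (q * K + r)‖ ≤ ‖x ^ K‖ ^ q * ‖x ^ (r : ℕ)‖
  -- The norm of 1 is not assumed to be 1, so ‖y^q‖ ≤ ‖y‖^q is available only for q > 0.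
  rcases q.eq_zero_or_pos with rfl | hq
  · simp
  · rw [mul_comm q, pow_add, pow_mul]
    exact (norm_mul_le _ _).trans (by gcongr; exact norm_pow_le' _ hq)

/-- If no positive power had norm below 1, the series would dominate the harmonic series; one such
power already gives geometric decay. -/
theorem summable_norm_pow_of_summable_div {R : Type*} [NormedRing R] {x : R}
    (h : Summable fun k : ℕ => ‖x ^ (k + 1)‖ / (k + 1)) : Summable fun n : ℕ => ‖x ^ n‖ := by
  by_cases hx : ∃ k : ℕ, ‖x ^ (k + 1)‖ < 1
  · obtain ⟨k, hk⟩ := hx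
    exact summable_norm_pow_of_norm_pow_lt_one k.succ_pos hk
  · push Not at hx
    refine absurd ?_ Real.not_summable_one_div_natCast
    rw [← summable_nat_add_iff 1]
    refine h.of_nonneg_of_le (fun k => by positivity) fun k => ?_
    push_cast
    gcongr
    exact hx k

variable {B : Type*} [NormedRing B] [CompleteSpace B]

/-- Cauchy product, meant for the double sums of Str (VU^i VU^j), with u the coefficients and b the
traces of products in a fixed finite family. -/
theorem hasSum_antidiagonal_bilinear {κ : Type*} [Fintype κ] {u : ℕ → κ → B} {δ : κ → B}
    (hs : ∀ x, Summable fun i => ‖u i x‖) (hu : ∀ x, HasSum (fun i => u i x) (δ x))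
    (b : κ → κ → B) :
    HasSum (fun k => ∑ ij ∈ antidiagonal k, ∑ x, ∑ y, u ij.1 x * (u ij.2 y * b x y))
      (∑ x, ∑ y, δ x * (δ y * b x y)) := by
  have h (x y : κ) : HasSum (fun k => ∑ ij ∈ antidiagonal k, u ij.1 x * u ij.2 y)
      (δ x * δ y) := by
    have h1 := (summable_norm_sum_mul_antidiagonal_of_summable_norm (hs x) (hs y)).of_norm.hasSum
    rwa [← tsum_mul_tsum_eq_tsum_sum_antidiagonal_of_summable_norm (hs x) (hs y),
      (hu x).tsum_eq, (hu y).tsum_eq] at h1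
  have h2 := hasSum_sum (s := univ) fun x _ => hasSum_sum (s := univ) fun y _ =>
    (h x y).mul_right (b x y)
  simp_rw [mul_assoc] at h2
  refine h2.congr_fun fun k => ?_
  simp_rw [sum_mul]
  rw [sum_comm]
  refine sum_congr rfl fun x _ => ?_
  rw [sum_comm]
  simp_rw [mul_assoc]

variable [NormedAlgebra ℝ B]

theorem logCoeff_zero : logCoeff 0 = 1 := by simp [logCoeff]

/-- The number of cyclic rotations cancels the denominator, which turns the logarithmic series into
a geometric one. -/
theorem logCoeff_succ_mul (k : ℕ) : logCoeff (k + 1) * (k + 2 : ℕ) = -(-1) ^ k := by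
  rw [logCoeff]
  push_cast
  have : (k : ℝ) + 1 + 1 ≠ 0 := by positivity
  rw [show (k : ℝ) + 2 = k + 1 + 1 by ring, neg_mul, div_mul_cancel₀ _ this]
  ring

section MatrixNorm

attribute [local instance] Matrix.linftyOpNormedRing

theorem norm_apply_le_linfty_opNorm {n : Type*} [Fintype n] [DecidableEq n] (A : Matrix n n B)
    (a b : n) : ‖A a b‖ ≤ ‖A‖ := by
  rw [Matrix.linfty_opNorm_def]
  have h1 : ‖A a b‖₊ ≤ ∑ j, ‖A a j‖₊ :=
    single_le_sum (f := fun j => ‖A a j‖₊) (fun _ _ => zero_le) (mem_univ b)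
  exact_mod_cast h1.trans (le_sup (f := fun i => ∑ j, ‖A i j‖₊) (mem_univ a))

theorem linfty_opNorm_le_sum {n : Type*} [Fintype n] [DecidableEq n] (A : Matrix n n B) :
    ‖A‖ ≤ ∑ a, ∑ b, ‖A a b‖ := by
  rw [Matrix.linfty_opNorm_def]
  have h : (univ.sup fun i => ∑ j, ‖A i j‖₊) ≤ ∑ i, ∑ j, ‖A i j‖₊ :=
    Finset.sup_le fun i _ =>
      single_le_sum (f := fun i => ∑ j, ‖A i j‖₊) (fun _ _ => zero_le) (mem_univ i)
  exact (NNReal.coe_le_coe.2 h).trans_eq (by push_cast; rfl)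

/-- If the series `ln (e + m)` converges absolutely, then so does the geometric series. -/
theorem summable_norm_pow_apply {n : Type*} [Fintype n] [DecidableEq n] {m : Matrix n n B}
    (h : ∀ a b, Summable fun k : ℕ => ‖logCoeff k • (m ^ (k + 1)) a b‖) (a b : n) :
    Summable fun k : ℕ => ‖(m ^ k) a b‖ := by
  have hc (k : ℕ) (x : B) : ‖logCoeff k • x‖ = ‖x‖ / (k + 1) := by
    rw [norm_smul, logCoeff, norm_neg, norm_div, norm_pow, norm_neg, norm_one, one_pow,
      Real.norm_of_nonneg (by positivity)]
    ring
  simp_rw [hc] at h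
  have h1 : Summable fun k : ℕ => ‖m ^ (k + 1)‖ / (k + 1) := by
    refine (summable_sum (s := univ) fun a _ => summable_sum (s := univ) fun b _ =>
      h a b).of_nonneg_of_le (fun k => by positivity) fun k => ?_
    simp_rw [← sum_div]
    gcongr
    exact linfty_opNorm_le_sum _
  exact (summable_norm_pow_of_summable_div h1).of_nonneg_of_le (fun _ => norm_nonneg _)
    fun k => norm_apply_le_linfty_opNorm _ a b

end MatrixNorm

/-- The coefficients `e` and `m^{n-1} (e + m)` of the products `V U^n`. -/
def geomCoeff {n : Type*} [Fintype n] [DecidableEq n] (m : Matrix n n B) : ℕ → Matrix n n B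
  | 0 => 1
  | i + 1 => m ^ i * (1 + m)

theorem summable_norm_geomCoeff {n : Type*} [Fintype n] [DecidableEq n] {m : Matrix n n B}
    {a b : n} (h : Summable fun k : ℕ => ‖(m ^ k) a b‖) :
    Summable fun i => ‖(-1 : ℝ) ^ i • geomCoeff m i a b‖ := by
  have e (i : ℕ) (x : B) : ‖(-1 : ℝ) ^ i • x‖ = ‖x‖ := by simp [norm_smul]
  simp_rw [e]
  rw [← summable_nat_add_iff 1]
  refine (h.add ((summable_nat_add_iff 1).2 h)).of_nonneg_of_le (fun _ => norm_nonneg _)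
    fun i => ?_
  rw [geomCoeff, mul_add, mul_one, ← pow_succ, Matrix.add_apply]
  exact norm_add_le _ _

/-- For i ≥ 1 the terms telescope to -e, which cancels the term i = 0. Thus the Y-part of V(𝕀 + U)⁻¹
vanishes. -/
theorem hasSum_geomCoeff {n : Type*} [Fintype n] [DecidableEq n] {m : Matrix n n B}
    {a b : n} (h : Summable fun k : ℕ => ‖(m ^ k) a b‖) :
    HasSum (fun i => (-1 : ℝ) ^ i • geomCoeff m i a b) 0 := by
  have e (i : ℕ) (x : B) : ‖(-1 : ℝ) ^ i • x‖ = ‖x‖ := by simp [norm_smul]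
  have hs : Summable fun i : ℕ => (-1 : ℝ) ^ i • (m ^ i) a b :=
    Summable.of_norm (by simpa only [e] using h)
  have h1 := ((hasSum_nat_add_iff' 1).2 hs.hasSum).sub hs.hasSum
  rw [← hasSum_nat_add_iff' 1]
  convert h1 using 1
  · funext i
    rw [geomCoeff, mul_add, mul_one, ← pow_succ, Matrix.add_apply, pow_succ (-1 : ℝ)]
    module
  · simp [geomCoeff]

end Series
end BAB

namespace BAB
namespace ConstrainedSystem

/-! ### The logarithm of the Jacobian -/

open Kernel

section Jacobian

variable {B ι : Type*} [NormedRing B] [NormedAlgebra ℝ B] [CompleteSpace B] [Fintype ι]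
  [DecidableEq ι] {𝒜 : ZMod 2 → Submodule ℝ B} [GradedAlgebra 𝒜] {ε : ι → ZMod 2} {t₀ t₁ : ℝ}
  (S : ConstrainedSystem 𝒜 ε) (Γ : Trajectory 𝒜 ε t₀ t₁) (h𝒜 : IsSupernumberAlgebra 𝒜)
  (ht : t₀ < t₁) (l : Fin 2 → Trajectory 𝒜 ε t₀ t₁ → B) (hl : ∀ a Γ, l a Γ ∈ 𝒜 1)
  (hk : ∀ a, HasFunDerivAt (l a) (funDeriv (l a) Γ) Γ)

include h𝒜 ht hl hk

theorem M_eq : S.M l Γ = S.U l Γ + S.V l Γ + S.W l Γ :=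
  (S.hasFunJacobianAt_ΔΓ Γ h𝒜 ht l hl hk).funJacobian_eq h𝒜 ht

theorem str_M_pow (δ₀ : ℝ) {n : ℕ} (hn : 1 ≤ n) :
    str ε δ₀ (S.M l Γ ^ n) =
      str ε δ₀ ((S.U l Γ + S.V l Γ) ^ n) + n • str ε δ₀ (S.U l Γ ^ (n - 1) * S.W l Γ) := by
  obtain ⟨U, V, W, hU, hV, hW, -, hVW, hWW⟩ := S.exists_even Γ h𝒜 ht l hl hk
  rw [S.M_eq Γ h𝒜 ht l hl hk, ← hU, ← hV, ← hW]
  simpa only [strEven_apply, evenSubring_val_pow, evenSubring_val_mul, evenSubring_val_add] using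
    trace_add_add_pow (strEven _ ε h𝒜 δ₀) (strEven_mul_comm δ₀) (U := U) hVW hWW hn

/-- Cyclicity brings W in front of U, and WU = 0. -/
theorem str_U_pow_mul_W (δ₀ : ℝ) (n : ℕ) : str ε δ₀ (S.U l Γ ^ (n + 1) * S.W l Γ) = 0 := by
  obtain ⟨U, -, W, hU, -, hW, -⟩ := S.exists_even Γ h𝒜 ht l hl hk
  have h0 : W * U = 0 := Subtype.ext (ContKernel.ext (by
    rw [evenSubring_val_mul, hU, hW, S.W_mul_U Γ h𝒜 ht l hl hk]; rfl))
  have h := strEven_mul_comm δ₀ (U ^ (n + 1)) W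
  rw [pow_succ' U, ← mul_assoc W, h0, zero_mul, map_zero, ← pow_succ'] at h
  rwa [strEven_apply, evenSubring_val_mul, evenSubring_val_pow, hU, hW] at h

theorem str_M_pow_of_one_lt (δ₀ : ℝ) {n : ℕ} (hn : 1 < n) :
    str ε δ₀ (S.M l Γ ^ n) = str ε δ₀ ((S.U l Γ + S.V l Γ) ^ n) := by
  obtain ⟨n, rfl⟩ := Nat.exists_eq_add_of_le' hn
  rw [S.str_M_pow Γ h𝒜 ht l hl hk δ₀ hn.le, show n + 1 + 1 - 1 = n + 1 from rfl,
    S.str_U_pow_mul_W Γ h𝒜 ht l hl hk, smul_zero, add_zero]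

theorem str_M_one (δ₀ : ℝ) : str ε δ₀ (S.M l Γ ^ 1) =
    str ε δ₀ (S.U l Γ + S.V l Γ) + str ε δ₀ (S.W l Γ) := by
  have hW := S.W_isCont Γ h𝒜 ht l hl
  have hUV := (S.U_isCont Γ h𝒜 l hk).add (S.V_isCont Γ h𝒜 ht l hl hk)
  rw [S.M_eq Γ h𝒜 ht l hl hk, ← hUV.str_add hW]
  exact congrArg (str ε δ₀) (hUV.add hW).one_mul

/-- The terms of the series `Str ln (𝕀 + M)`, ordered by the powers of `V`. -/
theorem logCoeff_smul_str_M_pow (δ₀ : ℝ) (k : ℕ) :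
    logCoeff (k + 1) • str ε δ₀ (S.M l Γ ^ (k + 2)) =
      -(logCoeff (k + 1) • (S.m l Γ ^ (k + 2)).trace) +
      (-1 : ℝ) ^ (k + 1) • str ε δ₀ (S.V l Γ * S.U l Γ ^ (k + 1)) +
      (-(1 / 2) : ℝ) • (-1 : ℝ) ^ k • ∑ ij ∈ Finset.HasAntidiagonal.antidiagonal k,
        str ε δ₀ (S.V l Γ * S.U l Γ ^ ij.1 * (S.V l Γ * S.U l Γ ^ ij.2)) := by
  have hU' := S.str_U_pow Γ h𝒜 ht l hl hk δ₀ (n := k + 2) (by omega)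
  rw [S.str_M_pow_of_one_lt Γ h𝒜 ht l hl hk δ₀ (by omega)]
  obtain ⟨U, V, -, hU, hV, -, hVV, -⟩ := S.exists_even Γ h𝒜 ht l hl hk
  obtain ⟨b, h1, h2⟩ := trace_add_pow_add_two (strEven _ ε h𝒜 δ₀) (strEven_mul_comm δ₀) hVV
    (U := U) k
  have h3 (i j : ℕ) : strEven _ ε h𝒜 δ₀ (U ^ i * V * (U ^ j * V)) =
      strEven _ ε h𝒜 δ₀ (V * U ^ j * (V * U ^ i)) := by
    rw [mul_assoc, strEven_mul_comm]; congr 1; noncomm_ring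
  have h4 : ∑ ij ∈ Finset.HasAntidiagonal.antidiagonal k,
        strEven _ ε h𝒜 δ₀ (U ^ ij.1 * V * (U ^ ij.2 * V)) =
      ∑ ij ∈ Finset.HasAntidiagonal.antidiagonal k,
        strEven _ ε h𝒜 δ₀ (V * U ^ ij.1 * (V * U ^ ij.2)) := by
    rw [← Finset.Nat.sum_antidiagonal_swap]
    exact Finset.sum_congr rfl fun ij _ => h3 _ _
  rw [h4, ← Nat.cast_smul_eq_nsmul ℝ] at h2
  rw [strEven_mul_comm δ₀ (U ^ (k + 1)), ← Nat.cast_smul_eq_nsmul ℝ] at h1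
  have h5 : b = (1 / 2 : ℝ) • (2 : ℝ) • b := by rw [smul_smul]; norm_num
  simp only [strEven_apply, evenSubring_val_pow, evenSubring_val_mul, evenSubring_val_add, hU, hV]
    at h1 h2
  -- At n = k + 2 the one-V words carry weight n and the two-V words n/2; the coefficient of the
  -- logarithm turns these into alternating signs and the factor -½.
  rw [h1, h5, h2, hU', smul_add, smul_add, smul_smul, logCoeff_succ_mul, smul_neg, pow_succ,
    smul_comm (logCoeff (k + 1)), smul_smul (logCoeff (k + 1)), logCoeff_succ_mul]
  module

omit h𝒜 ht hl hk in
/-- The kernels through which the products `V U^n` are expressed. -/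
noncomputable def basicKernel : Option (Fin 2 × Fin 2) → Kernel (Set.Icc t₀ t₁) ι B
  | none => S.V₁ l Γ
  | some (a, b) => S.Ymat l Γ b a

omit h𝒜 ht hl hk in
/-- The coefficients of the products `V U^n`. -/
noncomputable def basicCoeff (i : ℕ) : Option (Fin 2 × Fin 2) → B
  | none => if i = 0 then 1 else 0
  | some (a, b) => geomCoeff (S.m l Γ) i a b

theorem basicKernel_isCont (x : Option (Fin 2 × Fin 2)) : (S.basicKernel Γ l x).IsCont := by
  match x with
  | none => exact S.V₁_isCont Γ h𝒜 ht l
  | some (a, b) => exact S.Ymat_isCont Γ h𝒜 l hk b a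

theorem m_pow_mem (n : ℕ) (a b : Fin 2) : (S.m l Γ ^ n) a b ∈ 𝒜 0 := by
  induction n generalizing a b with
  | zero =>
    rw [pow_zero, Matrix.one_apply]
    split_ifs
    · exact SetLike.GradedOne.one_mem
    · exact Submodule.zero_mem _
  | succ n ih =>
    rw [pow_succ, Matrix.mul_apply]
    exact Submodule.sum_mem _ fun c _ =>
      mul_mem_of_eq (ih a c) (S.m_mem Γ h𝒜 ht l hl hk c b) (by simp)

theorem basicCoeff_mem (i : ℕ) (x : Option (Fin 2 × Fin 2)) : S.basicCoeff Γ l i x ∈ 𝒜 0 := by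
  match i, x with
  | 0, none => exact SetLike.GradedOne.one_mem
  | i + 1, none => exact Submodule.zero_mem _
  | 0, some (a, b) => exact S.m_pow_mem Γ h𝒜 ht l hl hk 0 a b
  | i + 1, some (a, b) =>
    change (S.m l Γ ^ i * (1 + S.m l Γ)) a b ∈ _
    rw [mul_add, mul_one, ← pow_succ]
    exact Submodule.add_mem _ (S.m_pow_mem Γ h𝒜 ht l hl hk _ a b)
      (S.m_pow_mem Γ h𝒜 ht l hl hk _ a b)

/-- All VU^i lie in the span of one finite family, so convergence is a matter of the coefficients.
V₁ occurs only at i = 0, because V₁U = V₂ already belongs to the Y-part. -/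
theorem V_mul_U_pow_eq_sum (i : ℕ) :
    S.V l Γ * S.U l Γ ^ i = ∑ x, S.basicCoeff Γ l i x • S.basicKernel Γ l x := by
  rw [Fintype.sum_option, Fintype.sum_prod_type]
  cases i with
  | zero =>
    change S.V l Γ * 1 = (1 : B) • S.V₁ l Γ + S.trY l Γ 1
    rw [(S.V_isCont Γ h𝒜 ht l hl hk).mul_one, one_smul, ← S.V₂_eq_trY Γ h𝒜 ht l hl hk, V]
  | succ i =>
    rw [S.V_mul_U_pow_succ Γ h𝒜 ht l hl hk]
    change _ = (0 : B) • S.V₁ l Γ + S.trY l Γ (S.m l Γ ^ i * (1 + S.m l Γ))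
    rw [zero_smul, zero_add]

theorem str_V_mul_U_pow (δ₀ : ℝ) (i : ℕ) : str ε δ₀ (S.V l Γ * S.U l Γ ^ i) =
    ∑ x, S.basicCoeff Γ l i x * str ε δ₀ (S.basicKernel Γ l x) := by
  have hE := S.basicKernel_isCont Γ h𝒜 ht l hl hk
  rw [S.V_mul_U_pow_eq_sum Γ h𝒜 ht l hl hk, str_sum _ _ fun x _ => (hE x).smul _]
  exact Finset.sum_congr rfl fun x _ => str_smul (hE x)

theorem str_V_mul_U_pow_mul (δ₀ : ℝ) (i j : ℕ) :
    str ε δ₀ (S.V l Γ * S.U l Γ ^ i * (S.V l Γ * S.U l Γ ^ j)) =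
      ∑ x, ∑ y, S.basicCoeff Γ l i x * (S.basicCoeff Γ l j y *
        str ε δ₀ (S.basicKernel Γ l x * S.basicKernel Γ l y)) := by
  have hE := S.basicKernel_isCont Γ h𝒜 ht l hl hk
  have hcE (i x) : (S.basicCoeff Γ l i x • S.basicKernel Γ l x).IsCont := (hE x).smul _
  rw [S.V_mul_U_pow_eq_sum Γ h𝒜 ht l hl hk i, S.V_mul_U_pow_eq_sum Γ h𝒜 ht l hl hk j,
    IsCont.sum_mul (fun x _ => hcE i x) (IsCont.sum fun y _ => hcE j y),
    str_sum _ _ fun x _ => (hcE i x).mul (IsCont.sum fun y _ => hcE j y)]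
  refine Finset.sum_congr rfl fun x _ => ?_
  rw [(hcE i x).mul_sum fun y _ => hcE j y, str_sum _ _ fun y _ => (hcE i x).mul (hcE j y)]
  refine Finset.sum_congr rfl fun y _ => ?_
  rw [(hE x).smul_mul (hcE j y), (hE x).mul_smul (hE y)
    (h𝒜.even_comm _ (S.basicCoeff_mem Γ h𝒜 ht l hl hk j y)),
    str_smul (((hE x).mul (hE y)).smul _), str_smul ((hE x).mul (hE y))]

/-- The series is split by order in V. Since Σ (-1)^i VU^i has coefficients summing to those of V₁,
the first order gives Str V₁ = 0 and the second -½ Str V₁², which cancels Str W. -/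
theorem hasSum_log_jacobian (δ₀ : ℝ)
    (hs : ∀ a b, Summable fun k : ℕ => ‖logCoeff k • (S.m l Γ ^ (k + 1)) a b‖) :
    HasSum (fun k : ℕ => logCoeff k • str ε δ₀ (S.M l Γ ^ (k + 1)))
      (-(matLog (S.m l Γ)).trace) := by
  have hg := summable_norm_pow_apply hs
  set u : ℕ → Option (Fin 2 × Fin 2) → B := fun i x => (-1 : ℝ) ^ i • S.basicCoeff Γ l i x with hu
  -- The limits of the coefficient series: only V₁, indexed by `none`, survives.
  set δ : Option (Fin 2 × Fin 2) → B := fun x => if x = none then 1 else 0 with hδ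
  have hδ0 (x : Fin 2 × Fin 2) : δ (some x) = 0 := if_neg (by simp)
  have hδ1 : δ none = 1 := if_pos rfl
  have hfin (i) (hi : i ∉ ({0} : Finset ℕ)) : u i none = 0 := by
    simp only [hu, basicCoeff]
    rw [if_neg (by simpa using hi), smul_zero]
  have hsu (x) : Summable fun i => ‖u i x‖ := by
    match x with
    | none => exact summable_of_ne_finset_zero (s := {0}) fun i hi => by rw [hfin i hi, norm_zero]
    | some (a, b) => exact summable_norm_geomCoeff (hg a b)
  have hsum (x) : HasSum (fun i => u i x) (δ x) := by
    match x with
    | none =>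
      have h := hasSum_single (f := fun i => u i none) 0 fun i hi => hfin i (by simpa using hi)
      rwa [show u 0 none = δ none by simp [hu, hδ, basicCoeff]] at h
    | some (a, b) => rw [hδ0]; exact hasSum_geomCoeff (hg a b)
  -- the terms without `V`
  have h0 : HasSum (fun k : ℕ => -(logCoeff k • (S.m l Γ ^ (k + 1)).trace))
      (-(matLog (S.m l Γ)).trace) := by
    refine HasSum.neg ?_
    have h := hasSum_sum (s := Finset.univ) fun a (_ : a ∈ Finset.univ) =>
      (hs a a).of_norm.hasSum
    refine h.congr_fun fun k => ?_
    rw [Matrix.trace, Finset.smul_sum]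
    rfl
  -- the terms of first order in `V`
  have h1 : HasSum (fun k : ℕ => (-1 : ℝ) ^ k • str ε δ₀ (S.V l Γ * S.U l Γ ^ k)) 0 := by
    have h := hasSum_sum (s := Finset.univ) fun x (_ : x ∈ Finset.univ) =>
      (hsum x).mul_right (str ε δ₀ (S.basicKernel Γ l x))
    rw [Fintype.sum_option, hδ1, one_mul, Finset.sum_eq_zero (s := Finset.univ)
      (f := fun x => δ (some x) * _) fun x _ => by rw [hδ0, zero_mul], add_zero,
      show S.basicKernel Γ l none = S.V₁ l Γ from rfl, S.str_V₁ Γ h𝒜 ht l hl] at h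
    refine h.congr_fun fun k => ?_
    rw [S.str_V_mul_U_pow Γ h𝒜 ht l hl hk, Finset.smul_sum]
    exact Finset.sum_congr rfl fun x _ => (smul_mul_assoc _ _ _).symm
  -- the terms of second order in `V`
  have h2 : HasSum (fun k : ℕ => (-1 : ℝ) ^ k • ∑ ij ∈ Finset.HasAntidiagonal.antidiagonal k,
      str ε δ₀ (S.V l Γ * S.U l Γ ^ ij.1 * (S.V l Γ * S.U l Γ ^ ij.2)))
      (str ε δ₀ (S.V₁ l Γ * S.V₁ l Γ)) := by
    have h := hasSum_antidiagonal_bilinear hsu hsum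
      fun x y => str ε δ₀ (S.basicKernel Γ l x * S.basicKernel Γ l y)
    have hval (b : Option (Fin 2 × Fin 2) → Option (Fin 2 × Fin 2) → B) :
        ∑ x, ∑ y, δ x * (δ y * b x y) = b none none := by
      simp [Fintype.sum_option, hδ1, hδ0]
    rw [hval] at h
    refine h.congr_fun fun k => ?_
    rw [Finset.smul_sum]
    refine Finset.sum_congr rfl fun ij hij => ?_
    rw [S.str_V_mul_U_pow_mul Γ h𝒜 ht l hl hk, Finset.smul_sum,
      ← Finset.HasAntidiagonal.mem_antidiagonal.1 hij]
    refine Finset.sum_congr rfl fun x _ => ?_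
    rw [Finset.smul_sum]
    refine Finset.sum_congr rfl fun y _ => ?_
    simp only [hu]
    rw [smul_mul_assoc, smul_mul_assoc, mul_smul_comm, smul_smul, pow_add]
  have hsq : S.V₁ l Γ ^ 2 = S.V₁ l Γ * S.V₁ l Γ :=
    congrArg (· * S.V₁ l Γ) (S.V₁_isCont Γ h𝒜 ht l).one_mul
  have hW := S.str_W_sub Γ h𝒜 ht l hl δ₀
  rw [hsq, sub_eq_zero] at hW
  -- With orders zero and one removed, the term n = 1 is Str W and the terms n ≥ 2 are of second
  -- order in V; they add up to zero.
  have h3 : HasSum (fun k : ℕ => logCoeff k • str ε δ₀ (S.M l Γ ^ (k + 1)) -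
      (-(logCoeff k • (S.m l Γ ^ (k + 1)).trace) +
        (-1 : ℝ) ^ k • str ε δ₀ (S.V l Γ * S.U l Γ ^ k))) 0 := by
    rw [← hasSum_nat_add_iff' 1]
    refine (?_ : ∀ z, z = (-(1 / 2) : ℝ) • str ε δ₀ (S.V₁ l Γ * S.V₁ l Γ) → HasSum _ z) _ ?_
    · rintro _ rfl
      refine (h2.const_smul (-(1 / 2) : ℝ)).congr_fun fun k => ?_
      rw [S.logCoeff_smul_str_M_pow Γ h𝒜 ht l hl hk, add_sub_cancel_left]
    · have hV := S.V_isCont Γ h𝒜 ht l hl hk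
      have hU := S.str_U_pow Γ h𝒜 ht l hl hk δ₀ le_rfl
      rw [show S.U l Γ ^ 1 = S.U l Γ from (S.U_isCont Γ h𝒜 l hk).one_mul] at hU
      rw [Finset.sum_range_one, logCoeff_zero, one_smul, one_smul, pow_zero, one_smul, zero_add,
        show S.V l Γ * S.U l Γ ^ 0 = S.V l Γ from hV.mul_one, S.str_M_one Γ h𝒜 ht l hl hk, hW,
        (S.U_isCont Γ h𝒜 l hk).str_add hV, hU]
      module
  simpa using h3.add (h0.add h1)

end Jacobian
end ConstrainedSystem
end BAB

/-! ### The main theorem. -/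

theorem mainTheorem2 {B : Type*} [NormedRing B] [NormedAlgebra ℝ B] [CompleteSpace B]
    (𝒜 : ZMod 2 → Submodule ℝ B) [GradedAlgebra 𝒜] (h𝒜 : IsSupernumberAlgebra 𝒜)
    {ι : Type*} [Fintype ι] [DecidableEq ι] (ε : ι → ZMod 2)
    (S : ConstrainedSystem 𝒜 ε) (t₀ t₁ : ℝ) (ht : t₀ < t₁)
    (l : Fin 2 → Trajectory 𝒜 ε t₀ t₁ → B) (hl_odd : ∀ a Γ, l a Γ ∈ 𝒜 1)
    (Γ : Trajectory 𝒜 ε t₀ t₁) (hl_diff : ∀ a, ∃ k, HasFunDerivAt (l a) k Γ)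
    (δ₀ : ℝ) :
    let m := S.m l Γ
    let M := S.M l Γ
    let U := S.U l Γ
    let V₁ := S.V₁ l Γ
    let V := S.V l Γ
    let W := S.W l Γ
    let Str : Kernel (Set.Icc t₀ t₁) ι B → B := Kernel.str ε δ₀
    -- the transformed trajectory is a trajectory, and `M`, the Jacobian matrix of `ΔΓ`, exists
    (∃ Γ' : Trajectory 𝒜 ε t₀ t₁, ∀ t p, (Γ' t p : B) = (Γ t p : B) + S.ΔΓ l Γ t p) ∧
    HasFunJacobianAt (S.ΔΓ l) M Γ ∧
    M = U + V + W ∧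
    -- reduction of `Str (M ^ n)`
    (∀ n : ℕ, 1 ≤ n → Str (M ^ n) = Str ((U + V) ^ n) + n • Str (U ^ (n - 1) * W)) ∧
    Str (M ^ 1) = Str (U + V) + Str W ∧
    (∀ n : ℕ, 1 < n → Str (M ^ n) = Str ((U + V) ^ n)) ∧
    -- expansion of `Str ((U + V) ^ n)`
    (∀ n : ℕ, n = 2 ∨ n = 3 →
      Str ((U + V) ^ n) = ∑ k ∈ Finset.range (n + 1), n.choose k • Str (U ^ (n - k) * V ^ k) ∧
      Str ((U + V) ^ n) =
        Str (U ^ n + n.choose 1 • (U ^ (n - 1) * V) + n.choose 2 • (U ^ (n - 2) * V ^ 2))) ∧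
    (∀ k : ℕ, 2 ≤ k →
      Str ((U + V) ^ (2 * k)) =
        ∑ i ∈ Finset.range 2, (2 * k).choose i • Str (U ^ (2 * k - i) * V ^ i) +
        (2 * k).choose 1 •
          ∑ i ∈ Finset.range (k - 1), Str (U ^ (2 * (k - i - 1)) * (U ^ i * V) ^ 2) +
        k.choose 1 • Str ((U ^ (k - 1) * V) ^ 2)) ∧
    (∀ k : ℕ, 2 ≤ k →
      Str ((U + V) ^ (2 * k + 1)) =
        ∑ i ∈ Finset.range 2, (2 * k + 1).choose i • Str (U ^ (2 * k + 1 - i) * V ^ i) +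
        (2 * k + 1).choose 1 •
          ∑ i ∈ Finset.range k, Str (U ^ (2 * (k - i) - 1) * (U ^ i * V) ^ 2)) ∧
    -- the matrices `V₁` and `W`
    Str V₁ = 0 ∧
    Str W - (1 / 2 : ℝ) • Str (V₁ ^ 2) = 0 ∧
    -- powers of `U`
    (∀ n : ℕ, 1 ≤ n → Str (U ^ n) = -(m ^ n).trace) ∧
    (∀ n : ℕ, 1 ≤ n → V * U ^ n = S.trY l Γ (m ^ (n - 1) * (1 + m))) ∧
    ∑ a, S.Ymat l Γ a a = S.V₂ l Γ ∧
    -- `ℑ = Str ln (𝕀 + M) = - tr ln (e + m)`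
    ((∀ a b, Summable fun k : ℕ => ‖logCoeff k • (m ^ (k + 1)) a b‖) →
      HasSum (fun k : ℕ => logCoeff k • Str (M ^ (k + 1))) (-(matLog m).trace)) := by
  -- Differentiability ensures that `funDeriv` is the genuine derivative and not its default value
  -- 0.
  have hk (a : Fin 2) : HasFunDerivAt (l a) (funDeriv (l a) Γ) Γ :=
    ConstrainedSystem.hasFunDerivAt_funDeriv Γ (hl_diff a)
  have hM := S.M_eq Γ h𝒜 ht l hl_odd hk
  -- The word counts take place in the ring of even kernels and are carried back to `Kernel` through
  -- the underlying values.
  obtain ⟨U, V, W, hU, hV, -, hVV, -⟩ := S.exists_even Γ h𝒜 ht l hl_odd hk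
  have hV3 : V ^ 3 = 0 := by
    have := hVV 1 1
    rwa [mul_one, mul_one, ← pow_two, ← pow_succ] at this
  have hτ := strEven_mul_comm (T := Set.Icc t₀ t₁) (h𝒜 := h𝒜) (ε := ε) δ₀
  refine ⟨S.exists_transformed_trajectory Γ h𝒜 l hl_odd,
    hM ▸ S.hasFunJacobianAt_ΔΓ Γ h𝒜 ht l hl_odd hk, hM,
    fun n hn => S.str_M_pow Γ h𝒜 ht l hl_odd hk δ₀ hn,
    S.str_M_one Γ h𝒜 ht l hl_odd hk δ₀,
    fun n hn => S.str_M_pow_of_one_lt Γ h𝒜 ht l hl_odd hk δ₀ hn,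
    fun n hn => ?_, fun k hk' => ?_, fun k hk' => ?_,
    S.str_V₁ Γ h𝒜 ht l hl_odd δ₀, S.str_W_sub Γ h𝒜 ht l hl_odd δ₀,
    fun n hn => S.str_U_pow Γ h𝒜 ht l hl_odd hk δ₀ hn,
    fun n hn => S.V_mul_U_pow Γ h𝒜 ht l hl_odd hk hn,
    S.sum_Ymat Γ h𝒜 ht l hl_odd hk, S.hasSum_log_jacobian Γ h𝒜 ht l hl_odd hk δ₀⟩
  · rw [← hU, ← hV]
    simpa only [strEven_apply, evenSubring_val_pow, evenSubring_val_mul, evenSubring_val_add,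
      evenSubring_val_nsmul] using trace_add_pow_two_or_three (strEven _ ε h𝒜 δ₀) hτ U hV3 hn
  · rw [← hU, ← hV]
    simpa only [strEven_apply, evenSubring_val_pow, evenSubring_val_mul, evenSubring_val_add] using
      trace_add_pow_even (strEven _ ε h𝒜 δ₀) hτ (U := U) hVV (one_le_two.trans hk')
  · rw [← hU, ← hV]
    simpa only [strEven_apply, evenSubring_val_pow, evenSubring_val_mul, evenSubring_val_add] using
      trace_add_pow_odd (strEven _ ε h𝒜 δ₀) hτ (U := U) hVV (one_le_two.trans hk')
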